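/- Let $-\infty<a<b<\infty$, $\mathcal T=[a,b]$, and let $U$ be either the open interval $(a,b)$ or the closed interval $[a,b]$. Consider the functional linear model $y_i(t)=\mathbf x_i^T\boldsymbol\beta(t)+v_i(t)+\varepsilon_i(t)$, $t\in\mathcal T$, $i=1,2,\dots$, with individual functions $f_i(t)=\mathbf x_i^T\boldsymbol\beta(t)+v_i(t)$, where the $\mathbf x_i$ are random vectors in $\mathbb R^q$; the $v_i$ are i.i.d. copies of a square-integrable process with mean $0$ and covariance function $\gamma(s,t)$; the $\varepsilon_i$ are i.i.d. copies of a square-integrable process with mean $0$ and covariance function $\sigma^2(t)1_{\{s=t\}}$; and covariates, subject effects, errors and design points are mutually independent. Subject $i$ is observed as $y_{ij}=f_i(t_{ij})+\varepsilon_i(t_{ij})$, $j=1,\dots,n_i$, where $n_i$ may depend on $n$. Let $p$ be odd, $K_h(u)=K(u/h)/h$. The $p$-order local polynomial kernel (LPK) reconstruction is $\hat f_i(t)=\mathbf e_1^T(\mathbf Z_i^T\mathbf K_{ih}\mathbf Z_i)^{-1}\mathbf Z_i^T\mathbf K_{ih}\mathbf y_i$, where $\mathbf y_i=[y_{i1},\dots,y_{in_i}]^T$,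 $\mathbf Z_i$ has rows $[1,t_{ij}-t,\dots,(t_{ij}-t)^p]$ and $\mathbf K_{ih}=\mathrm{diag}(K_h(t_{i1}-t),\dots,K_h(t_{in_i}-t))$. With $\mathbf X=[\mathbf x_1,\dots,\mathbf x_n]^T$, $\mathbf P=\mathbf X(\mathbf X^T\mathbf X)^{-1}\mathbf X^T$, $\hat{\mathbf f}=[\hat f_1,\dots,\hat f_n]^T$ and $\mathbf f=[f_1,\dots,f_n]^T$, put $$\hat{\boldsymbol\beta}(t)=(\mathbf X^T\mathbf X)^{-1}\mathbf X^T\hat{\mathbf f}(t),\qquad \hat\gamma(s,t)=\frac{[(\mathbf I_n-\mathbf P)\hat{\mathbf f}(s)]^T(\mathbf I_n-\mathbf P)\hat{\mathbf f}(t)}{n-q},$$ and let the ideal estimators $\tilde{\boldsymbol\beta}(t)$, $\tilde\gamma(s,t)$ be given by the same formulas with $\mathbf f$ in place of $\hat{\mathbf f}$. (Inverses of singular matrices, which occur with probability tending to $0$, are set to $0$.) For random quantities $X_n(\alpha)$, write $X_n(\alpha)=O_{UP}(1)$ if they are bounded in probability uniformly in the parameter $\alpha$: for every $\epsilon>0$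 there is $M$ such that, for all large $n$, $P(|X_n(\alpha)|>M)\le\epsilon$ for all admissible $\alpha$; here $\alpha$ consists of subjects $i\le n$ (if any) and time points (if any), which range over a compact set $S\subseteq U$, and the property is required for every such $S$. (For $U=[a,b]$ one may take $S=[a,b]$.) Assume Condition A: (1) the $t_{ij}$ are i.i.d. with a density $\pi$ that vanishes outside $[a,b]$ and is positive and continuously differentiable on $U$; (2) on $U$, $\boldsymbol\beta$ and (almost surely) the $f_i$ are $p+1$ times continuously differentiable and $\sigma^2$ is continuous, and the partial derivatives $\partial_s^k\partial_t^l\gamma$, $0\le k,l\le p+1$, exist and are continuous on $U\times U$; (3) $K$ is a bounded symmetric probability density vanishing outside $[-1,1]$; (4) there are constants $C,\delta>0$ with $n_i\ge Cn^\delta$ for all $i=1,\dots,n$, and the bandwidths $h=h_n>0$ satisfy $h\to0$, $n^\delta h\to\infty$. Assume Condition B: (1) the $\mathbf x_i$ are i.i.d. with finite, invertible second moment $\mathbf\Omega=E\,\mathbf x_1\mathbf x_1^T$, and $\mathbf x_i=O_{UP}(1)$; (2) $v_i(t)=O_{UP}(1)$. Finally assume that $h$ is of exact order $n^{-\delta/(2p+3)}$,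 i.e. $h\,n^{\delta/(2p+3)}$ is bounded above and bounded away from $0$ for large $n$. Then $$\hat{\boldsymbol\beta}(t)=\tilde{\boldsymbol\beta}(t)+n^{-(p+1)\delta/(2p+3)}O_{UP}(1),\qquad \hat\gamma(s,t)=\tilde\gamma(s,t)+n^{-(p+1)\delta/(2p+3)}O_{UP}(1).$$ If in addition $\delta>1+1/[2(p+1)]$, then $\sqrt n\{\hat{\boldsymbol\beta}(t)-\boldsymbol\beta(t)\}$ is asymptotically a centred Gaussian process with covariance function $\gamma(s,t)\mathbf\Omega^{-1}$: for all $t_1,\dots,t_k\in U$, the joint law of its values at $t_1,\dots,t_k$ converges weakly to the corresponding centred Gaussian law. -/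

import Mathlib

open MeasureTheory ProbabilityTheory Filter Set Asymptotics
open scoped Matrix ENNReal

noncomputable section

namespace FLM

variable {Ω : Type*} [MeasurableSpace Ω]

/-! ### Stochastic vocabulary -/

/-- `X ~ SP(m, c)` on the time domain `[a, b]`: a stochastic process with finite second moments,
mean function `m` and covariance function `c`. -/
structure IsSP (P : Measure Ω) (a b : ℝ) (X : ℝ → Ω → ℝ) (m : ℝ → ℝ) (c : ℝ → ℝ → ℝ) : Prop where
  measurable : ∀ s ∈ Icc a b, Measurable (X s)
  memLp : ∀ s ∈ Icc a b, MemLp (X s) 2 P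
  mean : ∀ s ∈ Icc a b, ∫ ω, X s ω ∂P = m s
  cov : ∀ s ∈ Icc a b, ∀ t ∈ Icc a b, covariance (X s) (X t) P = c s t

/-- `X = O_UP(1)`: the variables `X n α` are bounded in probability as `n → ∞`, uniformly over all
parameters `α` in the set `A n` (parameters are time points, pairs of time points, subjects, or
pairs of a subject and a time point). -/
def IsOUP {ι E : Type*} [Norm E] (P : Measure Ω) (A : ℕ → Set ι) (X : ℕ → ι → Ω → E) : Prop :=
  ∀ ε : ℝ, 0 < ε → ∃ M : ℝ, ∀ᶠ n in atTop, ∀ α ∈ A n, P {ω | M < ‖X n α ω‖} ≤ ENNReal.ofReal ε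

/-- `Z ~ AGP(0, Γ)` on `U`: the `ℝ^q`-valued random functions `Z n` are asymptotically a centred
Gaussian process with matrix covariance function `Γ`, i.e. every finite-dimensional marginal
at times in `U` converges in distribution to the corresponding Gaussian vector. -/
def IsAGP {q : ℕ} (P : Measure Ω) [IsProbabilityMeasure P] (U : Set ℝ)
    (Z : ℕ → ℝ → Ω → (Fin q → ℝ)) (Γ : ℝ → ℝ → Matrix (Fin q) (Fin q) ℝ) : Prop :=
  ∀ (k : ℕ) (s : Fin k → ℝ), (∀ c, s c ∈ U) →
    TendstoInDistribution
      (fun (n : ℕ) (ω : Ω) =>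
        (WithLp.toLp 2 (fun cr : Fin k × Fin q => Z n (s cr.1) ω cr.2) :
          EuclideanSpace ℝ (Fin k × Fin q)))
      atTop id (fun _ => P)
      (multivariateGaussian 0
        (Matrix.of fun cr ds : Fin k × Fin q => Γ (s cr.1) (s ds.1) cr.2 ds.2))

/-- `γ` has continuous mixed partial derivatives `γ_{k,l}`, `0 ≤ k, l ≤ m`, on `U × U`;
`g k l` is `γ_{k,l}`. -/
def HasContMixedDerivs (m : ℕ) (U : Set ℝ) (γ : ℝ → ℝ → ℝ) : Prop :=
  ∃ g : ℕ → ℕ → ℝ → ℝ → ℝ,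
    (∀ s ∈ U, ∀ t ∈ U, g 0 0 s t = γ s t) ∧
    (∀ k ≤ m, ∀ l ≤ m, ContinuousOn (fun st : ℝ × ℝ => g k l st.1 st.2) (U ×ˢ U)) ∧
    (∀ k < m, ∀ l ≤ m, ∀ s ∈ U, ∀ t ∈ U,
      HasDerivWithinAt (fun s' => g k l s' t) (g (k + 1) l s t) U s) ∧
    (∀ k ≤ m, ∀ l < m, ∀ s ∈ U, ∀ t ∈ U,
      HasDerivWithinAt (fun t' => g k l s t') (g k (l + 1) s t) U t)

/-! ### Local polynomial kernel smoothing -/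

/-- The matrix `Z` with rows `[1, τ_j - t, …, (τ_j - t)^p]`. -/
def lpkDesign (p : ℕ) {m : ℕ} (t : ℝ) (τ : Fin m → ℝ) : Matrix (Fin m) (Fin (p + 1)) ℝ :=
  Matrix.of fun j r => (τ j - t) ^ (r : ℕ)

/-- The weight matrix `diag(K_h(τ_1 - t), …, K_h(τ_m - t))`, `K_h(u) = K(u / h) / h`. -/
def lpkWeight (K : ℝ → ℝ) (h : ℝ) {m : ℕ} (t : ℝ) (τ : Fin m → ℝ) : Matrix (Fin m) (Fin m) ℝ :=
  Matrix.diagonal fun j => K ((τ j - t) / h) / h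

/-- The `p`-order LPK reconstruction at `t` from data `(τ_j, y_j)`:
`e₁ᵀ (Zᵀ K_h Z)⁻¹ Zᵀ K_h y`. -/
def lpk (p : ℕ) (K : ℝ → ℝ) (h : ℝ) {m : ℕ} (t : ℝ) (τ y : Fin m → ℝ) : ℝ :=
  (((lpkDesign p t τ)ᵀ * lpkWeight K h t τ * lpkDesign p t τ)⁻¹ *ᵥ
    (((lpkDesign p t τ)ᵀ * lpkWeight K h t τ) *ᵥ y)) 0

/-! ### The functional linear model and its estimators -/

/-- The covariate matrix of the first `n` subjects. -/
def covMat {q : ℕ} (x : ℕ → Ω → (Fin q → ℝ)) (n : ℕ) (ω : Ω) : Matrix (Fin n) (Fin q) ℝ :=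
  Matrix.of fun i => x i ω

/-- The individual functions `f_i(t) = x_iᵀ β(t) + v_i(t)`. -/
def indiv {q : ℕ} (x : ℕ → Ω → (Fin q → ℝ)) (β : ℝ → (Fin q → ℝ)) (v : ℕ → ℝ → Ω → ℝ)
    (i : ℕ) (t : ℝ) (ω : Ω) : ℝ :=
  x i ω ⬝ᵥ β t + v i t ω

/-- The observations `y_ij = f_i(t_ij) + ε_ij`. -/
def obs {q : ℕ} (x : ℕ → Ω → (Fin q → ℝ)) (β : ℝ → (Fin q → ℝ)) (v : ℕ → ℝ → Ω → ℝ)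
    (T e : ℕ → ℕ → Ω → ℝ) (i j : ℕ) (ω : Ω) : ℝ :=
  indiv x β v i (T i j ω) ω + e i j ω

/-- The vector `[f_1(t), …, f_n(t)]`. -/
def fVec {q : ℕ} (x : ℕ → Ω → (Fin q → ℝ)) (β : ℝ → (Fin q → ℝ)) (v : ℕ → ℝ → Ω → ℝ)
    (n : ℕ) (t : ℝ) (ω : Ω) : Fin n → ℝ :=
  fun i => indiv x β v i t ω

/-- The vector of LPK reconstructions of `f_1(t), …, f_n(t)`, with the common bandwidth `h n`,
subject `i` contributing its first `N n i` observations. -/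
def fHatVec {q : ℕ} (x : ℕ → Ω → (Fin q → ℝ)) (β : ℝ → (Fin q → ℝ)) (v : ℕ → ℝ → Ω → ℝ)
    (T e : ℕ → ℕ → Ω → ℝ) (p : ℕ) (K : ℝ → ℝ) (h : ℕ → ℝ) (N : ℕ → ℕ → ℕ)
    (n : ℕ) (t : ℝ) (ω : Ω) : Fin n → ℝ :=
  fun i => lpk p K (h n) t (fun j : Fin (N n i) => T i j ω)
    (fun j : Fin (N n i) => obs x β v T e i j ω)

/-- The least-squares coefficient `(Xᵀ X)⁻¹ Xᵀ f`. -/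
def lsCoef {n q : ℕ} (X : Matrix (Fin n) (Fin q) ℝ) (f : Fin n → ℝ) : Fin q → ℝ :=
  (Xᵀ * X)⁻¹ *ᵥ (Xᵀ *ᵥ f)

/-- The residuals `f - X (Xᵀ X)⁻¹ Xᵀ f`. -/
def lsResid {n q : ℕ} (X : Matrix (Fin n) (Fin q) ℝ) (f : Fin n → ℝ) : Fin n → ℝ :=
  f - X *ᵥ lsCoef X f

/-- The residual covariance `(n - q)⁻¹ v̂(s)ᵀ v̂(t)`, where `f, g` are the values at `s, t`. -/
def residCov {n q : ℕ} (X : Matrix (Fin n) (Fin q) ℝ) (f g : Fin n → ℝ) : ℝ :=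
  ((n : ℝ) - (q : ℝ))⁻¹ * (lsResid X f ⬝ᵥ lsResid X g)

/-- The second-moment matrix `E x₁ x₁ᵀ`. -/
def secondMoment {q : ℕ} (P : Measure Ω) (x : ℕ → Ω → (Fin q → ℝ)) :
    Matrix (Fin q) (Fin q) ℝ :=
  Matrix.of fun r s => ∫ ω, x 0 ω r * x 0 ω s ∂P

/-- The path of the subject effect `v_i` on `[a, b]`. -/
def vPath (a b : ℝ) (v : ℕ → ℝ → Ω → ℝ) (i : ℕ) (ω : Ω) : Icc a b → ℝ :=
  fun s => v i s ω

/-- The design time points of subject `i`. -/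
def design (T : ℕ → ℕ → Ω → ℝ) (i : ℕ) (ω : Ω) : ℕ → ℝ :=
  fun j => T i j ω

/-- The stochastic structure of the functional linear model. The measurement errors
enter only through the values `e i j = ε_i(t_ij)` at the random design points. That `ε_i` is an
independent copy of the process `ε` (living on some probability space `(Ω₀, P₀)`), independent of
covariate, subject effect and design, means: given those, `(ε_i(t_i1), …, ε_i(t_im))` has the law
of `(ε(s_1), …, ε(s_m))` with `s_j = t_ij`. (White noise `ε_i(·)` cannot be evaluated pathwise at
a random time: it has no jointly measurable version.) -/
structure IsModel {Ω₀ : Type*} [MeasurableSpace Ω₀] {q : ℕ} (P : Measure Ω) [IsProbabilityMeasure P]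
    (P₀ : Measure Ω₀) (a b : ℝ) (x : ℕ → Ω → (Fin q → ℝ)) (v : ℕ → ℝ → Ω → ℝ)
    (T e : ℕ → ℕ → Ω → ℝ) (ε : ℝ → Ω₀ → ℝ) (γ : ℝ → ℝ → ℝ) (σsq : ℝ → ℝ) : Prop where
  /-- the covariates are random vectors -/
  x_measurable : ∀ i, Measurable (x i)
  /-- the design points are random variables -/
  T_measurable : ∀ i j, Measurable (T i j)
  /-- the errors are random variables -/
  e_measurable : ∀ i j, Measurable (e i j)
  /-- `v_i ~ SP(0, γ)` -/
  v_sp : ∀ i, IsSP P a b (v i) 0 γ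
  /-- `ε ~ SP(0, γ_ε)` with `γ_ε(s,t) = σ²(t) 1_{s=t}` -/
  eps_sp : IsSP P₀ a b ε 0 (fun s t => if s = t then σsq t else 0)
  /-- the subjects are independent -/
  subjects_indep :
    iIndepFun (fun i ω => (x i ω, vPath a b v i ω, design T i ω, design e i ω)) P
  /-- the subjects are identically distributed -/
  subjects_ident : ∀ i,
    IdentDistrib (fun ω => (x i ω, vPath a b v i ω, design T i ω, design e i ω))
      (fun ω => (x 0 ω, vPath a b v 0 ω, design T 0 ω, design e 0 ω)) P P
  /-- covariate, subject effect and design of a subject are mutually independent (first part) -/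
  x_indep : ∀ i, IndepFun (x i) (fun ω => (vPath a b v i ω, design T i ω)) P
  /-- covariate, subject effect and design of a subject are mutually independent (second part) -/
  v_indep : ∀ i, IndepFun (vPath a b v i) (design T i) P
  /-- conditional law of the errors given covariate, subject effect and design -/
  e_law : ∀ i m : ℕ, ∀ᵐ ω ∂P,
    condDistrib (fun ω' (j : Fin m) => e i j ω')
        (fun ω' => (x i ω', vPath a b v i ω', design T i ω')) P
        (x i ω, vPath a b v i ω, design T i ω)
      = P₀.map (fun ω₀ (j : Fin m) => ε (T i j ω) ω₀)

/-- The regularity conditions on design density, smoothness, kernel, numbers of measurements and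
bandwidth. `U` is the part of `[a, b]` on which the smoothness conditions hold. -/
structure ConditionA {q : ℕ} (P : Measure Ω) (a b : ℝ) (U : Set ℝ)
    (x : ℕ → Ω → (Fin q → ℝ)) (β : ℝ → (Fin q → ℝ)) (v : ℕ → ℝ → Ω → ℝ) (T : ℕ → ℕ → Ω → ℝ)
    (γ : ℝ → ℝ → ℝ) (σsq dens : ℝ → ℝ) (p : ℕ) (K : ℝ → ℝ) (N : ℕ → ℕ → ℕ) (C δ : ℝ)
    (h : ℕ → ℝ) : Prop where
  /-- the design points are independent -/
  design_indep : iIndepFun (fun (ij : ℕ × ℕ) => T ij.1 ij.2) P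
  /-- the design points have density `dens` -/
  design_law : ∀ i j, P.map (T i j) = volume.withDensity (fun s => ENNReal.ofReal (dens s))
  /-- the density vanishes outside `[a, b]` -/
  dens_zero : ∀ s, s ∉ Icc a b → dens s = 0
  /-- the density is positive -/
  dens_pos : ∀ s ∈ U, 0 < dens s
  /-- the density is continuously differentiable -/
  dens_smooth : ContDiffOn ℝ 1 dens U
  /-- the individual functions are `p + 1` times continuously differentiable -/
  indiv_smooth : ∀ i, ∀ᵐ ω ∂P,
    ContDiffOn ℝ ((p + 1 : ℕ) : WithTop ℕ∞) (fun t => indiv x β v i t ω) U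
  /-- the mean (coefficient) functions are `p + 1` times continuously differentiable -/
  beta_smooth : ContDiffOn ℝ ((p + 1 : ℕ) : WithTop ℕ∞) β U
  /-- `γ_{k,l}` exists and is continuous for `k, l ≤ p + 1` -/
  cov_smooth : HasContMixedDerivs (p + 1) U γ
  /-- the error variance function is continuous -/
  var_cont : ContinuousOn σsq U
  /-- the kernel is measurable -/
  K_measurable : Measurable K
  /-- the kernel is bounded -/
  K_bdd : ∃ B, ∀ u, K u ≤ B
  /-- the kernel is symmetric -/
  K_symm : ∀ u, K (-u) = K u
  /-- the kernel is nonnegative -/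
  K_nonneg : ∀ u, 0 ≤ K u
  /-- the kernel integrates to one -/
  K_integral : ∫ u, K u = 1
  /-- the kernel is supported in `[-1, 1]` -/
  K_supp : ∀ u, u ∉ Icc (-1 : ℝ) 1 → K u = 0
  /-- the constant `C` is positive -/
  C_pos : 0 < C
  /-- the exponent `δ` is positive -/
  delta_pos : 0 < δ
  /-- `n_i ≥ C n^δ` for all subjects -/
  N_ge : ∀ n : ℕ, ∀ i < n, C * (n : ℝ) ^ δ ≤ (N n i : ℝ)
  /-- bandwidths are positive -/
  h_pos : ∀ n, 0 < h n
  /-- `h → 0` -/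
  h_zero : Tendsto h atTop (nhds 0)
  /-- `n^δ h → ∞` -/
  nh_top : Tendsto (fun n : ℕ => (n : ℝ) ^ δ * h n) atTop atTop

/-- The conditions on covariates and subject effects; `U` is as in `ConditionA`. -/
structure ConditionB {q : ℕ} (P : Measure Ω) (U : Set ℝ) (x : ℕ → Ω → (Fin q → ℝ))
    (v : ℕ → ℝ → Ω → ℝ) : Prop where
  /-- the covariates are independent -/
  x_indep : iIndepFun x P
  /-- the covariates are identically distributed -/
  x_ident : ∀ i, IdentDistrib (x i) (x 0) P P
  /-- finite second moment -/
  x_memLp : MemLp (x 0) 2 P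
  /-- invertible second moment -/
  x_inv : IsUnit (secondMoment P x)
  /-- `x_i = O_UP(1)` -/
  x_oup : IsOUP P (fun n => Iio n) (fun (_ : ℕ) (i : ℕ) ω => x i ω)
  /-- `v_i(t) = O_UP(1)` -/
  v_oup : ∀ S ⊆ U, IsCompact S →
    IsOUP P (fun n => Iio n ×ˢ S) (fun (_ : ℕ) (it : ℕ × ℝ) ω => v it.1 it.2 ω)

end FLM

end

namespace FLM

set_option linter.unusedSectionVars false

/-! An LPK reconstruction is a linear functional of the data whose weights `lpkCoef` reproduce
polynomials of degree at most `p`. Hence its error is a signed measure (the weights at the design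
points minus a unit mass at `t`) applied to the individual function, plus a weighted sum of errors.
If the design near `t` is well conditioned, this measure lives within `h` of `t`, kills polynomials
of degree at most `p`, has bounded total variation, and its squared weights sum to order `1 / (m *
h)`, where `m` is the number of observations.

Taylor expansion of `β` bounds the bias from the mean functions by `h ^ (p + 1)`. For the subject
effect no bound on path derivatives is available, but the second moment of the functional is a
bilinear form in `γ`, and Taylor expansion in both variables (`bilinear_functional_bound`) gives `h
^ (2 * (p + 1))`. Errors at distinct times are uncorrelated, which gives variance of order `1 / (m *
h)`. These facts combine in `exists_error_bound`. Ill-conditioned designs are exponentially rare in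
`m * h ^ 2` by Hoeffding's inequality (`exists_wellConditioned_event`), so a union bound over all
`n` subjects is affordable. With the prescribed bandwidth, squared bias and variance are both of
order `n ^ (-2η)` with `η = (p + 1) * δ / (2 * p + 3)`, and `meanSqErr_oup` gives this rate for the
squared error averaged over subjects.

The average is all that the estimators see. Cauchy–Schwarz over subjects and the strong law for the
Gram matrix control the coefficients (`norm_lsCoef_le`); that residuals are never longer than the
data controls the covariance (`abs_residCov_sub_le`).

For the limit law, the ideal estimator minus `β` is the regression of the effects on the covariates.
A multivariate central limit theorem for the products of whitened covariates and effects, with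
Slutsky's lemma, yields the Gaussian limit. The extra condition on `δ` says exactly that `η > 1 /
2`, so that replacing the individual functions by their reconstructions costs `√n * n ^ (-η) → 0`.
-/

/-! ### Linear functionals annihilating polynomials -/

/-- `G 0, …, G m` are successive derivatives on `U`. -/
def IsDerivChain (m : ℕ) (U : Set ℝ) (G : ℕ → ℝ → ℝ) : Prop :=
  ∀ k < m, ∀ s ∈ U, HasDerivWithinAt (G k) (G (k + 1) s) U s

/-- Induction on the order: the derivative of the remainder is the remainder of one order less for
the shifted chain, and the mean value inequality on the interval between `t` and `s` adds a factor
`|s - t|`. The factorial is given away, since only the order matters. -/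
lemma IsDerivChain.taylor_bound {m : ℕ} {U : Set ℝ} {G : ℕ → ℝ → ℝ} {t s M : ℝ}
    (hU : U.OrdConnected) (hG : IsDerivChain m U G) (ht : t ∈ U) (hs : s ∈ U)
    (hM : ∀ u ∈ uIcc t s, |G m u| ≤ M) :
    |G 0 s - ∑ k ∈ Finset.range m, G k t * ((s - t) ^ k / k.factorial)| ≤ M * |s - t| ^ m := by
  induction m generalizing G s with
  | zero => simpa using hM s right_mem_uIcc
  | succ m ih =>
    have hsub : uIcc t s ⊆ U := hU.uIcc_subset ht hs
    set R : ℝ → ℝ := fun s' => G 0 s' - ∑ k ∈ Finset.range (m + 1),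
      G k t * ((s' - t) ^ k / k.factorial) with hR
    have hderiv : ∀ s' ∈ uIcc t s, HasDerivWithinAt R
        (G 1 s' - ∑ k ∈ Finset.range m, G (k + 1) t * ((s' - t) ^ k / k.factorial))
        (uIcc t s) s' := by
      intro s' hs'
      refine ((hG 0 (Nat.succ_pos m) s' (hsub hs')).mono hsub).sub ?_
      have hsum : HasDerivAt (fun x : ℝ => ∑ k ∈ Finset.range (m + 1),
          G k t * ((x - t) ^ k / k.factorial))
          (∑ k ∈ Finset.range (m + 1), G k t * ((k * (s' - t) ^ (k - 1)) / k.factorial)) s' := by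
        refine HasDerivAt.fun_sum fun k _ => ?_
        have h1 := (((hasDerivAt_id s').sub_const t).pow k).div_const (k.factorial : ℝ)
        simpa using h1.const_mul (G k t)
      rw [Finset.sum_range_succ'] at hsum
      convert hsum.hasDerivWithinAt using 1
      simp only [Nat.cast_zero, zero_mul, zero_div, mul_zero, add_zero, Nat.add_sub_cancel]
      refine Finset.sum_congr rfl fun k _ => ?_
      rw [Nat.factorial_succ]
      push_cast
      have : (k.factorial : ℝ) ≠ 0 := by positivity
      field_simp
    have hchain : IsDerivChain m U (fun k => G (k + 1)) := fun k hk s' hs' =>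
      hG (k + 1) (by omega) s' hs'
    have hM0 : 0 ≤ M := (abs_nonneg _).trans (hM t left_mem_uIcc)
    have hbound : ∀ s' ∈ uIcc t s,
        ‖G 1 s' - ∑ k ∈ Finset.range m, G (k + 1) t * ((s' - t) ^ k / k.factorial)‖
          ≤ M * |s - t| ^ m := by
      intro s' hs'
      refine (ih hchain (hsub hs') fun u hu => hM u (uIcc_subset_uIcc_left hs' hu)).trans ?_
      exact mul_le_mul_of_nonneg_left
        (pow_le_pow_left₀ (abs_nonneg _) (abs_sub_left_of_mem_uIcc hs') m) hM0
    have hmv := (convex_uIcc t s).norm_image_sub_le_of_norm_hasDerivWithin_le hderiv hbound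
      left_mem_uIcc right_mem_uIcc
    have hRt : R t = 0 := by
      simp [hR, Finset.sum_range_succ']
    rw [hRt, sub_zero] at hmv
    simpa [hR, pow_succ, mul_assoc] using hmv

/-- The Taylor polynomial at `t` is annihilated, so only the remainder contributes. Points of zero
weight may lie anywhere in `U`, which is why the top derivative need be bounded only within `h` of
`t`. -/
lemma IsDerivChain.functional_bound {ι : Type*} [Fintype ι] {m : ℕ} {U : Set ℝ}
    {G : ℕ → ℝ → ℝ} {t h M : ℝ} {c s : ι → ℝ} (hU : U.OrdConnected) (hG : IsDerivChain m U G)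
    (ht : t ∈ U) (h0 : 0 ≤ h) (hs : ∀ j, s j ∈ U) (hsh : ∀ j, c j ≠ 0 → |s j - t| ≤ h)
    (hc : ∀ r < m, ∑ j, c j * (s j - t) ^ r = 0)
    (hM : ∀ u ∈ U, |u - t| ≤ h → |G m u| ≤ M) :
    |∑ j, c j * G 0 (s j)| ≤ M * h ^ m * ∑ j, |c j| := by
  have hM0 : 0 ≤ M := (abs_nonneg _).trans (hM t ht (by simpa using h0))
  have hzero : ∑ j, c j * ∑ k ∈ Finset.range m, G k t * ((s j - t) ^ k / k.factorial) = 0 := by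
    simp_rw [Finset.mul_sum]
    rw [Finset.sum_comm]
    refine Finset.sum_eq_zero fun k hk => ?_
    have : ∀ j, c j * (G k t * ((s j - t) ^ k / k.factorial))
        = (G k t / k.factorial) * (c j * (s j - t) ^ k) := fun j => by ring
    simp_rw [this]
    rw [← Finset.mul_sum, hc k (Finset.mem_range.1 hk), mul_zero]
  have : ∑ j, c j * G 0 (s j) = ∑ j, c j * (G 0 (s j) -
      ∑ k ∈ Finset.range m, G k t * ((s j - t) ^ k / k.factorial)) := by
    simp_rw [mul_sub]
    rw [Finset.sum_sub_distrib, hzero, sub_zero]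
  rw [this, Finset.mul_sum]
  refine (Finset.abs_sum_le_sum_abs _ _).trans (Finset.sum_le_sum fun j _ => ?_)
  rw [abs_mul, mul_comm]
  by_cases hj : c j = 0
  · simp [hj]
  refine mul_le_mul_of_nonneg_right ?_ (abs_nonneg _)
  refine (hG.taylor_bound hU ht (hs j) fun u hu => hM u (hU.uIcc_subset ht (hs j) hu) ?_).trans ?_
  · exact (abs_sub_left_of_mem_uIcc hu).trans (hsh j hj)
  · exact mul_le_mul_of_nonneg_left (pow_le_pow_left₀ (abs_nonneg _) (hsh j hj) m) hM0

/-- The one-variable bound is used twice: with the functional applied in the second variable, the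
partial derivatives form a chain in the first, and its top member is again such a functional. When
`g 0 0` is a covariance, this bounds the variance of a functional without any control of path
derivatives. -/
lemma bilinear_functional_bound {ι : Type*} [Fintype ι] {m : ℕ} {U : Set ℝ}
    {g : ℕ → ℕ → ℝ → ℝ → ℝ} {t h M : ℝ} {c s : ι → ℝ} (hU : U.OrdConnected)
    (hg₁ : ∀ k < m, ∀ l ≤ m, ∀ s ∈ U, ∀ t ∈ U,
      HasDerivWithinAt (fun s' => g k l s' t) (g (k + 1) l s t) U s)
    (hg₂ : ∀ k ≤ m, ∀ l < m, ∀ s ∈ U, ∀ t ∈ U,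
      HasDerivWithinAt (fun t' => g k l s t') (g k (l + 1) s t) U t)
    (ht : t ∈ U) (h0 : 0 ≤ h) (hs : ∀ j, s j ∈ U) (hsh : ∀ j, c j ≠ 0 → |s j - t| ≤ h)
    (hc : ∀ r < m, ∑ j, c j * (s j - t) ^ r = 0)
    (hM : ∀ u ∈ U, |u - t| ≤ h → ∀ u' ∈ U, |u' - t| ≤ h → |g m m u u'| ≤ M) :
    |∑ j, c j * ∑ l, c l * g 0 0 (s j) (s l)| ≤ M * (h ^ m * ∑ j, |c j|) ^ 2 := by
  have hchain : IsDerivChain m U (fun k u => ∑ l, c l * g k 0 u (s l)) := by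
    intro k hk u hu
    exact HasDerivWithinAt.fun_sum fun l _ =>
      (hg₁ k hk 0 (Nat.zero_le _) u hu (s l) (hs l)).const_mul (c l)
  have := hchain.functional_bound (M := M * (h ^ m * ∑ j, |c j|)) hU ht h0 hs hsh hc
    (fun u hu hut => by
      have hch2 : IsDerivChain m U (fun l u' => g m l u u') := fun l hl u' hu' =>
        hg₂ m le_rfl l hl u hu u' hu'
      have := hch2.functional_bound (M := M) hU ht h0 hs hsh hc (fun u' hu' h' =>
        hM u hu hut u' hu' h')
      simpa [mul_assoc] using this)
  calc _ ≤ _ := this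
    _ = _ := by ring

/-! ### Local polynomial weights -/

/-- The matrix `Zᵀ K_h Z`. -/
noncomputable def lpkGram (p : ℕ) (K : ℝ → ℝ) (h : ℝ) {m : ℕ} (t : ℝ) (τ : Fin m → ℝ) :
    Matrix (Fin (p + 1)) (Fin (p + 1)) ℝ :=
  (lpkDesign p t τ)ᵀ * lpkWeight K h t τ * lpkDesign p t τ

/-- The weight of the `j`-th observation in the LPK reconstruction. -/
noncomputable def lpkCoef (p : ℕ) (K : ℝ → ℝ) (h : ℝ) {m : ℕ} (t : ℝ) (τ : Fin m → ℝ)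
    (j : Fin m) : ℝ :=
  (∑ r, (lpkGram p K h t τ)⁻¹ 0 r * (τ j - t) ^ (r : ℕ)) * (K ((τ j - t) / h) / h)

lemma lpkGram_apply (p : ℕ) (K : ℝ → ℝ) (h : ℝ) {m : ℕ} (t : ℝ) (τ : Fin m → ℝ)
    (r s : Fin (p + 1)) :
    lpkGram p K h t τ r s
      = ∑ j, (τ j - t) ^ (r : ℕ) * (K ((τ j - t) / h) / h) * (τ j - t) ^ (s : ℕ) := by
  rw [lpkGram, Matrix.mul_apply]
  simp [lpkDesign, lpkWeight, Matrix.mul_diagonal]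

lemma lpk_eq_sum (p : ℕ) (K : ℝ → ℝ) (h : ℝ) {m : ℕ} (t : ℝ) (τ y : Fin m → ℝ) :
    lpk p K h t τ y = ∑ j, lpkCoef p K h t τ j * y j := by
  change ((lpkGram p K h t τ)⁻¹ *ᵥ (((lpkDesign p t τ)ᵀ * lpkWeight K h t τ) *ᵥ y)) 0 = _
  simp only [Matrix.mulVec, dotProduct, lpkDesign, lpkWeight, Matrix.mul_diagonal,
    Matrix.transpose_apply, Matrix.of_apply, lpkCoef, Finset.mul_sum, Finset.sum_mul]
  rw [Finset.sum_comm]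
  exact Finset.sum_congr rfl fun j _ => Finset.sum_congr rfl fun r _ => by ring

lemma lpkCoef_eq_zero {p : ℕ} {K : ℝ → ℝ} {h : ℝ} {m : ℕ} {t : ℝ} {τ : Fin m → ℝ} {j : Fin m}
    (hK : ∀ u, u ∉ Icc (-1 : ℝ) 1 → K u = 0) (h0 : 0 < h) (hj : h < |τ j - t|) :
    lpkCoef p K h t τ j = 0 := by
  have : (τ j - t) / h ∉ Icc (-1 : ℝ) 1 := by
    rw [mem_Icc, ← abs_le, abs_div, abs_of_pos h0, not_le, lt_div_iff₀ h0]
    simpa using hj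
  simp [lpkCoef, hK _ this]

lemma sum_gram_eq (p : ℕ) (K : ℝ → ℝ) (h : ℝ) {m : ℕ} (t : ℝ) (τ : Fin m → ℝ)
    (w : Fin (p + 1) → ℝ) :
    ∑ j, (∑ r : Fin (p + 1), w r * (τ j - t) ^ (r : ℕ)) ^ 2 * (K ((τ j - t) / h) / h)
      = ∑ s, (∑ r : Fin (p + 1), w r * lpkGram p K h t τ r s) * w s := by
  have h1 : ∀ j, (∑ r : Fin (p + 1), w r * (τ j - t) ^ (r : ℕ)) ^ 2 * (K ((τ j - t) / h) / h)
      = ∑ s : Fin (p + 1), ∑ r : Fin (p + 1), w r * ((τ j - t) ^ (r : ℕ) * (K ((τ j - t) / h) / h) * (τ j - t) ^ (s : ℕ))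
        * w s := by
    intro j
    rw [pow_two, Finset.sum_mul_sum, Finset.sum_mul, Finset.sum_comm]
    refine Finset.sum_congr rfl fun s _ => ?_
    rw [Finset.sum_mul]
    exact Finset.sum_congr rfl fun r _ => by ring
  simp_rw [h1, lpkGram_apply, Finset.mul_sum, Finset.sum_mul]
  rw [Finset.sum_comm]
  refine Finset.sum_congr rfl fun s _ => ?_
  rw [Finset.sum_comm]

/-- The scaled design of the LPK smoother is well conditioned: its empirical moment matrix is
bounded below by `c` and its total kernel mass is bounded above by `C`. -/
structure WellConditioned (p : ℕ) (K : ℝ → ℝ) (h c C : ℝ) {m : ℕ} (t : ℝ) (τ : Fin m → ℝ) :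
    Prop where
  lower : ∀ w : Fin (p + 1) → ℝ, c * m * ∑ r : Fin (p + 1), w r ^ 2
    ≤ ∑ j, (∑ r : Fin (p + 1), w r * ((τ j - t) / h) ^ (r : ℕ)) ^ 2 * (K ((τ j - t) / h) / h)
  upper : ∑ j, K ((τ j - t) / h) / h ≤ C * m

namespace WellConditioned

variable {p : ℕ} {K : ℝ → ℝ} {h c C : ℝ} {m : ℕ} {t : ℝ} {τ : Fin m → ℝ}

/-- Giving the `r`-th coefficient the factor `h ^ r` trades powers of `(τ - t) / h` for powers of `τ
- t`. -/
lemma lower_unscaled (H : WellConditioned p K h c C t τ) (h0 : 0 < h) (w : Fin (p + 1) → ℝ) :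
    c * m * ∑ r : Fin (p + 1), (h ^ (r : ℕ) * w r) ^ 2
      ≤ ∑ s, (∑ r : Fin (p + 1), w r * lpkGram p K h t τ r s) * w s := by
  rw [← sum_gram_eq]
  refine (H.lower _).trans (le_of_eq ?_)
  refine Finset.sum_congr rfl fun j _ => ?_
  congr 2
  refine Finset.sum_congr rfl fun r _ => ?_
  rw [div_pow]
  field_simp

lemma isUnit_det (H : WellConditioned p K h c C t τ) (h0 : 0 < h) (hc : 0 < c) (hm : 0 < m) :
    IsUnit (lpkGram p K h t τ).det := by
  rw [isUnit_iff_ne_zero]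
  intro hdet
  obtain ⟨w, hw, hw0⟩ := Matrix.exists_vecMul_eq_zero_iff.2 hdet
  have hle := H.lower_unscaled h0 w
  have hz : ∀ s, ∑ r : Fin (p + 1), w r * lpkGram p K h t τ r s = 0 := fun s => congrFun hw0 s
  simp only [hz, zero_mul, Finset.sum_const_zero] at hle
  have hcm : 0 < c * m := by positivity
  have hsum : ∑ r : Fin (p + 1), (h ^ (r : ℕ) * w r) ^ 2 ≤ 0 := by
    by_contra hcon
    exact absurd hle (not_le.2 (mul_pos hcm (not_le.1 hcon)))
  refine hw (funext fun r => ?_)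
  have := (Finset.sum_eq_zero_iff_of_nonneg fun r _ => sq_nonneg _).1
    (le_antisymm hsum (Finset.sum_nonneg fun r _ => sq_nonneg _)) r (Finset.mem_univ r)
  have h2 : h ^ (r : ℕ) * w r = 0 := by simpa using this
  exact (mul_eq_zero.1 h2).resolve_left (pow_pos h0 _).ne'

lemma sum_row_mul_gram (H : WellConditioned p K h c C t τ) (h0 : 0 < h) (hc : 0 < c) (hm : 0 < m)
    (s : Fin (p + 1)) :
    ∑ r : Fin (p + 1), (lpkGram p K h t τ)⁻¹ 0 r * lpkGram p K h t τ r s = if s = 0 then 1 else 0 := by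
  have := congrFun (congrFun (Matrix.nonsing_inv_mul _ (H.isUnit_det h0 hc hm)) 0) s
  rw [Matrix.mul_apply, Matrix.one_apply] at this
  rw [this]
  simp [eq_comm]

/-- Polynomial reproduction: the sum is the entry `(0, r)` of the inverse Gram matrix times the Gram
matrix. -/
lemma sum_coef_mul_pow (H : WellConditioned p K h c C t τ) (h0 : 0 < h) (hc : 0 < c) (hm : 0 < m)
    {r : ℕ} (hr : r < p + 1) :
    ∑ j, lpkCoef p K h t τ j * (τ j - t) ^ r = if r = 0 then 1 else 0 := by
  have := H.sum_row_mul_gram h0 hc hm ⟨r, hr⟩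
  simp_rw [lpkGram_apply, Finset.mul_sum] at this
  rw [Finset.sum_comm] at this
  simp only [Fin.ext_iff, Fin.val_zero] at this
  rw [← this]
  refine Finset.sum_congr rfl fun j _ => ?_
  rw [lpkCoef, Finset.sum_mul, Finset.sum_mul]
  exact Finset.sum_congr rfl fun r _ => by ring

/-- The quadratic form of the Gram matrix at the first row of its inverse. -/
lemma sum_sq_row (H : WellConditioned p K h c C t τ) (h0 : 0 < h) (hc : 0 < c) (hm : 0 < m) :
    ∑ j, (∑ r : Fin (p + 1), (lpkGram p K h t τ)⁻¹ 0 r * (τ j - t) ^ (r : ℕ)) ^ 2 * (K ((τ j - t) / h) / h)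
      = (lpkGram p K h t τ)⁻¹ 0 0 := by
  rw [sum_gram_eq]
  simp [H.sum_row_mul_gram h0 hc hm]

/-- Let `a` be the first row of the inverse. The Gram form at `a` equals `a 0`, while its lower
bound contains the term `c * m * a 0 ^ 2`, whose scaling factor is `h ^ 0 = 1`. Thus `c * m * a 0 ^
2 ≤ a 0`. -/
lemma inv_gram_le (H : WellConditioned p K h c C t τ) (h0 : 0 < h) (hc : 0 < c) (hm : 0 < m) :
    (lpkGram p K h t τ)⁻¹ 0 0 ≤ 1 / (c * m) := by
  have hle := H.lower_unscaled h0 fun r => (lpkGram p K h t τ)⁻¹ 0 r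
  rw [← sum_gram_eq, H.sum_sq_row h0 hc hm] at hle
  have hcm : 0 < c * m := by positivity
  have h1 : ((lpkGram p K h t τ)⁻¹ 0 0) ^ 2
      ≤ ∑ r : Fin (p + 1), (h ^ (r : ℕ) * (lpkGram p K h t τ)⁻¹ 0 r) ^ 2 := by
    have := Finset.single_le_sum
      (f := fun r : Fin (p + 1) => (h ^ (r : ℕ) * (lpkGram p K h t τ)⁻¹ 0 r) ^ 2)
      (fun r _ => sq_nonneg _) (Finset.mem_univ 0)
    simpa using this
  have h2 := (mul_le_mul_of_nonneg_left h1 hcm.le).trans hle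
  by_contra hcon
  rw [not_le, div_lt_iff₀ hcm] at hcon
  have hpos : 0 < (lpkGram p K h t τ)⁻¹ 0 0 := by
    by_contra h'
    nlinarith
  nlinarith

/-- One of the two kernel factors in each squared weight is bounded by `B / h`; what remains is the
Gram form at the first row of the inverse. -/
lemma sum_coef_sq_le (H : WellConditioned p K h c C t τ) (h0 : 0 < h) (hc : 0 < c) (hm : 0 < m)
    (hK0 : ∀ u, 0 ≤ K u) {B : ℝ} (hKB : ∀ u, K u ≤ B) :
    ∑ j, lpkCoef p K h t τ j ^ 2 ≤ B / (c * (m * h)) := by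
  have hB : 0 ≤ B := (hK0 0).trans (hKB 0)
  calc ∑ j, lpkCoef p K h t τ j ^ 2
      ≤ ∑ j, (B / h) * ((∑ r : Fin (p + 1), (lpkGram p K h t τ)⁻¹ 0 r * (τ j - t) ^ (r : ℕ)) ^ 2
          * (K ((τ j - t) / h) / h)) := by
        refine Finset.sum_le_sum fun j _ => ?_
        rw [lpkCoef, mul_pow, pow_two (K _ / h)]
        have h1 : K ((τ j - t) / h) / h ≤ B / h := by gcongr; exact hKB _
        have h2 : 0 ≤ K ((τ j - t) / h) / h := div_nonneg (hK0 _) h0.le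
        have h3 := mul_le_mul_of_nonneg_left (mul_le_mul_of_nonneg_right h1 h2)
          (sq_nonneg (∑ r : Fin (p + 1), (lpkGram p K h t τ)⁻¹ 0 r * (τ j - t) ^ (r : ℕ)))
        linarith
    _ = (B / h) * (lpkGram p K h t τ)⁻¹ 0 0 := by rw [← Finset.mul_sum, H.sum_sq_row h0 hc hm]
    _ ≤ (B / h) * (1 / (c * m)) := by
        gcongr
        exact H.inv_gram_le h0 hc hm
    _ = B / (c * (m * h)) := by
        have : (m : ℝ) ≠ 0 := by positivity
        field_simp

/-- Cauchy–Schwarz with the kernel weight split evenly between the factors: one is the Gram form of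
`sum_sq_row`, the other the total kernel mass. -/
lemma sum_abs_coef_le (H : WellConditioned p K h c C t τ) (h0 : 0 < h) (hc : 0 < c) (hm : 0 < m)
    (hK0 : ∀ u, 0 ≤ K u) :
    ∑ j, |lpkCoef p K h t τ j| ≤ √(C / c) := by
  have hk : ∀ j, 0 ≤ K ((τ j - t) / h) / h := fun j => div_nonneg (hK0 _) h0.le
  refine Real.le_sqrt_of_sq_le ?_
  set z : Fin m → ℝ := fun j => ∑ r : Fin (p + 1), (lpkGram p K h t τ)⁻¹ 0 r * (τ j - t) ^ (r : ℕ)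
  calc (∑ j, |lpkCoef p K h t τ j|) ^ 2
      = (∑ j, (|z j| * √(K ((τ j - t) / h) / h)) * √(K ((τ j - t) / h) / h)) ^ 2 := by
        congr 1
        refine Finset.sum_congr rfl fun j _ => ?_
        rw [lpkCoef, abs_mul, abs_of_nonneg (hk j), mul_assoc, Real.mul_self_sqrt (hk j)]
    _ ≤ (∑ j, (|z j| * √(K ((τ j - t) / h) / h)) ^ 2) * ∑ j, √(K ((τ j - t) / h) / h) ^ 2 :=
        Finset.sum_mul_sq_le_sq_mul_sq _ _ _
    _ = (lpkGram p K h t τ)⁻¹ 0 0 * ∑ j, K ((τ j - t) / h) / h := by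
        rw [← H.sum_sq_row h0 hc hm]
        simp_rw [mul_pow, sq_abs, Real.sq_sqrt (hk _)]
        rfl
    _ ≤ (1 / (c * m)) * (C * m) := by
        refine mul_le_mul (H.inv_gram_le h0 hc hm) H.upper (Finset.sum_nonneg fun j _ => hk j) ?_
        positivity
    _ = C / c := by
        have : (m : ℝ) ≠ 0 := by positivity
        field_simp

end WellConditioned

/-! ### Kernel moments -/

/-- A symmetric probability density on `[-1, 1]` that is bounded by `B`. -/
structure IsKernel (K : ℝ → ℝ) (B : ℝ) : Prop where
  measurable : Measurable K
  le : ∀ u, K u ≤ B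
  symm : ∀ u, K (-u) = K u
  nonneg : ∀ u, 0 ≤ K u
  integral : ∫ u, K u = 1
  supp : ∀ u, u ∉ Icc (-1 : ℝ) 1 → K u = 0

namespace IsKernel

variable {K : ℝ → ℝ} {B : ℝ}

lemma bound_nonneg (hK : IsKernel K B) : 0 ≤ B := (hK.nonneg 0).trans (hK.le 0)

lemma integrable_mul (hK : IsKernel K B) {f : ℝ → ℝ} (hf : Continuous f) :
    Integrable fun u => f u * K u := by
  have hs : Function.support (fun u => f u * K u) ⊆ Icc (-1) 1 := by
    intro u hu
    by_contra h
    exact hu (by simp [hK.supp u h])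
  rw [← integrableOn_iff_integrable_of_support_subset hs]
  refine (hf.integrableOn_Icc).mul_bdd (c := B) hK.measurable.aestronglyMeasurable ?_
  exact ae_of_all _ fun u => by rw [Real.norm_of_nonneg (hK.nonneg u)]; exact hK.le u

lemma integrable (hK : IsKernel K B) : Integrable K := by
  simpa using hK.integrable_mul (f := fun _ => 1) continuous_const

/-- By symmetry the two half-lines carry equal mass, and the total is one. -/
lemma setIntegral_Ioi_pos (hK : IsKernel K B) : 0 < ∫ u in Ioi 0, K u := by
  refine lt_of_le_of_ne (setIntegral_nonneg measurableSet_Ioi fun u _ => hK.nonneg u) fun h => ?_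
  have h1 : ∫ u in Iic 0, K u = ∫ u in Ioi 0, K u := by
    have := integral_comp_neg_Iic (0 : ℝ) K
    simpa [hK.symm] using this
  have h2 := intervalIntegral.integral_Iic_add_Ioi (b := (0 : ℝ)) hK.integrable.integrableOn
    hK.integrable.integrableOn
  rw [h1, ← h, hK.integral] at h2
  norm_num at h2

lemma continuous_poly {p : ℕ} (w : Fin (p + 1) → ℝ) :
    Continuous fun u : ℝ => (∑ r : Fin (p + 1), w r * u ^ (r : ℕ)) ^ 2 := by fun_prop

lemma ae_poly_ne_zero {p : ℕ} {w : Fin (p + 1) → ℝ} (hw : w ≠ 0) :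
    ∀ᵐ u : ℝ, ∑ r : Fin (p + 1), w r * u ^ (r : ℕ) ≠ 0 := by
  set Q : Polynomial ℝ := ∑ r : Fin (p + 1), Polynomial.monomial (r : ℕ) (w r) with hQ
  have hQ0 : Q ≠ 0 := by
    intro h
    refine hw (funext fun r => ?_)
    have := congrArg (fun P => Polynomial.coeff P (r : ℕ)) h
    simpa [hQ, Polynomial.finsetSum_coeff, Polynomial.coeff_monomial, Fin.val_inj] using this
  have hfin : {u : ℝ | Q.IsRoot u}.Finite := Polynomial.finite_setOfPred_isRoot hQ0
  filter_upwards [measure_eq_zero_iff_ae_notMem.1 (hfin.measure_zero volume)] with u hu h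
  refine hu ?_
  rw [Polynomial.IsRoot, hQ, Polynomial.eval_finsetSum]
  simpa [Polynomial.eval_monomial] using h

/-- The quadratic form of the half kernel moments is positive definite. -/
lemma exists_half_moment_lower (hK : IsKernel K B) (p : ℕ) :
    ∃ c : ℝ, 0 < c ∧ ∀ w : Fin (p + 1) → ℝ,
      c * ∑ r, w r ^ 2 ≤ ∫ u in Ioi 0, (∑ r : Fin (p + 1), w r * u ^ (r : ℕ)) ^ 2 * K u := by
  set Q : (Fin (p + 1) → ℝ) → ℝ := fun w =>
    ∫ u in Ioi 0, (∑ r : Fin (p + 1), w r * u ^ (r : ℕ)) ^ 2 * K u with hQdef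
  have hQexp : ∀ w, Q w = ∑ r : Fin (p + 1), ∑ s : Fin (p + 1),
      w r * w s * ∫ u in Ioi 0, u ^ ((r : ℕ) + s) * K u := by
    intro w
    have h1 : ∀ u : ℝ, (∑ r : Fin (p + 1), w r * u ^ (r : ℕ)) ^ 2 * K u
        = ∑ r : Fin (p + 1), ∑ s : Fin (p + 1), w r * w s * (u ^ ((r : ℕ) + s) * K u) := by
      intro u
      rw [pow_two, Finset.sum_mul_sum, Finset.sum_mul]
      refine Finset.sum_congr rfl fun r _ => ?_
      rw [Finset.sum_mul]
      exact Finset.sum_congr rfl fun s _ => by rw [pow_add]; ring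
    have hi : ∀ k : ℕ, IntegrableOn (fun u => u ^ k * K u) (Ioi 0) := fun k =>
      (hK.integrable_mul (continuous_pow k)).integrableOn
    simp only [hQdef, h1]
    rw [integral_finsetSum _ fun r _ => integrable_finsetSum _ fun s _ => (hi _).const_mul _]
    refine Finset.sum_congr rfl fun r _ => ?_
    rw [integral_finsetSum _ fun s _ => (hi _).const_mul _]
    exact Finset.sum_congr rfl fun s _ => integral_const_mul _ _
  have hQcont : Continuous Q := by
    rw [show Q = _ from funext hQexp]
    fun_prop
  have hQpos : ∀ w, w ≠ 0 → 0 < Q w := by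
    intro w hw
    have hnn : ∀ u, 0 ≤ (∑ r : Fin (p + 1), w r * u ^ (r : ℕ)) ^ 2 * K u := fun u =>
      mul_nonneg (sq_nonneg _) (hK.nonneg u)
    refine lt_of_le_of_ne (integral_nonneg hnn) fun h => ?_
    have h0 := (integral_eq_zero_iff_of_nonneg hnn
      (hK.integrable_mul (continuous_poly w)).integrableOn).1 h.symm
    -- A nonzero polynomial vanishes only on a null set, so a vanishing integral would force the
    -- kernel itself to vanish almost everywhere on the half-line.
    have hK0 : K =ᵐ[volume.restrict (Ioi 0)] 0 := by
      filter_upwards [h0, ae_restrict_of_ae (ae_poly_ne_zero hw)] with u hu hu'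
      simpa [hu'] using hu
    have := hK.setIntegral_Ioi_pos
    rw [integral_congr_ae hK0] at this
    simp at this
  have hcomp : IsCompact {w : Fin (p + 1) → ℝ | ∑ r, w r ^ 2 = 1} := by
    refine Metric.isCompact_of_isClosed_isBounded
      (isClosed_eq (by fun_prop) continuous_const) ?_
    refine (Metric.isBounded_closedBall (x := (0 : Fin (p + 1) → ℝ)) (r := 1)).subset fun w hw => ?_
    rw [mem_closedBall_zero_iff, pi_norm_le_iff_of_nonneg zero_le_one]
    intro r
    have h1 : w r ^ 2 ≤ 1 := by
      rw [← (show ∑ r, w r ^ 2 = 1 from hw)]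
      exact Finset.single_le_sum (f := fun r => w r ^ 2) (fun r _ => sq_nonneg _)
        (Finset.mem_univ r)
    rw [Real.norm_eq_abs]
    exact abs_le_one_iff_mul_self_le_one.2 (by nlinarith)
  have hne : {w : Fin (p + 1) → ℝ | ∑ r, w r ^ 2 = 1}.Nonempty :=
    ⟨Pi.single 0 1, by simp [Pi.single_apply]⟩
  -- The constant is the minimum of the form on the Euclidean unit sphere; homogeneity of degree two
  -- extends the bound to all vectors.
  obtain ⟨w₀, hw₀, hmin⟩ := hcomp.exists_isMinOn hne hQcont.continuousOn
  have hw₀0 : w₀ ≠ 0 := by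
    rintro rfl
    simp at hw₀
  refine ⟨Q w₀, hQpos w₀ hw₀0, fun w => ?_⟩
  change _ ≤ Q w
  by_cases hw : w = 0
  · subst hw
    simp [hQexp]
  set n : ℝ := ∑ r, w r ^ 2 with hn
  have hnpos : 0 < n := by
    refine lt_of_le_of_ne (Finset.sum_nonneg fun r _ => sq_nonneg _) fun h => hw ?_
    funext r
    have := (Finset.sum_eq_zero_iff_of_nonneg fun r _ => sq_nonneg (w r)).1 h.symm r
      (Finset.mem_univ r)
    simpa using this
  have hmem : (fun r => w r / √n) ∈ {w : Fin (p + 1) → ℝ | ∑ r, w r ^ 2 = 1} := by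
    simp only [mem_ofPred_eq, div_pow, Real.sq_sqrt hnpos.le]
    rw [← Finset.sum_div, ← hn, div_self hnpos.ne']
  have h1 : Q w₀ ≤ Q fun r => w r / √n := hmin hmem
  have h2 : Q (fun r => w r / √n) = Q w / n := by
    rw [hQexp, hQexp, Finset.sum_div]
    refine Finset.sum_congr rfl fun r _ => ?_
    rw [Finset.sum_div]
    refine Finset.sum_congr rfl fun s _ => ?_
    have : √n * √n = n := Real.mul_self_sqrt hnpos.le
    rw [div_mul_div_comm, this]
    ring
  rwa [h2, le_div_iff₀ hnpos] at h1

/-- Reflection `u ↦ -u` turns `w r` into `(-1) ^ r * w r`, which leaves the sum of squares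
unchanged. Both halves are needed because at an endpoint of a closed time domain only the inward
half of the kernel window meets the design. -/
lemma exists_half_moment_lower_both (hK : IsKernel K B) (p : ℕ) :
    ∃ c : ℝ, 0 < c ∧ ∀ w : Fin (p + 1) → ℝ,
      c * ∑ r, w r ^ 2 ≤ ∫ u in Ioi 0, (∑ r : Fin (p + 1), w r * u ^ (r : ℕ)) ^ 2 * K u ∧
      c * ∑ r, w r ^ 2 ≤ ∫ u in Iic 0, (∑ r : Fin (p + 1), w r * u ^ (r : ℕ)) ^ 2 * K u := by
  obtain ⟨c, hc, H⟩ := hK.exists_half_moment_lower p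
  refine ⟨c, hc, fun w => ⟨H w, ?_⟩⟩
  have h1 := H fun r => w r * (-1) ^ (r : ℕ)
  have h2 := integral_comp_neg_Iic (0 : ℝ)
    fun u => (∑ r : Fin (p + 1), w r * (-1) ^ (r : ℕ) * u ^ (r : ℕ)) ^ 2 * K u
  rw [neg_zero] at h2
  rw [← h2] at h1
  have e1 : ∀ r : Fin (p + 1), (w r * (-1) ^ (r : ℕ)) ^ 2 = w r ^ 2 := fun r => by
    rw [mul_pow, ← pow_mul, mul_comm _ 2, pow_mul]
    simp
  have e2 : ∀ (u : ℝ) (r : Fin (p + 1)), w r * (-1) ^ (r : ℕ) * (-u) ^ (r : ℕ) = w r * u ^ (r : ℕ) :=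
    fun u r => by
      rw [mul_assoc, ← mul_pow]
      simp
  simpa only [e1, e2, hK.symm] using h1

end IsKernel

/-! ### Localization inside the time domain -/

/-- The compact set `S'` holds every point of `U` that a smoother at `t ∈ S` can use, so continuous
functions on `U` are bounded there and the density is bounded away from zero. For open `U` a closed
thickening of `S` works and the whole window fits. For closed `U` the half of the window pointing
towards the midpoint fits once `ρ` is half the length. -/
lemma exists_compact_window {a b : ℝ} (hab : a < b) {U : Set ℝ} (hU : U = Ioo a b ∨ U = Icc a b)
    {S : Set ℝ} (hSU : S ⊆ U) (hS : IsCompact S) :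
    ∃ ρ > 0, ∃ S' ⊆ U, IsCompact S' ∧ (∀ t ∈ S, ∀ s ∈ U, |s - t| ≤ ρ → s ∈ S') ∧
      ∀ t ∈ S, ∀ h : ℝ, 0 < h → h ≤ ρ →
        (∀ u ∈ Icc (0 : ℝ) 1, t + h * u ∈ U) ∨ (∀ u ∈ Icc (-1 : ℝ) 0, t + h * u ∈ U) := by
  rcases hU with rfl | rfl
  · obtain ⟨ρ, hρ, hsub⟩ := hS.exists_cthickening_subset_open isOpen_Ioo hSU
    have hmem : ∀ t ∈ S, ∀ s, |s - t| ≤ ρ → s ∈ Metric.cthickening ρ S := fun t ht s hs =>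
      Metric.mem_cthickening_of_dist_le s t ρ S ht (by rwa [Real.dist_eq])
    refine ⟨ρ, hρ, _, hsub, hS.cthickening, fun t ht s _ hs => hmem t ht s hs, ?_⟩
    intro t ht h h0 hρ'
    left
    intro u hu
    refine hsub (hmem t ht _ ?_)
    rw [add_sub_cancel_left, abs_of_nonneg (mul_nonneg h0.le hu.1)]
    nlinarith [hu.2]
  · refine ⟨(b - a) / 2, by linarith, Icc a b, Subset.rfl, isCompact_Icc,
      fun t _ s hs _ => hs, ?_⟩
    intro t ht h h0 hρ
    have ht' := hSU ht
    rcases le_total t ((a + b) / 2) with h1 | h1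
    · left
      intro u hu
      constructor <;> nlinarith [hu.1, hu.2, ht'.1, ht'.2]
    · right
      intro u hu
      constructor <;> nlinarith [hu.1, hu.2, ht'.1, ht'.2]

/-! ### Design moments -/

/-- The substitution `s = t + h * u`, whose Jacobian cancels the factor `1 / h` of the kernel. -/
lemma integral_comp_density {Ω : Type*} [MeasurableSpace Ω] {P : Measure Ω} {X : Ω → ℝ}
    {π : ℝ → ℝ} (hX : Measurable X) (hπ : Measurable π) (hπ0 : ∀ s, 0 ≤ π s)
    (hlaw : P.map X = volume.withDensity fun s => ENNReal.ofReal (π s)) {f : ℝ → ℝ}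
    (hf : Measurable f) {h : ℝ} (h0 : 0 < h) (t : ℝ) :
    ∫ ω, f ((X ω - t) / h) / h ∂P = ∫ u, f u * π (t + h * u) := by
  have h1 : ∫ ω, f ((X ω - t) / h) / h ∂P = ∫ s, f ((s - t) / h) / h ∂(P.map X) := by
    rw [integral_map hX.aemeasurable]
    exact Measurable.aestronglyMeasurable (by fun_prop)
  rw [h1, hlaw, integral_withDensity_eq_integral_toReal_smul (by fun_prop)
    (ae_of_all _ fun s => ENNReal.ofReal_lt_top)]
  have h2 := Measure.integral_comp_mul_left
    (fun s => (ENNReal.ofReal (π (t + s))).toReal • (f (s / h) / h)) h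
  have h3 := integral_add_left_eq_self (μ := volume)
    (fun s => (ENNReal.ofReal (π s)).toReal • (f ((s - t) / h) / h)) t
  simp only [add_sub_cancel_left] at h3
  rw [← h3]
  rw [smul_eq_mul, abs_of_pos (inv_pos.2 h0)] at h2
  rw [← mul_right_inj' (inv_pos.2 h0).ne', ← h2, ← integral_const_mul]
  refine integral_congr_ae (ae_of_all _ fun u => ?_)
  simp only [ENNReal.toReal_ofReal (hπ0 _), smul_eq_mul, mul_div_cancel_left₀ u h0.ne']
  field_simp

section DesignMoments

variable {Ω : Type*} [MeasurableSpace Ω] {P : Measure Ω} {X : Ω → ℝ} {π K : ℝ → ℝ}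
  {B h t πmax πmin c : ℝ} {p : ℕ}

lemma integrable_mul_density (hK : IsKernel K B) (hπ : Measurable π) (hπ0 : ∀ s, 0 ≤ π s)
    (hup : ∀ u ∈ Icc (-1 : ℝ) 1, π (t + h * u) ≤ πmax) {f : ℝ → ℝ} (hf : Continuous f) :
    Integrable fun u => f u * K u * π (t + h * u) := by
  refine ((hK.integrable_mul hf).norm.mul_const πmax).mono'
    (((hf.measurable.mul hK.measurable).mul (by fun_prop)).aestronglyMeasurable)
    (ae_of_all _ fun u => ?_)
  rw [norm_mul, Real.norm_of_nonneg (hπ0 _)]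
  by_cases hu : u ∈ Icc (-1 : ℝ) 1
  · exact mul_le_mul_of_nonneg_left (hup u hu) (norm_nonneg _)
  · simp [hK.supp u hu]

lemma design_mass_le (hK : IsKernel K B) (hX : Measurable X) (hπ : Measurable π)
    (hπ0 : ∀ s, 0 ≤ π s) (hlaw : P.map X = volume.withDensity fun s => ENNReal.ofReal (π s))
    (h0 : 0 < h) (hup : ∀ u ∈ Icc (-1 : ℝ) 1, π (t + h * u) ≤ πmax) :
    ∫ ω, K ((X ω - t) / h) / h ∂P ≤ πmax := by
  rw [integral_comp_density hX hπ hπ0 hlaw hK.measurable h0]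
  calc ∫ u, K u * π (t + h * u) ≤ ∫ u, K u * πmax := by
        refine integral_mono ?_ (hK.integrable.mul_const _) fun u => ?_
        · simpa using integrable_mul_density (f := fun _ => 1) hK hπ hπ0 hup continuous_const
        by_cases hu : u ∈ Icc (-1 : ℝ) 1
        · exact mul_le_mul_of_nonneg_left (hup u hu) (hK.nonneg u)
        · simp [hK.supp u hu]
    _ = πmax := by rw [integral_mul_const, hK.integral, one_mul]

/-- The integrand is nonnegative, so the half-line on which the density may vanish is discarded; on
the other one the density is at least `πmin` wherever the kernel is nonzero. -/
lemma le_design_moment (hK : IsKernel K B) (hX : Measurable X) (hπ : Measurable π)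
    (hπ0 : ∀ s, 0 ≤ π s) (hlaw : P.map X = volume.withDensity fun s => ENNReal.ofReal (π s))
    (h0 : 0 < h) (hup : ∀ u ∈ Icc (-1 : ℝ) 1, π (t + h * u) ≤ πmax) (hmin : 0 ≤ πmin)
    (hlow : (∀ u ∈ Icc (0 : ℝ) 1, πmin ≤ π (t + h * u)) ∨
      (∀ u ∈ Icc (-1 : ℝ) 0, πmin ≤ π (t + h * u)))
    {w : Fin (p + 1) → ℝ}
    (hc : c * ∑ r, w r ^ 2 ≤ ∫ u in Ioi 0, (∑ r : Fin (p + 1), w r * u ^ (r : ℕ)) ^ 2 * K u ∧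
      c * ∑ r, w r ^ 2 ≤ ∫ u in Iic 0, (∑ r : Fin (p + 1), w r * u ^ (r : ℕ)) ^ 2 * K u) :
    πmin * c * ∑ r, w r ^ 2 ≤
      ∫ ω, (∑ r : Fin (p + 1), w r * ((X ω - t) / h) ^ (r : ℕ)) ^ 2 *
        (K ((X ω - t) / h) / h) ∂P := by
  set f : ℝ → ℝ := fun u => (∑ r : Fin (p + 1), w r * u ^ (r : ℕ)) ^ 2 with hf
  have hfc : Continuous f := IsKernel.continuous_poly w
  have h1 := integral_comp_density hX hπ hπ0 hlaw (hfc.measurable.mul hK.measurable) h0 t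
  simp only [Pi.mul_apply, mul_div_assoc] at h1
  rw [h1]
  have hint := integrable_mul_density hK hπ hπ0 hup hfc
  have hnn : ∀ u, 0 ≤ f u * K u * π (t + h * u) := fun u =>
    mul_nonneg (mul_nonneg (sq_nonneg _) (hK.nonneg u)) (hπ0 _)
  have key : ∀ A : Set ℝ, MeasurableSet A → (∀ u ∈ A, u ∈ Icc (-1 : ℝ) 1 → πmin ≤ π (t + h * u)) →
      c * ∑ r, w r ^ 2 ≤ ∫ u in A, f u * K u →
      πmin * c * ∑ r, w r ^ 2 ≤ ∫ u, f u * K u * π (t + h * u) := by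
    intro A hA hlowA hcA
    calc πmin * c * ∑ r, w r ^ 2 ≤ (∫ u in A, f u * K u) * πmin := by
          rw [mul_assoc, mul_comm]
          exact mul_le_mul_of_nonneg_right hcA hmin
      _ = ∫ u in A, f u * K u * πmin := (integral_mul_const _ _).symm
      _ ≤ ∫ u in A, f u * K u * π (t + h * u) := by
          refine setIntegral_mono_on ((hK.integrable_mul hfc).mul_const _).integrableOn
            hint.integrableOn hA fun u hu => ?_
          by_cases hu1 : u ∈ Icc (-1 : ℝ) 1
          · exact mul_le_mul_of_nonneg_left (hlowA u hu hu1)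
              (mul_nonneg (sq_nonneg _) (hK.nonneg u))
          · simp [hK.supp u hu1]
      _ ≤ _ := setIntegral_le_integral hint (ae_of_all _ hnn)
  rcases hlow with hl | hl
  · exact key (Ioi 0) measurableSet_Ioi (fun u hu hu1 => hl u ⟨le_of_lt hu, hu1.2⟩) hc.1
  · exact key (Iic 0) measurableSet_Iic (fun u hu hu1 => hl u ⟨hu1.1, hu⟩) hc.2

end DesignMoments

/-! ### Concentration of the empirical design moments -/

section Concentration

variable {Ω : Type*} [MeasurableSpace Ω] {P : Measure Ω} [IsProbabilityMeasure P]

lemma hoeffding_two_sided {Y : ℕ → Ω → ℝ} (hind : iIndepFun Y P) (hY : ∀ j, Measurable (Y j))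
    {R μ η : ℝ} (hR : ∀ j ω, |Y j ω| ≤ R) (hμ : ∀ j, ∫ ω, Y j ω ∂P = μ) (hη : 0 ≤ η) (m : ℕ) :
    P.real {ω | η * m ≤ |∑ j ∈ Finset.range m, (Y j ω - μ)|}
      ≤ 2 * Real.exp (-(η ^ 2 * m / (2 * R ^ 2))) := by
  have hR0 : 0 ≤ R := by
    obtain ⟨ω⟩ := P.nonempty_of_neZero
    exact (abs_nonneg _).trans (hR 0 ω)
  lift R to NNReal using hR0
  -- A variable in an interval of length `2 * R` is sub-Gaussian with parameter the square of half
  -- that length.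
  have hc : (‖(R : ℝ) - -R‖₊ / 2) ^ 2 = R ^ 2 := by
    congr 1
    apply NNReal.coe_injective
    rw [NNReal.coe_div, coe_nnnorm, Real.norm_of_nonneg (by linarith [R.2])]
    simp
  have hsub : ∀ j, HasSubgaussianMGF (fun ω => Y j ω - μ) (R ^ 2) P := by
    intro j
    have := hasSubgaussianMGF_of_mem_Icc (X := Y j) (μ := P) (a := -R) (b := R)
      (hY j).aemeasurable (ae_of_all _ fun ω => abs_le.1 (hR j ω))
    rwa [hc, hμ j] at this
  -- The identity also holds for `m = 0` or `R = 0`, where division by zero makes both exponents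
  -- zero.
  have hexp : -(η * m) ^ 2 / (2 * m * ((R ^ 2 : NNReal) : ℝ))
      = -(η ^ 2 * m / (2 * R ^ 2)) := by
    rcases Nat.eq_zero_or_pos m with rfl | hm
    · simp
    have hm' : (m : ℝ) ≠ 0 := by positivity
    rcases (zero_le (a := R)).eq_or_lt with h | h
    · simp [← h]
    · push_cast
      field_simp
  have hnn : 0 ≤ η * m := by positivity
  have h1 := HasSubgaussianMGF.measure_sum_range_ge_le_of_iIndepFun (n := m)
    (hind.comp (fun _ y => y - μ) fun _ => by fun_prop)
    (c := R ^ 2) (fun j _ => hsub j) hnn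
  have h2 := HasSubgaussianMGF.measure_sum_range_ge_le_of_iIndepFun (n := m)
    (hind.comp (fun _ y => -(y - μ)) fun _ => by fun_prop)
    (c := R ^ 2) (fun j _ => (hsub j).neg) hnn
  rw [hexp] at h1 h2
  have hset : {ω | η * m ≤ |∑ j ∈ Finset.range m, (Y j ω - μ)|} ⊆
      {ω | η * m ≤ ∑ j ∈ Finset.range m, ((fun y => y - μ) ∘ Y j) ω} ∪
      {ω | η * m ≤ ∑ j ∈ Finset.range m, ((fun y => -(y - μ)) ∘ Y j) ω} := by
    intro ω hω
    rcases le_abs.1 (show η * m ≤ |∑ j ∈ Finset.range m, (Y j ω - μ)| from hω) with h | h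
    · exact Or.inl h
    · right
      change η * m ≤ ∑ j ∈ Finset.range m, -(Y j ω - μ)
      rwa [Finset.sum_neg_distrib]
  calc _ ≤ _ := measureReal_mono hset
    _ ≤ _ := measureReal_union_le _ _
    _ ≤ _ := by rw [two_mul]; exact add_le_add h1 h2

end Concentration

lemma sq_sum_pow_mul {p : ℕ} (w : Fin (p + 1) → ℝ) (u k : ℝ) :
    (∑ r : Fin (p + 1), w r * u ^ (r : ℕ)) ^ 2 * k
      = ∑ r : Fin (p + 1), ∑ s : Fin (p + 1), w r * w s * (u ^ ((r : ℕ) + s) * k) := by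
  rw [pow_two, Finset.sum_mul_sum, Finset.sum_mul]
  refine Finset.sum_congr rfl fun r _ => ?_
  rw [Finset.sum_mul]
  exact Finset.sum_congr rfl fun s _ => by rw [pow_add]; ring

/-- The LPK smoother is well conditioned when its empirical scaled moments are close to moments
`μ` whose quadratic form is bounded below. -/
lemma wellConditioned_of_moments {p : ℕ} {K : ℝ → ℝ} {h c C : ℝ} {m : ℕ} {t : ℝ}
    {τ : Fin m → ℝ} {μ : ℕ → ℝ} (hc : 0 < c)
    (hlow : ∀ w : Fin (p + 1) → ℝ, c * ∑ r, w r ^ 2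
      ≤ ∑ r : Fin (p + 1), ∑ s : Fin (p + 1), w r * w s * μ (r + s))
    (hup : μ 0 ≤ C)
    (hclose : ∀ k ∈ Finset.range (2 * p + 1),
      |∑ j, (((τ j - t) / h) ^ k * (K ((τ j - t) / h) / h) - μ k)| ≤ c / (2 * (p + 1)) * m) :
    WellConditioned p K h (c / 2) (C + c) t τ := by
  have hη : 0 < c / (2 * ((p : ℝ) + 1)) := by positivity
  set M : ℕ → ℝ := fun k => ∑ j, ((τ j - t) / h) ^ k * (K ((τ j - t) / h) / h) with hM
  have hclose' : ∀ k ∈ Finset.range (2 * p + 1), |M k - m * μ k| ≤ c / (2 * (p + 1)) * m := by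
    intro k hk
    have := hclose k hk
    rwa [Finset.sum_sub_distrib, Finset.sum_const, Finset.card_univ, Fintype.card_fin,
      nsmul_eq_mul] at this
  constructor
  · intro w
    have h1 : ∑ j, (∑ r : Fin (p + 1), w r * ((τ j - t) / h) ^ (r : ℕ)) ^ 2
        * (K ((τ j - t) / h) / h)
        = ∑ r : Fin (p + 1), ∑ s : Fin (p + 1), w r * w s * M (r + s) := by
      simp_rw [sq_sum_pow_mul]
      rw [Finset.sum_comm]
      refine Finset.sum_congr rfl fun r _ => ?_
      rw [Finset.sum_comm]
      exact Finset.sum_congr rfl fun s _ => by rw [hM, Finset.mul_sum]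
    rw [h1]
    -- Perturbing every moment by at most `c / (2 * (p + 1)) * m` changes the form by at most that
    -- times `(∑ |w r|) ^ 2 ≤ (p + 1) * ∑ w r ^ 2`, which uses up half of the lower bound `c`.
    have h2 : m * (∑ r : Fin (p + 1), ∑ s : Fin (p + 1), w r * w s * μ (r + s))
        - c / (2 * (p + 1)) * m * (∑ r, |w r|) ^ 2
        ≤ ∑ r : Fin (p + 1), ∑ s : Fin (p + 1), w r * w s * M (r + s) := by
      rw [pow_two, Finset.sum_mul_sum, Finset.mul_sum, Finset.mul_sum, ← Finset.sum_sub_distrib]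
      refine Finset.sum_le_sum fun r _ => ?_
      rw [Finset.mul_sum, Finset.mul_sum, ← Finset.sum_sub_distrib]
      refine Finset.sum_le_sum fun s _ => ?_
      have h3 := hclose' (r + s) (by rw [Finset.mem_range]; omega)
      have h4 : |w r * w s * (M (r + s) - m * μ (r + s))|
          ≤ |w r| * |w s| * (c / (2 * (p + 1)) * m) := by
        rw [abs_mul, abs_mul]
        exact mul_le_mul_of_nonneg_left h3 (by positivity)
      have h5 := (abs_le.1 h4).1
      linarith
    have h6 : (∑ r : Fin (p + 1), |w r|) ^ 2 ≤ (p + 1) * ∑ r, w r ^ 2 := by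
      have := sq_sum_le_card_mul_sum_sq (s := Finset.univ) (f := fun r : Fin (p + 1) => |w r|)
      simpa using this
    have h7 : c / (2 * (p + 1)) * m * (∑ r : Fin (p + 1), |w r|) ^ 2
        ≤ c / 2 * m * ∑ r, w r ^ 2 := by
      calc _ ≤ c / (2 * (p + 1)) * m * ((p + 1) * ∑ r, w r ^ 2) := by gcongr
        _ = _ := by field_simp
    have h8 := mul_le_mul_of_nonneg_left (hlow w) (Nat.cast_nonneg (α := ℝ) m)
    linarith
  · have h1 := (abs_le.1 (hclose' 0 (by simp))).2
    have h2 : M 0 = ∑ j, K ((τ j - t) / h) / h := by simp [hM]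
    rw [h2] at h1
    have h3 : c / (2 * ((p : ℝ) + 1)) ≤ c := by
      apply div_le_self hc.le
      have : (0 : ℝ) ≤ p := Nat.cast_nonneg p
      linarith
    have h4 := mul_le_mul_of_nonneg_left hup (Nat.cast_nonneg (α := ℝ) m)
    have h5 := mul_le_mul_of_nonneg_right h3 (Nat.cast_nonneg (α := ℝ) m)
    linarith

section Probability

variable {Ω : Type*} [MeasurableSpace Ω] {P : Measure Ω} [IsProbabilityMeasure P]

/-- Only the moments of order `0` to `2 * p` enter the Gram matrix, which explains the factor `2 * p
+ 1` in the union bound. Each summand is at most `B / h` in absolute value, hence the Hoeffding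
exponent of order `m * h ^ 2`. The event is given as a set of design configurations so that the
design can later be conditioned upon. -/
lemma exists_wellConditioned_event {T : ℕ → Ω → ℝ} {π K : ℝ → ℝ} {B h t c C : ℝ} {p : ℕ}
    (hK : IsKernel K B) (hT : ∀ j, Measurable (T j)) (hind : iIndepFun T P)
    (hπ : Measurable π) (hπ0 : ∀ s, 0 ≤ π s)
    (hlaw : ∀ j, P.map (T j) = volume.withDensity fun s => ENNReal.ofReal (π s))
    (h0 : 0 < h) (hup : ∀ u ∈ Icc (-1 : ℝ) 1, π (t + h * u) ≤ C) (hc : 0 < c)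
    (hlow : ∀ w : Fin (p + 1) → ℝ, c * ∑ r, w r ^ 2 ≤
      ∫ ω, (∑ r : Fin (p + 1), w r * ((T 0 ω - t) / h) ^ (r : ℕ)) ^ 2 *
        (K ((T 0 ω - t) / h) / h) ∂P) (m : ℕ) :
    ∃ G : Set (Fin m → ℝ), MeasurableSet G ∧
      (∀ τ ∈ G, WellConditioned p K h (c / 2) (C + c) t τ) ∧
      P.real {ω | (fun j : Fin m => T j ω) ∉ G} ≤ (2 * p + 1) *
        (2 * Real.exp (-((c / (2 * (p + 1))) ^ 2 / (2 * B ^ 2) * (m * h ^ 2)))) := by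
  have hB0 := hK.bound_nonneg
  set φ : ℕ → ℝ → ℝ := fun k s => ((s - t) / h) ^ k * (K ((s - t) / h) / h) with hφ
  have hφm : ∀ k, Measurable (φ k) := fun k => by
    have := hK.measurable
    fun_prop
  have hφb : ∀ k s, |φ k s| ≤ B / h := by
    intro k s
    have hk : |K ((s - t) / h) / h| ≤ B / h := by
      rw [abs_of_nonneg (div_nonneg (hK.nonneg _) h0.le)]
      exact div_le_div_of_nonneg_right (hK.le _) h0.le
    by_cases hu : (s - t) / h ∈ Icc (-1 : ℝ) 1
    · rw [hφ, abs_mul, abs_pow]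
      calc _ ≤ 1 * (B / h) := by
            refine mul_le_mul (pow_le_one₀ (abs_nonneg _) (abs_le.2 hu)) hk (abs_nonneg _) zero_le_one
        _ = _ := one_mul _
    · simp only [hφ, hK.supp _ hu, zero_div, mul_zero, abs_zero]
      exact div_nonneg hB0 h0.le
  set μ : ℕ → ℝ := fun k => ∫ ω, φ k (T 0 ω) ∂P with hμ
  have hμj : ∀ k j, ∫ ω, φ k (T j ω) ∂P = μ k := by
    intro k j
    have e : ∀ i, ∫ ω, φ k (T i ω) ∂P = ∫ s, φ k s ∂(P.map (T i)) := fun i =>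
      (integral_map (hT i).aemeasurable (hφm k).aestronglyMeasurable).symm
    rw [hμ, e, hlaw]; beta_reduce; rw [e, hlaw]
  have hint : ∀ k, Integrable (fun ω => φ k (T 0 ω)) P := fun k =>
    Integrable.of_bound ((hφm k).comp (hT 0)).aestronglyMeasurable (B / h)
      (ae_of_all _ fun ω => hφb k _)
  have hlow' : ∀ w : Fin (p + 1) → ℝ, c * ∑ r, w r ^ 2
      ≤ ∑ r : Fin (p + 1), ∑ s : Fin (p + 1), w r * w s * μ (r + s) := by
    intro w
    refine (hlow w).trans (le_of_eq ?_)
    simp_rw [sq_sum_pow_mul]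
    change ∫ ω, ∑ r : Fin (p + 1), ∑ s : Fin (p + 1), w r * w s * φ (r + s) (T 0 ω) ∂P = _
    rw [integral_finsetSum _ fun (r : Fin (p + 1)) _ => integrable_finsetSum _
      fun (s : Fin (p + 1)) _ => (hint (r + s)).const_mul _]
    refine Finset.sum_congr rfl fun r _ => ?_
    rw [integral_finsetSum _ fun (s : Fin (p + 1)) _ => (hint (r + s)).const_mul _]
    exact Finset.sum_congr rfl fun s _ => integral_const_mul _ _
  have hμ0 : μ 0 ≤ C := by
    have := design_mass_le hK (hT 0) hπ hπ0 (hlaw 0) h0 hup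
    simpa [hμ, hφ] using this
  have hη : 0 ≤ c / (2 * ((p : ℝ) + 1)) := by positivity
  refine ⟨⋂ k ∈ Finset.range (2 * p + 1), {τ | |∑ j, (φ k (τ j) - μ k)| ≤ c / (2 * (p + 1)) * m},
    ?_, ?_, ?_⟩
  · refine Finset.measurableSet_biInter _ fun k _ => measurableSet_le ?_ measurable_const
    exact (Finset.measurable_sum _ fun j _ =>
      ((hφm k).comp (measurable_pi_apply j)).sub_const _).norm
  · intro τ hτ
    simp only [mem_iInter, mem_ofPred_eq] at hτ
    exact wellConditioned_of_moments hc hlow' hμ0 fun k hk => hτ k hk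
  have hsub : {ω | (fun j : Fin m => T j ω) ∉ ⋂ k ∈ Finset.range (2 * p + 1),
      {τ : Fin m → ℝ | |∑ j, (φ k (τ j) - μ k)| ≤ c / (2 * (p + 1)) * m}} ⊆
      ⋃ k ∈ Finset.range (2 * p + 1), {ω | c / (2 * (p + 1)) * m ≤
        |∑ j ∈ Finset.range m, (φ k (T j ω) - μ k)|} := by
    intro ω hω
    by_contra hcon
    simp only [mem_iUnion, mem_ofPred_eq, not_exists, not_le] at hcon
    refine hω ?_
    simp only [mem_iInter, mem_ofPred_eq]
    intro k hk
    have := (hcon k hk).le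
    rwa [Finset.sum_range] at this
  calc _ ≤ _ := measureReal_mono hsub (measure_ne_top _ _)
    _ ≤ ∑ k ∈ Finset.range (2 * p + 1), P.real {ω | c / (2 * (p + 1)) * m ≤
        |∑ j ∈ Finset.range m, (φ k (T j ω) - μ k)|} := measureReal_biUnion_finset_le _ _
    _ ≤ ∑ k ∈ Finset.range (2 * p + 1),
        2 * Real.exp (-((c / (2 * (p + 1))) ^ 2 / (2 * B ^ 2) * (m * h ^ 2))) := by
        refine Finset.sum_le_sum fun k _ => ?_
        refine (hoeffding_two_sided (R := B / h) (hind.comp (fun _ => φ k) fun _ => hφm k)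
          (fun j => (hφm k).comp (hT j)) (fun j ω => hφb k _) (hμj k) hη m).trans (le_of_eq ?_)
        congr 3
        rcases hB0.eq_or_lt with h | h
        · simp [← h]
        · field_simp
    _ = _ := by
        rw [Finset.sum_const, Finset.card_range, nsmul_eq_mul]
        push_cast
        ring

end Probability

/-! ### Measurability -/

/-- The inverse is the adjugate divided by the determinant; the zero value at singular matrices
agrees with real division by zero, so no case distinction is needed. -/
lemma measurable_inv_apply {α : Type*} [MeasurableSpace α] {n : Type*} [Fintype n] [DecidableEq n]
    {A : α → Matrix n n ℝ} (hA : ∀ i j, Measurable fun x => A x i j) (i j : n) :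
    Measurable fun x => (A x)⁻¹ i j := by
  have hA' : Measurable fun x => (fun i j => A x i j : n → n → ℝ) :=
    measurable_pi_lambda _ fun i => measurable_pi_lambda _ fun j => hA i j
  have hdet : Measurable fun x => (A x).det := by
    have : Continuous fun M : n → n → ℝ => (Matrix.of M).det := by
      refine Continuous.matrix_det ?_
      exact continuous_id
    exact this.measurable.comp hA'
  have hadj : Measurable fun x => (A x).adjugate i j := by
    have : Continuous fun M : n → n → ℝ => (Matrix.of M).adjugate i j := by
      refine Continuous.matrix_elem (Continuous.matrix_adjugate ?_) i j
      exact continuous_id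
    exact this.measurable.comp hA'
  simp only [Matrix.inv_def, Ring.inverse_eq_inv', Matrix.smul_apply, smul_eq_mul]
  exact hdet.inv.mul hadj

lemma measurable_lpkCoef (p : ℕ) {K : ℝ → ℝ} (hK : Measurable K) (h : ℝ) {m : ℕ} (t : ℝ)
    (j : Fin m) : Measurable fun τ : Fin m → ℝ => lpkCoef p K h t τ j := by
  have hw : ∀ i : Fin m, Measurable fun τ : Fin m → ℝ => K ((τ i - t) / h) / h := fun i => by
    have : Measurable fun τ : Fin m → ℝ => (τ i - t) / h := by fun_prop
    exact (hK.comp this).div_const h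
  have hp : ∀ (i : Fin m) (r : ℕ), Measurable fun τ : Fin m → ℝ => (τ i - t) ^ r := fun i r => by
    fun_prop
  have hg : ∀ r s : Fin (p + 1), Measurable fun τ : Fin m → ℝ => lpkGram p K h t τ r s := by
    intro r s
    simp only [lpkGram_apply]
    exact Finset.measurable_sum _ fun i _ => ((hp i r).mul (hw i)).mul (hp i s)
  exact (Finset.measurable_sum _ fun r _ =>
    (measurable_inv_apply hg 0 r).mul (hp j r)).mul (hw j)

/-- Evaluation of a path at a time point agrees, on paths that are continuous on `U`, with a
jointly measurable function. -/
lemma exists_measurable_eval {a b : ℝ} {U : Set ℝ} (hU : U ⊆ Icc a b) (hne : U.Nonempty) :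
    ∃ F : (Icc a b → ℝ) × ℝ → ℝ, Measurable F ∧
      ∀ f : ℝ → ℝ, ContinuousOn f U → ∀ s ∈ U, F (fun r : Icc a b => f r, s) = f s := by
  obtain ⟨y₀, hy₀⟩ := hne
  -- In the product σ-algebra on paths only fixed-time evaluations are measurable. Rounding the time
  -- to finitely many values in `U` makes evaluation a finite sum of such maps, and continuity
  -- recovers the exact value in the limit.
  let r : ℕ → SimpleFunc ℝ ℝ := fun k => SimpleFunc.approxOn id measurable_id U y₀ hy₀ k
  let e : (Icc a b → ℝ) → ℝ → ℝ := fun g y => if h : y ∈ Icc a b then g ⟨y, h⟩ else 0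
  have he : ∀ y, Measurable fun g => e g y := by
    intro y
    by_cases h : y ∈ Icc a b
    · simp only [e, h, dif_pos]
      exact measurable_pi_apply _
    · simp only [e, h, dif_neg, not_false_eq_true]
      exact measurable_const
  have hF : ∀ k, Measurable fun gs : (Icc a b → ℝ) × ℝ => e gs.1 (r k gs.2) := by
    intro k
    have : (fun gs : (Icc a b → ℝ) × ℝ => e gs.1 (r k gs.2))
        = fun gs => ∑ y ∈ (r k).range, if r k gs.2 = y then e gs.1 y else 0 := by
      funext gs
      rw [Finset.sum_ite_eq, if_pos (SimpleFunc.mem_range_self _ _)]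
    rw [this]
    refine Finset.measurable_sum _ fun y _ => Measurable.ite ?_ ((he y).comp measurable_fst)
      measurable_const
    exact ((r k).measurable.comp measurable_snd) (measurableSet_singleton y)
  refine ⟨fun gs => limsup (fun k => e gs.1 (r k gs.2)) atTop, Measurable.limsup hF, ?_⟩
  intro f hf s hs
  refine Tendsto.limsup_eq ?_
  have hmem : ∀ k, r k s ∈ U := fun k => SimpleFunc.approxOn_mem measurable_id hy₀ k s
  have h1 : ∀ k, e (fun r : Icc a b => f r) (r k s) = f (r k s) := fun k => by
    simp only [e, hU (hmem k), dif_pos]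
  simp only [h1]
  have h2 : Tendsto (fun k => r k s) atTop (nhds s) :=
    SimpleFunc.tendsto_approxOn measurable_id hy₀ (subset_closure hs)
  exact (hf s hs).tendsto.comp (tendsto_nhdsWithin_iff.2 ⟨h2, Eventually.of_forall hmem⟩)

/-! ### Second moments of linear functionals of a process -/

section SecondMoments

variable {Ω : Type*} [MeasurableSpace Ω] {P : Measure Ω}

lemma IsSP.integral_mul {a b : ℝ} {X : ℝ → Ω → ℝ} {γ : ℝ → ℝ → ℝ} (hX : IsSP P a b X 0 γ) {s t : ℝ}
    (hs : s ∈ Icc a b) (ht : t ∈ Icc a b) : ∫ ω, X s ω * X t ω ∂P = γ s t := by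
  rw [← hX.cov s hs t ht, covariance, hX.mean s hs, hX.mean t ht]
  simp

lemma IsSP.integrable_mul {a b : ℝ} {X : ℝ → Ω → ℝ} {γ : ℝ → ℝ → ℝ} {m : ℝ → ℝ}
    (hX : IsSP P a b X m γ) {s t : ℝ}
    (hs : s ∈ Icc a b) (ht : t ∈ Icc a b) : Integrable (fun ω => X s ω * X t ω) P :=
  (hX.memLp s hs).integrable_mul (hX.memLp t ht)

lemma IsSP.lintegral_sq_sum {a b : ℝ} {X : ℝ → Ω → ℝ} {γ : ℝ → ℝ → ℝ} (hX : IsSP P a b X 0 γ)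
    {ι : Type*} [Fintype ι] (c s : ι → ℝ) (hs : ∀ j, s j ∈ Icc a b) :
    ∫⁻ ω, ENNReal.ofReal ((∑ j, c j * X (s j) ω) ^ 2) ∂P
      = ENNReal.ofReal (∑ j, c j * ∑ l, c l * γ (s j) (s l)) := by
  have h1 : ∀ ω, (∑ j, c j * X (s j) ω) ^ 2
      = ∑ j, ∑ l, c j * c l * (X (s j) ω * X (s l) ω) := by
    intro ω
    rw [pow_two, Finset.sum_mul_sum]
    exact Finset.sum_congr rfl fun j _ => Finset.sum_congr rfl fun l _ => by ring
  have hi : ∀ j l, Integrable (fun ω => c j * c l * (X (s j) ω * X (s l) ω)) P := fun j l =>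
    (hX.integrable_mul (hs j) (hs l)).const_mul _
  rw [← ofReal_integral_eq_lintegral_ofReal]
  · congr 1
    simp_rw [h1]
    rw [integral_finsetSum _ fun j _ => integrable_finsetSum _ fun l _ => hi j l]
    refine Finset.sum_congr rfl fun j _ => ?_
    rw [integral_finsetSum _ fun l _ => hi j l, Finset.mul_sum]
    refine Finset.sum_congr rfl fun l _ => ?_
    rw [integral_const_mul, hX.integral_mul (hs j) (hs l)]
    ring
  · simp_rw [h1]
    exact integrable_finsetSum _ fun j _ => integrable_finsetSum _ fun l _ => hi j l
  · exact ae_of_all _ fun ω => sq_nonneg _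

variable [IsProbabilityMeasure P] {a b : ℝ} {U : Set ℝ} {m : ℕ}

/-- Second moment of a random linear functional of an independent smooth process. -/
lemma lintegral_sq_functional_le {v : ℝ → Ω → ℝ} {γ : ℝ → ℝ → ℝ} {τ : Ω → Fin m → ℝ}
    (hU : U ⊆ Icc a b) (hUm : MeasurableSet U) (hv : IsSP P a b v 0 γ) (hτ : Measurable τ)
    (hcont : ∀ᵐ ω ∂P, ContinuousOn (fun s => v s ω) U)
    (hind : IndepFun (fun ω (s : Icc a b) => v s ω) τ P) (hτU : ∀ᵐ ω ∂P, ∀ j, τ ω j ∈ U)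
    {c : (Fin m → ℝ) → Fin m → ℝ} (hc : ∀ j, Measurable fun z => c z j)
    {G : Set (Fin m → ℝ)} (hG : MeasurableSet G) {t D : ℝ} (ht : t ∈ U)
    (hD : ∀ z ∈ G, (∀ j, z j ∈ U) → ∑ j : Option (Fin m), (j.elim (-1) (c z)) *
      ∑ l : Option (Fin m), (l.elim (-1) (c z)) * γ (j.elim t z) (l.elim t z) ≤ D) :
    ∫⁻ ω in {ω | τ ω ∈ G}, ENNReal.ofReal ((∑ j, c (τ ω) j * v (τ ω j) ω - v t ω) ^ 2) ∂P
      ≤ ENNReal.ofReal D := by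
  obtain ⟨F, hF, hFeq⟩ := exists_measurable_eval hU ⟨t, ht⟩
  have hpath : Measurable fun ω (s : Icc a b) => v s ω :=
    measurable_pi_lambda _ fun s => hv.measurable s s.2
  let Φ : (Icc a b → ℝ) × (Fin m → ℝ) → ℝ≥0∞ := fun gz =>
    (Prod.snd ⁻¹' G).indicator (fun gz => ENNReal.ofReal
      ((∑ j, c gz.2 j * F (gz.1, gz.2 j) - F (gz.1, t)) ^ 2)) gz
  have hΦ : Measurable Φ := by
    refine Measurable.indicator ?_ (measurable_snd hG)
    fun_prop
  have hset : MeasurableSet {ω | τ ω ∈ G} := hτ hG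
  rw [← lintegral_indicator hset]
  have h1 : ∫⁻ ω, {ω | τ ω ∈ G}.indicator (fun ω => ENNReal.ofReal
      ((∑ j, c (τ ω) j * v (τ ω j) ω - v t ω) ^ 2)) ω ∂P
      = ∫⁻ ω, Φ (fun s : Icc a b => v s ω, τ ω) ∂P := by
    refine lintegral_congr_ae ?_
    filter_upwards [hcont, hτU] with ω h1 h2
    simp only [Φ, indicator, mem_preimage, mem_ofPred_eq]
    rw [hFeq _ h1 t ht]
    simp only [fun j => hFeq _ h1 _ (h2 j)]
    rfl
  -- By independence the joint law is a product, so the design can be frozen; the inner integral is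
  -- then a second moment at deterministic times, with the index `none` standing for `t` with weight
  -- `-1`.
  rw [h1, ← lintegral_map (f := Φ) hΦ (hpath.prodMk hτ),
    (indepFun_iff_map_prod_eq_prod_map_map hpath.aemeasurable hτ.aemeasurable).1 hind,
    lintegral_prod_symm' _ hΦ]
  have hprob : IsProbabilityMeasure (P.map τ) := Measure.isProbabilityMeasure_map hτ.aemeasurable
  calc ∫⁻ z, ∫⁻ g, Φ (g, z) ∂(P.map fun ω (s : Icc a b) => v s ω) ∂(P.map τ)
      ≤ ∫⁻ _, ENNReal.ofReal D ∂(P.map τ) := by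
        refine lintegral_mono_ae ?_
        have hUz : MeasurableSet {z : Fin m → ℝ | ∀ j, z j ∈ U} := by
          have : {z : Fin m → ℝ | ∀ j, z j ∈ U} = ⋂ j, (fun z => z j) ⁻¹' U := by
            ext z
            simp
          rw [this]
          exact MeasurableSet.iInter fun j => measurable_pi_apply j hUm
        filter_upwards [(ae_map_iff hτ.aemeasurable hUz).2 hτU] with z hz
        by_cases hzG : z ∈ G
        swap
        · simp [Φ, hzG]
        rw [lintegral_map (f := fun g => Φ (g, z))
          (hΦ.comp (measurable_id.prodMk measurable_const)) hpath]
        refine le_trans (le_of_eq ?_) (ENNReal.ofReal_le_ofReal (hD z hzG hz))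
        have hmem : ∀ j : Option (Fin m), j.elim t z ∈ Icc a b := by
          rintro (_ | j)
          · exact hU ht
          · exact hU (hz j)
        rw [← hv.lintegral_sq_sum (fun j : Option (Fin m) => j.elim (-1) (c z))
          (fun j => j.elim t z) hmem]
        refine lintegral_congr_ae ?_
        filter_upwards [hcont] with ω h1
        have h2 : (Prod.snd ⁻¹' G : Set ((Icc a b → ℝ) × (Fin m → ℝ))).indicator (fun gz =>
            ENNReal.ofReal ((∑ j, c gz.2 j * F (gz.1, gz.2 j) - F (gz.1, t)) ^ 2))
            (fun s : Icc a b => v s ω, z)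
            = ENNReal.ofReal ((∑ j, c z j * F (fun s : Icc a b => v s ω, z j)
              - F (fun s : Icc a b => v s ω, t)) ^ 2) :=
          indicator_of_mem (s := (Prod.snd ⁻¹' G : Set ((Icc a b → ℝ) × (Fin m → ℝ))))
            (a := (fun s : Icc a b => v s ω, z)) hzG _
        simp only [Φ]
        rw [h2, hFeq _ h1 t ht]
        simp only [fun j => hFeq _ h1 _ (hz j), Fintype.sum_option, Option.elim]
        congr 2
        ring
    _ = ENNReal.ofReal D := by simp

/-- Second moment of a random linear combination of conditionally uncorrelated errors. -/
lemma lintegral_sq_noise_le {Ω₀ : Type*} [MeasurableSpace Ω₀] {P₀ : Measure Ω₀}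
    [IsProbabilityMeasure P₀] {ε : ℝ → Ω₀ → ℝ} {σsq : ℝ → ℝ} (hU : U ⊆ Icc a b)
    (hε : IsSP P₀ a b ε 0 fun s t => if s = t then σsq t else 0)
    {β : Type*} [MeasurableSpace β] {X : Ω → β} (hX : Measurable X) {pr : β → Fin m → ℝ}
    (hpr : Measurable pr) {e : Ω → Fin m → ℝ} (he : Measurable e)
    (hlaw : ∀ᵐ ω ∂P, condDistrib e X P (X ω) = P₀.map fun ω₀ j => ε (pr (X ω) j) ω₀)
    (hτU : ∀ᵐ ω ∂P, ∀ j, pr (X ω) j ∈ U) (hinj : ∀ᵐ ω ∂P, Function.Injective (pr (X ω)))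
    {c : (Fin m → ℝ) → Fin m → ℝ} (hc : ∀ j, Measurable fun z => c z j)
    {G : Set (Fin m → ℝ)} (hG : MeasurableSet G) {D : ℝ}
    (hD : ∀ z ∈ G, (∀ j, z j ∈ U) → ∑ j, c z j ^ 2 * σsq (z j) ≤ D) :
    ∫⁻ ω in {ω | pr (X ω) ∈ G}, ENNReal.ofReal ((∑ j, c (pr (X ω)) j * e ω j) ^ 2) ∂P
      ≤ ENNReal.ofReal D := by
  let Φ : β × (Fin m → ℝ) → ℝ≥0∞ := fun xy =>
    ((fun xy : β × (Fin m → ℝ) => pr xy.1) ⁻¹' G).indicator (fun xy => ENNReal.ofReal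
      ((∑ j, c (pr xy.1) j * xy.2 j) ^ 2)) xy
  have hΦ : Measurable Φ := by
    refine Measurable.indicator ?_ ((hpr.comp measurable_fst) hG)
    have : ∀ j, Measurable fun xy : β × (Fin m → ℝ) => c (pr xy.1) j := fun j =>
      (hc j).comp (hpr.comp measurable_fst)
    fun_prop
  have hset : MeasurableSet {ω | pr (X ω) ∈ G} := hpr.comp hX hG
  rw [← lintegral_indicator hset]
  have h1 : ∫⁻ ω, {ω | pr (X ω) ∈ G}.indicator (fun ω => ENNReal.ofReal
      ((∑ j, c (pr (X ω)) j * e ω j) ^ 2)) ω ∂P = ∫⁻ ω, Φ (X ω, e ω) ∂P := rfl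
  -- The joint law of `X` and the errors is disintegrated, so that for almost every value of `X` the
  -- errors are the process `ε` sampled at fixed times.
  rw [h1, ← lintegral_map (f := Φ) hΦ (hX.prodMk he),
    ← compProd_map_condDistrib he.aemeasurable, Measure.lintegral_compProd hΦ,
    lintegral_map (Measurable.lintegral_kernel_prod_right' hΦ) hX]
  calc ∫⁻ ω, ∫⁻ y, Φ (X ω, y) ∂(condDistrib e X P (X ω)) ∂P
      ≤ ∫⁻ _, ENNReal.ofReal D ∂P := by
        refine lintegral_mono_ae ?_
        filter_upwards [hlaw, hτU, hinj] with ω h1 h2 h3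
        by_cases hzG : pr (X ω) ∈ G
        swap
        · simp [Φ, hzG]
        have hm : Measurable fun ω₀ j => ε (pr (X ω) j) ω₀ :=
          measurable_pi_lambda _ fun j => hε.measurable _ (hU (h2 j))
        rw [h1, lintegral_map (f := fun y => Φ (X ω, y))
          (hΦ.comp (measurable_const.prodMk measurable_id)) hm]
        refine le_trans (le_of_eq ?_) (ENNReal.ofReal_le_ofReal (hD _ hzG h2))
        have h4 := hε.lintegral_sq_sum (c (pr (X ω))) (pr (X ω)) fun j => hU (h2 j)
        -- Distinct design points leave only the diagonal of the covariance; ties would contribute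
        -- cross terms.
        have h5 : ∑ j, c (pr (X ω)) j ^ 2 * σsq (pr (X ω) j) = ∑ j, c (pr (X ω)) j *
            ∑ l, c (pr (X ω)) l * (if pr (X ω) j = pr (X ω) l then σsq (pr (X ω) l) else 0) := by
          refine Finset.sum_congr rfl fun j _ => ?_
          simp only [h3.eq_iff, mul_ite, mul_zero, Finset.sum_ite_eq, Finset.mem_univ, if_true]
          ring
        rw [h5, ← h4]
        refine lintegral_congr fun ω₀ => ?_
        exact indicator_of_mem (s := (fun xy : β × (Fin m → ℝ) => pr xy.1) ⁻¹' G)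
          (a := (X ω, fun j => ε (pr (X ω) j) ω₀)) hzG _
    _ = ENNReal.ofReal D := by simp

end SecondMoments

/-! ### The reconstruction error of a single subject -/

lemma contDiffOn_isDerivChain {m : ℕ} {U : Set ℝ} (hU : UniqueDiffOn ℝ U) {f : ℝ → ℝ}
    (hf : ContDiffOn ℝ (m : WithTop ℕ∞) f U) :
    IsDerivChain m U fun k => iteratedDerivWithin k f U := by
  intro k hk s hs
  have := (hf.differentiableOn_iteratedDerivWithin (m := k) (by exact_mod_cast hk) hU) s hs
  beta_reduce
  rw [iteratedDerivWithin_succ]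
  exact this.hasDerivWithinAt

lemma exists_abs_bound_of_continuousOn {α : Type*} [TopologicalSpace α] {S : Set α}
    (hS : IsCompact S) {f : α → ℝ} (hf : ContinuousOn f S) :
    ∃ M : ℝ, 0 ≤ M ∧ ∀ s ∈ S, |f s| ≤ M := by
  obtain ⟨M, hM⟩ := hS.exists_bound_of_continuousOn hf
  exact ⟨max M 0, le_max_right _ _, fun s hs => (hM s hs).trans (le_max_left _ _)⟩

lemma ordConnected_of_eq {a b : ℝ} {U : Set ℝ} (hU : U = Ioo a b ∨ U = Icc a b) :
    U.OrdConnected := by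
  rcases hU with rfl | rfl
  · exact ordConnected_Ioo
  · exact ordConnected_Icc

lemma measurableSet_of_eq {a b : ℝ} {U : Set ℝ} (hU : U = Ioo a b ∨ U = Icc a b) :
    MeasurableSet U := by
  rcases hU with rfl | rfl
  · exact measurableSet_Ioo
  · exact measurableSet_Icc

lemma subset_Icc_of_eq {a b : ℝ} {U : Set ℝ} (hU : U = Ioo a b ∨ U = Icc a b) : U ⊆ Icc a b := by
  rcases hU with rfl | rfl
  · exact Ioo_subset_Icc_self
  · exact Subset.rfl

lemma uniqueDiffOn_of_eq {a b : ℝ} (hab : a < b) {U : Set ℝ} (hU : U = Ioo a b ∨ U = Icc a b) :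
    UniqueDiffOn ℝ U := by
  rcases hU with rfl | rfl
  · exact uniqueDiffOn_Ioo a b
  · exact uniqueDiffOn_Icc hab


section Model

variable {Ω Ω₀ : Type*} [MeasurableSpace Ω] [MeasurableSpace Ω₀]
  {P : Measure Ω} [IsProbabilityMeasure P] {P₀ : Measure Ω₀} [IsProbabilityMeasure P₀]
  {a b : ℝ} {U : Set ℝ} {q : ℕ} {x : ℕ → Ω → (Fin q → ℝ)} {β : ℝ → (Fin q → ℝ)}
  {v : ℕ → ℝ → Ω → ℝ} {T e : ℕ → ℕ → Ω → ℝ} {ε : ℝ → Ω₀ → ℝ} {γ : ℝ → ℝ → ℝ} {σsq dens : ℝ → ℝ}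
  {p : ℕ} {K : ℝ → ℝ} {N : ℕ → ℕ → ℕ} {C δ : ℝ} {h : ℕ → ℝ}

lemma ConditionA.exists_isKernel (hA : ConditionA P a b U x β v T γ σsq dens p K N C δ h) :
    ∃ B, IsKernel K B := by
  obtain ⟨B, hB⟩ := hA.K_bdd
  exact ⟨B, hA.K_measurable, hB, hA.K_symm, hA.K_nonneg, hA.K_integral, hA.K_supp⟩

lemma ConditionA.indicator_dens_nonneg
    (hA : ConditionA P a b U x β v T γ σsq dens p K N C δ h) (s : ℝ) :
    0 ≤ U.indicator dens s := by
  by_cases hs : s ∈ U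
  · rw [indicator_of_mem hs]
    exact (hA.dens_pos s hs).le
  · rw [indicator_of_notMem hs]

lemma ConditionA.measurable_indicator_dens (hU : MeasurableSet U)
    (hA : ConditionA P a b U x β v T γ σsq dens p K N C δ h) :
    Measurable (U.indicator dens) := by
  classical
  rw [← piecewise_eq_indicator]
  exact hA.dens_smooth.continuousOn.measurable_piecewise continuousOn_const hU

/-- The regularity of `dens` is assumed on `U` only. Outside `U` it can be nonzero at most at the
endpoints, a null set, so the truncated density, which is measurable and nonnegative everywhere, has
the same law. -/
lemma ConditionA.map_design (hU : U = Ioo a b ∨ U = Icc a b)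
    (hA : ConditionA P a b U x β v T γ σsq dens p K N C δ h) (i j : ℕ) :
    P.map (T i j) = volume.withDensity fun s => ENNReal.ofReal (U.indicator dens s) := by
  rw [hA.design_law]
  refine withDensity_congr_ae ?_
  have hfin : ∀ᵐ s : ℝ, s ∉ ({a, b} : Set ℝ) :=
    measure_eq_zero_iff_ae_notMem.1 ((Set.toFinite {a, b}).measure_zero volume)
  filter_upwards [hfin] with s hs
  by_cases hsU : s ∈ U
  · rw [indicator_of_mem hsU]
  · rw [indicator_of_notMem hsU, hA.dens_zero]
    intro hsI
    simp only [mem_insert_iff, mem_singleton_iff, not_or] at hs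
    refine hsU ?_
    rcases hU with rfl | rfl
    · exact ⟨lt_of_le_of_ne hsI.1 (Ne.symm hs.1), lt_of_le_of_ne hsI.2 hs.2⟩
    · exact hsI

lemma ConditionA.ae_design_mem (hU : U = Ioo a b ∨ U = Icc a b)
    (hmodel : IsModel P P₀ a b x v T e ε γ σsq)
    (hA : ConditionA P a b U x β v T γ σsq dens p K N C δ h) :
    ∀ᵐ ω ∂P, ∀ i j, T i j ω ∈ U := by
  rw [ae_all_iff]
  intro i
  rw [ae_all_iff]
  intro j
  have hUm := measurableSet_of_eq hU
  have h1 : ∀ᵐ s ∂(P.map (T i j)), s ∈ U := by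
    rw [hA.map_design hU, ae_withDensity_iff]
    · refine ae_of_all _ fun s hs => ?_
      by_contra hsU
      simp [indicator_of_notMem hsU] at hs
    · exact (hA.measurable_indicator_dens hUm).ennreal_ofReal
  exact (ae_map_iff (hmodel.T_measurable i j).aemeasurable hUm).1 h1

/-- Independent variables with atomless laws almost surely differ: the diagonal is null for the
product law. -/
lemma ConditionA.ae_design_injective (hmodel : IsModel P P₀ a b x v T e ε γ σsq)
    (hA : ConditionA P a b U x β v T γ σsq dens p K N C δ h) :
    ∀ᵐ ω ∂P, ∀ i j k, T i j ω = T i k ω → j = k := by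
  rw [ae_all_iff]
  intro i
  rw [ae_all_iff]
  intro j
  rw [ae_all_iff]
  intro k
  by_cases hjk : j = k
  · exact ae_of_all _ fun _ _ => hjk
  have hm := hmodel.T_measurable
  have hind : IndepFun (T i j) (T i k) P :=
    hA.design_indep.indepFun (i := (i, j)) (j := (i, k)) (by simpa using hjk)
  have hna : ∀ s : ℝ, P.map (T i k) {s} = 0 := by
    rw [hA.design_law]
    exact fun s => (withDensity_absolutelyContinuous _ _) (measure_singleton s)
  have hp1 : IsProbabilityMeasure (P.map (T i j)) :=
    Measure.isProbabilityMeasure_map (hm i j).aemeasurable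
  have hp2 : IsProbabilityMeasure (P.map (T i k)) :=
    Measure.isProbabilityMeasure_map (hm i k).aemeasurable
  have hdiag : MeasurableSet {z : ℝ × ℝ | z.1 = z.2} :=
    measurableSet_eq_fun measurable_fst measurable_snd
  have h1 : ∀ᵐ z ∂((P.map (T i j)).prod (P.map (T i k))), z.1 ≠ z.2 := by
    rw [ae_iff]
    simp only [ne_eq, not_not]
    rw [Measure.prod_apply hdiag]
    simp [preimage, hna]
  rw [← (indepFun_iff_map_prod_eq_prod_map_map (hm i j).aemeasurable
    (hm i k).aemeasurable).1 hind] at h1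
  have h2 := (ae_map_iff ((hm i j).prodMk (hm i k)).aemeasurable hdiag.compl).1 h1
  filter_upwards [h2] with ω hω h
  exact absurd h hω

lemma ConditionA.ae_continuousOn_effect
    (hA : ConditionA P a b U x β v T γ σsq dens p K N C δ h) (i : ℕ) :
    ∀ᵐ ω ∂P, ContinuousOn (fun s => v i s ω) U := by
  filter_upwards [hA.indiv_smooth i] with ω hω
  have h1 : ContinuousOn (fun s => x i ω ⬝ᵥ β s) U := by
    simp only [dotProduct]
    exact continuousOn_finsetSum _ fun r _ => continuousOn_const.mul
      ((continuous_apply r).comp_continuousOn hA.beta_smooth.continuousOn)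
  refine (hω.continuousOn.sub h1).congr fun s _ => ?_
  simp [indiv]

lemma ConditionB.memLp_apply (hB : ConditionB P U x v) (i : ℕ) (r : Fin q) :
    MemLp (fun ω => x i ω r) 2 P :=
  ((hB.x_ident i).symm.memLp_snd hB.x_memLp).eval r

/-- The first reconstruction error decomposition. -/
lemma lpk_obs_sub_indiv (i m : ℕ) (t hh : ℝ) (ω : Ω) :
    lpk p K hh t (fun j : Fin m => T i j ω) (fun j : Fin m => obs x β v T e i j ω)
        - indiv x β v i t ω
      = (∑ r, x i ω r * (∑ j : Fin m, lpkCoef p K hh t (fun j : Fin m => T i j ω) j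
            * β (T i j ω) r - β t r))
        + (∑ j : Fin m, lpkCoef p K hh t (fun j : Fin m => T i j ω) j * v i (T i j ω) ω - v i t ω)
        + ∑ j : Fin m, lpkCoef p K hh t (fun j : Fin m => T i j ω) j * e i j ω := by
  rw [lpk_eq_sum]
  simp only [obs, indiv, dotProduct, mul_add, mul_sub, Finset.sum_add_distrib,
    Finset.sum_sub_distrib, Finset.mul_sum]
  rw [Finset.sum_comm]
  have : ∀ (r : Fin q) (j : Fin m), lpkCoef p K hh t (fun j : Fin m => T i j ω) j *
      (x i ω r * β (T i j ω) r) = x i ω r * (lpkCoef p K hh t (fun j : Fin m => T i j ω) j *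
      β (T i j ω) r) := fun r j => by ring
  simp only [this]
  ring

/-- The bias part of the reconstruction error caused by the mean functions. -/
lemma exists_beta_bias_bound (hU : U.OrdConnected) (hUd : UniqueDiffOn ℝ U)
    (hβ : ContDiffOn ℝ ((p + 1 : ℕ) : WithTop ℕ∞) β U) {S' : Set ℝ} (hS' : IsCompact S')
    (hS'U : S' ⊆ U) :
    ∃ M : ℝ, 0 ≤ M ∧ ∀ (r : Fin q) (t hh : ℝ) (ι : Type) [Fintype ι] (c s : ι → ℝ), t ∈ U →
      0 ≤ hh → (∀ u ∈ U, |u - t| ≤ hh → u ∈ S') → (∀ j, s j ∈ U) →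
      (∀ j, c j ≠ 0 → |s j - t| ≤ hh) → (∀ k < p + 1, ∑ j, c j * (s j - t) ^ k = 0) →
      |∑ j, c j * β (s j) r| ≤ M * hh ^ (p + 1) * ∑ j, |c j| := by
  have hβr : ∀ r, ContDiffOn ℝ ((p + 1 : ℕ) : WithTop ℕ∞) (fun s => β s r) U := fun r =>
    (contDiff_apply ℝ ℝ r).comp_contDiffOn hβ
  have hcont : ∀ r, ∃ M : ℝ, 0 ≤ M ∧ ∀ s ∈ S',
      |iteratedDerivWithin (p + 1) (fun s => β s r) U s| ≤ M := fun r =>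
    exists_abs_bound_of_continuousOn hS'
      (((hβr r).continuousOn_iteratedDerivWithin le_rfl hUd).mono hS'U)
  choose M hM0 hM using hcont
  refine ⟨∑ r, M r, Finset.sum_nonneg fun r _ => hM0 r, ?_⟩
  intro r t hh ι _ c s ht h0 hwin hs hsh hc
  have := (contDiffOn_isDerivChain hUd (hβr r)).functional_bound (M := ∑ r, M r) hU ht h0 hs hsh hc
    fun u hu hut => (hM r u (hwin u hu hut)).trans
      (Finset.single_le_sum (fun r _ => hM0 r) (Finset.mem_univ r))
  simpa using this

lemma sq_dotProduct_le {x' b' : Fin q → ℝ} {A : ℝ} (hb : ∀ r, |b' r| ≤ A) :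
    (∑ r, x' r * b' r) ^ 2 ≤ q * A ^ 2 * ∑ r, x' r ^ 2 := by
  have h1 := Finset.sum_mul_sq_le_sq_mul_sq Finset.univ x' b'
  have h2 : ∑ r, b' r ^ 2 ≤ q * A ^ 2 := by
    calc ∑ r, b' r ^ 2 ≤ ∑ _r : Fin q, A ^ 2 := Finset.sum_le_sum fun r _ => by
          rw [← sq_abs]
          exact pow_le_pow_left₀ (abs_nonneg _) (hb r) 2
      _ = q * A ^ 2 := by simp
  have h3 : 0 ≤ ∑ r, x' r ^ 2 := Finset.sum_nonneg fun r _ => sq_nonneg _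
  nlinarith

lemma ofReal_sq_add_three_le (y z w Y : ℝ) (hY : y ^ 2 ≤ Y) :
    ENNReal.ofReal ((y + z + w) ^ 2) ≤ 3 * (ENNReal.ofReal Y + (ENNReal.ofReal (z ^ 2) +
      ENNReal.ofReal (w ^ 2))) := by
  have h3 : (3 : ℝ≥0∞) = ENNReal.ofReal 3 := by simp
  have hY0 : 0 ≤ Y := (sq_nonneg _).trans hY
  rw [h3, ← ENNReal.ofReal_add (sq_nonneg _) (sq_nonneg _),
    ← ENNReal.ofReal_add hY0 (by positivity), ← ENNReal.ofReal_mul (by norm_num)]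
  apply ENNReal.ofReal_le_ofReal
  nlinarith [sq_nonneg (y - z), sq_nonneg (y - w), sq_nonneg (z - w)]

/-- On an event of overwhelming probability, the reconstruction error of a subject has second
moment of the order of squared bias plus variance, uniformly in subject and time. -/
lemma exists_error_bound (hab : a < b) (hU : U = Ioo a b ∨ U = Icc a b)
    (hmodel : IsModel P P₀ a b x v T e ε γ σsq)
    (hA : ConditionA P a b U x β v T γ σsq dens p K N C δ h) (hB : ConditionB P U x v)
    {S : Set ℝ} (hSU : S ⊆ U) (hS : IsCompact S) :
    ∃ ρ > 0, ∃ κ > 0, ∃ D : ℝ, 0 ≤ D ∧ ∀ t ∈ S, ∀ hh : ℝ, 0 < hh → hh ≤ ρ → ∀ i m : ℕ, 0 < m →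
      ∃ G : Set (Fin m → ℝ), MeasurableSet G ∧
        P.real {ω | (fun j : Fin m => T i j ω) ∉ G} ≤ D * Real.exp (-(κ * (m * hh ^ 2))) ∧
        ∫⁻ ω in {ω | (fun j : Fin m => T i j ω) ∈ G}, ENNReal.ofReal
          ((lpk p K hh t (fun j : Fin m => T i j ω) (fun j : Fin m => obs x β v T e i j ω)
            - indiv x β v i t ω) ^ 2) ∂P
          ≤ ENNReal.ofReal (D * (hh ^ (2 * (p + 1)) + 1 / (m * hh))) := by
  have hUo := ordConnected_of_eq hU
  have hUm := measurableSet_of_eq hU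
  have hUI := subset_Icc_of_eq hU
  have hUd := uniqueDiffOn_of_eq hab hU
  obtain ⟨B, hK⟩ := hA.exists_isKernel
  have hB0 := hK.bound_nonneg
  obtain ⟨c₀, hc₀, hhalf⟩ := hK.exists_half_moment_lower_both p
  obtain ⟨ρ, hρ, S', hS'U, hS', hwin, hside⟩ := exists_compact_window hab hU hSU hS
  have hdc : ContinuousOn dens S' := hA.dens_smooth.continuousOn.mono hS'U
  obtain ⟨πmin, hπmin, hπle⟩ := hS'.exists_forall_le' hdc fun s hs => hA.dens_pos s (hS'U hs)
  obtain ⟨πmax, hπmax0, hπmax⟩ := exists_abs_bound_of_continuousOn hS' hdc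
  obtain ⟨σm, hσm0, hσm⟩ := exists_abs_bound_of_continuousOn hS' (hA.var_cont.mono hS'U)
  obtain ⟨g, hg0, hgc, hg₁, hg₂⟩ := hA.cov_smooth
  obtain ⟨Mγ, hMγ0, hMγ⟩ := exists_abs_bound_of_continuousOn (hS'.prod hS')
    ((hgc (p + 1) le_rfl (p + 1) le_rfl).mono (prod_mono hS'U hS'U))
  obtain ⟨Mβ, hMβ0, hMβ⟩ := exists_beta_bias_bound (q := q) hUo hUd hA.beta_smooth hS' hS'U
  -- The population moment form is at least the density minimum times the half-kernel constant.
  set c : ℝ := πmin * c₀ with hc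
  have hcpos : 0 < c := mul_pos hπmin hc₀
  -- Total variation of the signed measure: one for the mass at `t`, and the absolute sum of the
  -- weights under conditioning constants `c / 2` and `πmax + c`.
  set A : ℝ := 1 + √((πmax + c) / (c / 2)) with hAdef
  have hA0 : 0 ≤ A := by positivity
  set X2 : ℝ := ∫ ω, ∑ r, x 0 ω r ^ 2 ∂P with hX2
  have hX20 : 0 ≤ X2 := integral_nonneg fun ω => Finset.sum_nonneg fun r _ => sq_nonneg _
  set κ : ℝ := (c / (2 * (p + 1))) ^ 2 / (2 * B ^ 2) with hκ
  -- Strict positivity is needed because `κ` has `B ^ 2` in its denominator and would be zero for `B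
  -- = 0`.
  have hBpos : 0 < B := by
    rcases hB0.eq_or_lt with h | h
    · exfalso
      have hz : ∀ u, K u = 0 := fun u => le_antisymm ((hK.le u).trans h.symm.le) (hK.nonneg u)
      have := hK.integral
      simp [hz] at this
    · exact h
  set D₁ : ℝ := q * (Mβ * A) ^ 2 * X2 with hD₁
  set D₂ : ℝ := Mγ * A ^ 2 with hD₂
  set D₃ : ℝ := B / (c / 2) * σm with hD₃
  have hD₁0 : 0 ≤ D₁ := by positivity
  have hD₂0 : 0 ≤ D₂ := by positivity
  have hD₃0 : 0 ≤ D₃ := by positivity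
  -- One constant serves both bounds: `2 * (2 * p + 1)` is the union-bound factor, and `3` comes
  -- from the square of a sum of three terms (mean function, subject effect, error).
  refine ⟨ρ, hρ, κ, by positivity, 2 * (2 * p + 1) + 3 * (D₁ + D₂ + D₃), by positivity, ?_⟩
  intro t ht hh h0 hhρ i m hm
  have htU := hSU ht
  have hwin' : ∀ u ∈ U, |u - t| ≤ hh → u ∈ S' := fun u hu hut => hwin t ht u hu (hut.trans hhρ)
  have hmemS : ∀ u ∈ Icc (-1 : ℝ) 1, t + hh * u ∈ U → t + hh * u ∈ S' := by
    intro u hu huU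
    refine hwin' _ huU ?_
    rw [add_sub_cancel_left, abs_mul, abs_of_pos h0]
    exact mul_le_of_le_one_right h0.le (abs_le.2 hu)
  have hup : ∀ u ∈ Icc (-1 : ℝ) 1, U.indicator dens (t + hh * u) ≤ πmax := by
    intro u hu
    by_cases huU : t + hh * u ∈ U
    · rw [indicator_of_mem huU]
      exact (le_abs_self _).trans (hπmax _ (hmemS u hu huU))
    · rw [indicator_of_notMem huU]
      exact hπmax0
  have hlowπ : ∀ u ∈ Icc (-1 : ℝ) 1, t + hh * u ∈ U → πmin ≤ U.indicator dens (t + hh * u) := by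
    intro u hu huU
    rw [indicator_of_mem huU]
    exact hπle _ (hmemS u hu huU)
  have hlow : (∀ u ∈ Icc (0 : ℝ) 1, πmin ≤ U.indicator dens (t + hh * u)) ∨
      (∀ u ∈ Icc (-1 : ℝ) 0, πmin ≤ U.indicator dens (t + hh * u)) := by
    rcases hside t ht hh h0 hhρ with hs | hs
    · exact Or.inl fun u hu => hlowπ u ⟨by linarith [hu.1], hu.2⟩ (hs u hu)
    · exact Or.inr fun u hu => hlowπ u ⟨hu.1, by linarith [hu.2]⟩ (hs u hu)
  have hdm := hA.measurable_indicator_dens hUm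
  have hTm := hmodel.T_measurable
  obtain ⟨G, hG, hGW, hGP⟩ := exists_wellConditioned_event (P := P) (T := T i) (p := p)
    (π := U.indicator dens) (c := c) (C := πmax) (t := t) hK (hTm i)
    (hA.design_indep.precomp (g := fun j => (i, j)) fun j k hjk => by simpa using hjk) hdm
    hA.indicator_dens_nonneg (hA.map_design hU i) h0 hup hcpos
    (fun w => le_design_moment hK (hTm i 0) hdm hA.indicator_dens_nonneg (hA.map_design hU i 0) h0
      hup hπmin.le hlow (hhalf w)) m
  have hc2 : 0 < c / 2 := by positivity
  have hτm : Measurable fun ω (j : Fin m) => T i j ω := measurable_pi_lambda _ fun j => hTm i j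
  have hTU := hA.ae_design_mem hU hmodel
  refine ⟨G, hG, hGP.trans ?_, ?_⟩
  · rw [← mul_assoc]
    refine mul_le_mul_of_nonneg_right ?_ (Real.exp_nonneg _)
    nlinarith
  -- the signed measure `∑ W_j δ_{τ_j} - δ_t`
  let cW : (Fin m → ℝ) → Option (Fin m) → ℝ := fun z j => j.elim (-1) (lpkCoef p K hh t z)
  have hcW_sum : ∀ z ∈ G, ∑ j, |cW z j| ≤ A := by
    intro z hz
    rw [Fintype.sum_option]
    simp only [cW, Option.elim, abs_neg, abs_one, hAdef]
    gcongr
    exact (hGW z hz).sum_abs_coef_le h0 hc2 hm hK.nonneg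
  have hcW_supp : ∀ z : Fin m → ℝ, ∀ j, cW z j ≠ 0 → |j.elim t z - t| ≤ hh := by
    rintro z (_ | j) hj
    · simpa using h0.le
    · by_contra hcon
      exact hj (lpkCoef_eq_zero hK.supp h0 (not_le.1 hcon))
  have hcW_ann : ∀ z ∈ G, ∀ k < p + 1, ∑ j, cW z j * (j.elim t z - t) ^ k = 0 := by
    intro z hz k hk
    rw [Fintype.sum_option]
    simp only [cW, Option.elim, sub_self, (hGW z hz).sum_coef_mul_pow h0 hc2 hm hk]
    by_cases hk0 : k = 0 <;> simp [hk0]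
  have hcW_mem : ∀ z : Fin m → ℝ, (∀ j, z j ∈ U) → ∀ j : Option (Fin m), j.elim t z ∈ U := by
    rintro z hz (_ | j)
    · exact htU
    · exact hz j
  have hψ : Measurable fun (d : ℕ → ℝ) (j : Fin m) => d j := by fun_prop
  -- subject effect
  have hu := lintegral_sq_functional_le (c := fun z => lpkCoef p K hh t z)
    (D := D₂ * hh ^ (2 * (p + 1))) (t := t) hUI hUm (hmodel.v_sp i) hτm
    (hA.ae_continuousOn_effect i)
    ((hmodel.v_indep i).comp measurable_id hψ)
    (hTU.mono fun ω hω j => hω i j) (fun j => measurable_lpkCoef p hK.measurable hh t j) hG htU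
    (by
      intro z hz hzU
      have h1 := bilinear_functional_bound (c := cW z) (s := fun j => j.elim t z) (M := Mγ)
        hUo hg₁ hg₂ htU h0.le (hcW_mem z hzU) (hcW_supp z) (hcW_ann z hz)
        (fun u hu hut u' hu' hut' => hMγ (u, u') ⟨hwin' u hu hut, hwin' u' hu' hut'⟩)
      simp only [fun j l => hg0 _ (hcW_mem z hzU j) _ (hcW_mem z hzU l)] at h1
      refine (le_abs_self _).trans (h1.trans ?_)
      calc Mγ * (hh ^ (p + 1) * ∑ j, |cW z j|) ^ 2 ≤ Mγ * (hh ^ (p + 1) * A) ^ 2 := by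
            have := hcW_sum z hz
            gcongr
        _ = D₂ * hh ^ (2 * (p + 1)) := by
            rw [hD₂]
            ring)
  -- errors
  have hXm : Measurable fun ω => (x i ω, vPath a b v i ω, design T i ω) :=
    (hmodel.x_measurable i).prodMk ((measurable_pi_lambda _ fun s : Icc a b =>
      (hmodel.v_sp i).measurable s s.2).prodMk (measurable_pi_lambda _ fun j => hTm i j))
  have hw := lintegral_sq_noise_le (P := P) (P₀ := P₀) (U := U) (ε := ε) (σsq := σsq)
    (c := fun z => lpkCoef p K hh t z) (D := D₃ * (1 / (m * hh)))
    (e := fun ω (j : Fin m) => e i j ω) hUI hmodel.eps_sp hXm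
    (pr := fun y (j : Fin m) => y.2.2 j) (by fun_prop)
    (measurable_pi_lambda _ fun j => hmodel.e_measurable i j) (hmodel.e_law i m)
    (hTU.mono fun ω hω j => hω i j)
    ((hA.ae_design_injective hmodel).mono fun ω hω j k hjk => Fin.ext (hω i j k hjk))
    (fun j => measurable_lpkCoef p hK.measurable hh t j) hG
    (by
      intro z hz hzU
      have hm' : (0 : ℝ) < m := by exact_mod_cast hm
      calc ∑ j, lpkCoef p K hh t z j ^ 2 * σsq (z j)
          ≤ ∑ j, lpkCoef p K hh t z j ^ 2 * σm := by
            refine Finset.sum_le_sum fun j _ => ?_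
            by_cases hj : lpkCoef p K hh t z j = 0
            · simp [hj]
            refine mul_le_mul_of_nonneg_left ?_ (sq_nonneg _)
            exact (le_abs_self _).trans (hσm _ (hwin' _ (hzU j) (hcW_supp z (some j) hj)))
        _ = (∑ j, lpkCoef p K hh t z j ^ 2) * σm := by rw [Finset.sum_mul]
        _ ≤ B / (c / 2 * (m * hh)) * σm :=
            mul_le_mul_of_nonneg_right
              ((hGW z hz).sum_coef_sq_le h0 hc2 hm hK.nonneg hK.le) hσm0
        _ = D₃ * (1 / (m * hh)) := by
            rw [hD₃]
            field_simp)
  -- mean functions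
  have hb : ∀ᵐ ω ∂P, (fun j : Fin m => T i j ω) ∈ G → ∀ r,
      |∑ j : Fin m, lpkCoef p K hh t (fun j : Fin m => T i j ω) j * β (T i j ω) r - β t r|
        ≤ Mβ * A * hh ^ (p + 1) := by
    filter_upwards [hTU] with ω hω hωG r
    have h1 := hMβ r t hh (Option (Fin m)) (cW fun j : Fin m => T i j ω)
      (fun j => j.elim t fun j : Fin m => T i j ω) htU h0.le hwin' (hcW_mem _ fun j => hω i j)
      (hcW_supp _) (hcW_ann _ hωG)
    rw [Fintype.sum_option] at h1
    have h2 := hcW_sum _ hωG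
    refine le_trans (le_of_eq ?_) (h1.trans ?_)
    · congr 1
      simp only [cW, Option.elim]
      ring
    · calc _ ≤ Mβ * hh ^ (p + 1) * A := by gcongr
        _ = _ := by ring
  set E : Set Ω := {ω | (fun j : Fin m => T i j ω) ∈ G} with hE
  have hEm : MeasurableSet E := hτm hG
  have hxm : ∀ r, Measurable fun ω => x i ω r := fun r =>
    (measurable_pi_apply r).comp (hmodel.x_measurable i)
  have hx2 : ∫⁻ ω in E, ENNReal.ofReal (q * (Mβ * A * hh ^ (p + 1)) ^ 2 * ∑ r, x i ω r ^ 2) ∂P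
      ≤ ENNReal.ofReal (D₁ * hh ^ (2 * (p + 1))) := by
    refine (setLIntegral_le_lintegral _ _).trans ?_
    have hint : Integrable (fun ω => ∑ r, x i ω r ^ 2) P :=
      integrable_finsetSum _ fun r _ => (hB.memLp_apply i r).integrable_sq
    rw [← ofReal_integral_eq_lintegral_ofReal (hint.const_mul _)
      (ae_of_all _ fun ω => mul_nonneg (by positivity)
        (Finset.sum_nonneg fun r _ => sq_nonneg _)), integral_const_mul]
    have hX : ∫ ω, ∑ r, x i ω r ^ 2 ∂P = X2 :=
      ((hB.x_ident i).comp (u := fun y : Fin q → ℝ => ∑ r, y r ^ 2) (by fun_prop)).integral_eq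
    rw [hX]
    apply ENNReal.ofReal_le_ofReal (le_of_eq _)
    rw [hD₁]
    ring
  have hcm : ∀ j, Measurable fun ω => lpkCoef p K hh t (fun j : Fin m => T i j ω) j := fun j =>
    (measurable_lpkCoef p hK.measurable hh t j).comp hτm
  calc ∫⁻ ω in E, ENNReal.ofReal
          ((lpk p K hh t (fun j : Fin m => T i j ω) (fun j : Fin m => obs x β v T e i j ω)
            - indiv x β v i t ω) ^ 2) ∂P
      ≤ ∫⁻ ω in E, 3 * (ENNReal.ofReal (q * (Mβ * A * hh ^ (p + 1)) ^ 2 * ∑ r, x i ω r ^ 2) +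
          (ENNReal.ofReal ((∑ j : Fin m, lpkCoef p K hh t (fun j : Fin m => T i j ω) j
              * v i (T i j ω) ω - v i t ω) ^ 2) +
            ENNReal.ofReal ((∑ j : Fin m, lpkCoef p K hh t (fun j : Fin m => T i j ω) j
              * e i j ω) ^ 2))) ∂P := by
        refine lintegral_mono_ae ?_
        filter_upwards [ae_restrict_of_ae hb, ae_restrict_mem hEm] with ω h1 h2
        rw [lpk_obs_sub_indiv]
        exact ofReal_sq_add_three_le _ _ _ _ (sq_dotProduct_le (h1 h2))
    _ ≤ 3 * (ENNReal.ofReal (D₁ * hh ^ (2 * (p + 1))) +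
          (ENNReal.ofReal (D₂ * hh ^ (2 * (p + 1))) + ENNReal.ofReal (D₃ * (1 / (m * hh))))) := by
        rw [lintegral_const_mul' _ _ (by norm_num), lintegral_add_left (by fun_prop),
          lintegral_add_right]
        · gcongr
          exact hw
        · have := hmodel.e_measurable i
          fun_prop
    _ ≤ ENNReal.ofReal ((2 * (2 * p + 1) + 3 * (D₁ + D₂ + D₃)) *
          (hh ^ (2 * (p + 1)) + 1 / (m * hh))) := by
        have h3 : (3 : ℝ≥0∞) = ENNReal.ofReal 3 := by simp
        have hH : 0 ≤ hh ^ (2 * (p + 1)) := by positivity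
        have hH' : 0 ≤ 1 / ((m : ℝ) * hh) := by positivity
        rw [h3, ← ENNReal.ofReal_add (by positivity) (by positivity),
          ← ENNReal.ofReal_add (by positivity) (by positivity),
          ← ENNReal.ofReal_mul (by norm_num)]
        apply ENNReal.ofReal_le_ofReal
        have hp0 : (0 : ℝ) ≤ 2 * (2 * p + 1) := by positivity
        nlinarith [mul_nonneg hD₁0 hH', mul_nonneg hD₂0 hH', mul_nonneg hD₃0 hH,
          mul_nonneg hp0 hH, mul_nonneg hp0 hH']

end Model

/-! ### Boundedness in probability -/

section OUP

variable {Ω : Type*} [MeasurableSpace Ω] {P : Measure Ω} {ι : Type*} {A : ℕ → Set ι}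

lemma IsOUP.mono {E F : Type*} [Norm E] [Norm F] {X : ℕ → ι → Ω → E} {Z : ℕ → ι → Ω → F}
    (hX : IsOUP P A X)
    (h : ∀ᶠ n in atTop, ∀ α ∈ A n, ∀ᵐ ω ∂P, ‖Z n α ω‖ ≤ ‖X n α ω‖) : IsOUP P A Z := by
  intro ε hε
  obtain ⟨M, hM⟩ := hX ε hε
  refine ⟨M, ?_⟩
  filter_upwards [hM, h] with n h1 h2 α hα
  refine (measure_mono_ae ?_).trans (h1 α hα)
  filter_upwards [h2 α hα] with ω hω h3
  exact lt_of_lt_of_le h3 hω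

lemma IsOUP.comp {E κ : Type*} [Norm E] {X : ℕ → ι → Ω → E} (hX : IsOUP P A X) {B : ℕ → Set κ}
    (f : κ → ι) (hf : ∀ n, MapsTo f (B n) (A n)) : IsOUP P B fun n α ω => X n (f α) ω := by
  intro ε hε
  obtain ⟨M, hM⟩ := hX ε hε
  exact ⟨M, hM.mono fun n h α hα => h (f α) (hf n hα)⟩

/-- Each argument is bounded outside an event of probability `ε / 2`, and `φ` maps bounded pairs to
a bounded set. -/
lemma IsOUP.map₂ {X Y Z : ℕ → ι → Ω → ℝ} (hX : IsOUP P A X) (hY : IsOUP P A Y)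
    (φ : ℝ → ℝ → ℝ) (hφ : ∀ M₁ M₂, ∃ M, ∀ y z, ‖y‖ ≤ M₁ → ‖z‖ ≤ M₂ → ‖φ y z‖ ≤ M)
    (hZ : ∀ n α ω, Z n α ω = φ (X n α ω) (Y n α ω)) : IsOUP P A Z := by
  intro ε hε
  obtain ⟨M₁, h1⟩ := hX (ε / 2) (half_pos hε)
  obtain ⟨M₂, h2⟩ := hY (ε / 2) (half_pos hε)
  obtain ⟨M, hM⟩ := hφ M₁ M₂
  refine ⟨M, ?_⟩
  filter_upwards [h1, h2] with n h1 h2 α hα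
  have hsub : {ω | M < ‖Z n α ω‖} ⊆ {ω | M₁ < ‖X n α ω‖} ∪ {ω | M₂ < ‖Y n α ω‖} := by
    intro ω hω
    by_contra hcon
    simp only [mem_union, mem_ofPred_eq, not_or, not_lt] at hcon
    have := hM _ _ hcon.1 hcon.2
    rw [← hZ] at this
    exact absurd hω (not_lt.2 this)
  calc _ ≤ _ := measure_mono hsub
    _ ≤ _ := measure_union_le _ _
    _ ≤ ENNReal.ofReal (ε / 2) + ENNReal.ofReal (ε / 2) := add_le_add (h1 α hα) (h2 α hα)
    _ = ENNReal.ofReal ε := by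
        rw [← ENNReal.ofReal_add (half_pos hε).le (half_pos hε).le, add_halves]

lemma IsOUP.mul {X Y : ℕ → ι → Ω → ℝ} (hX : IsOUP P A X) (hY : IsOUP P A Y) :
    IsOUP P A fun n α ω => X n α ω * Y n α ω :=
  hX.map₂ hY (fun y z => y * z) (fun M₁ M₂ => ⟨M₁ * M₂, fun y z hy hz => by
    rw [norm_mul]
    exact mul_le_mul hy hz (norm_nonneg _) ((norm_nonneg _).trans hy)⟩) fun _ _ _ => rfl

lemma IsOUP.add {X Y : ℕ → ι → Ω → ℝ} (hX : IsOUP P A X) (hY : IsOUP P A Y) :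
    IsOUP P A fun n α ω => X n α ω + Y n α ω :=
  hX.map₂ hY (fun y z => y + z) (fun M₁ M₂ => ⟨M₁ + M₂, fun _ _ hy hz =>
    (norm_add_le _ _).trans (add_le_add hy hz)⟩) fun _ _ _ => rfl

lemma IsOUP.sqrt {X : ℕ → ι → Ω → ℝ} (hX : IsOUP P A X) :
    IsOUP P A fun n α ω => √(X n α ω) :=
  hX.map₂ hX (fun y _ => √y) (fun M₁ _ => ⟨√M₁, fun y _ hy _ => by
    rw [Real.norm_of_nonneg (Real.sqrt_nonneg _)]
    exact Real.sqrt_le_sqrt ((le_abs_self _).trans hy)⟩) fun _ _ _ => rfl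

lemma IsOUP.of_lintegral_le {X : ℕ → ι → Ω → ℝ} {C : ℝ}
    (h : ∀ᶠ n in atTop, ∀ α ∈ A n, AEMeasurable (X n α) P ∧ (∀ ω, 0 ≤ X n α ω) ∧
      ∫⁻ ω, ENNReal.ofReal (X n α ω) ∂P ≤ ENNReal.ofReal C) : IsOUP P A X := by
  intro ε hε
  -- Markov's inequality; the maximum with one keeps the threshold positive.
  refine ⟨max C 1 / ε, h.mono fun n hn α hα => ?_⟩
  obtain ⟨hm, h0, hle⟩ := hn α hα
  have hM : 0 < max C 1 / ε := by positivity
  have hsub : {ω | max C 1 / ε < ‖X n α ω‖} ⊆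
      {ω | ENNReal.ofReal (max C 1 / ε) ≤ ENNReal.ofReal (X n α ω)} := by
    intro ω hω
    have hω' : max C 1 / ε < ‖X n α ω‖ := hω
    rw [Real.norm_of_nonneg (h0 ω)] at hω'
    exact ENNReal.ofReal_le_ofReal hω'.le
  calc _ ≤ _ := measure_mono hsub
    _ ≤ (∫⁻ ω, ENNReal.ofReal (X n α ω) ∂P) / ENNReal.ofReal (max C 1 / ε) :=
        meas_ge_le_lintegral_div hm.ennreal_ofReal (by simpa using hM) ENNReal.ofReal_ne_top
    _ ≤ ENNReal.ofReal (max C 1) / ENNReal.ofReal (max C 1 / ε) := by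
        gcongr
        exact hle.trans (ENNReal.ofReal_le_ofReal (le_max_left _ _))
    _ = ENNReal.ofReal ε := by
        rw [← ENNReal.ofReal_div_of_pos hM]
        congr 1
        have : 0 < max C 1 := by positivity
        field_simp

lemma IsOUP.of_tendsto_ae [IsFiniteMeasure P] {X : ℕ → Ω → ℝ} {c : ℝ}
    (hm : ∀ n, AEStronglyMeasurable (X n) P)
    (h : ∀ᵐ ω ∂P, Tendsto (fun n => X n ω) atTop (nhds c)) :
    IsOUP P A fun n _ ω => X n ω := by
  have h1 := tendstoInMeasure_of_tendsto_ae hm (g := fun _ => c) h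
  rw [tendstoInMeasure_iff_norm] at h1
  intro ε hε
  refine ⟨|c| + 1, ?_⟩
  have h2 := (h1 1 zero_lt_one).eventually_le_const (ENNReal.ofReal_pos.2 hε)
  filter_upwards [h2] with n hn α _
  refine (measure_mono fun ω hω => ?_).trans hn
  have hω' : |c| + 1 < |X n ω| := hω
  have := abs_sub_abs_le_abs_sub (X n ω) c
  change 1 ≤ |X n ω - c|
  linarith

end OUP

/-! ### Rates -/

/-- With `y = n ^ θ` the sequence is `y ^ (1 / θ) * exp (-k * y)`. The factor `n` is the number of
subjects in the union bound over ill-conditioned designs. -/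
lemma tendsto_mul_exp_neg_rpow {k θ : ℝ} (hk : 0 < k) (hθ : 0 < θ) :
    Tendsto (fun n : ℕ => (n : ℝ) * Real.exp (-(k * (n : ℝ) ^ θ))) atTop (nhds 0) := by
  have h1 := (tendsto_rpow_mul_exp_neg_mul_atTop_nhds_zero (1 / θ) k hk).comp
    ((tendsto_rpow_atTop hθ).comp tendsto_natCast_atTop_atTop)
  refine h1.congr fun n => ?_
  simp only [Function.comp]
  rw [← Real.rpow_mul (Nat.cast_nonneg n), mul_one_div_cancel hθ.ne', Real.rpow_one, neg_mul]


/-! ### Squared reconstruction error averaged over subjects -/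

section Model

variable {Ω Ω₀ : Type*} [MeasurableSpace Ω] [MeasurableSpace Ω₀]
  {P : Measure Ω} [IsProbabilityMeasure P] {P₀ : Measure Ω₀} [IsProbabilityMeasure P₀]
  {a b : ℝ} {U : Set ℝ} {q : ℕ} {x : ℕ → Ω → (Fin q → ℝ)} {β : ℝ → (Fin q → ℝ)}
  {v : ℕ → ℝ → Ω → ℝ} {T e : ℕ → ℕ → Ω → ℝ} {ε : ℝ → Ω₀ → ℝ} {γ : ℝ → ℝ → ℝ} {σsq dens : ℝ → ℝ}
  {p : ℕ} {K : ℝ → ℝ} {N : ℕ → ℕ → ℕ} {C δ : ℝ} {h : ℕ → ℝ}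

/-- The mean squared reconstruction error at time `t`. -/
noncomputable def meanSqErr (x : ℕ → Ω → (Fin q → ℝ)) (β : ℝ → (Fin q → ℝ)) (v : ℕ → ℝ → Ω → ℝ)
    (T e : ℕ → ℕ → Ω → ℝ) (p : ℕ) (K : ℝ → ℝ) (h : ℕ → ℝ) (N : ℕ → ℕ → ℕ) (n : ℕ) (t : ℝ)
    (ω : Ω) : ℝ :=
  (n : ℝ)⁻¹ * ∑ i, (fHatVec x β v T e p K h N n t ω i - fVec x β v n t ω i) ^ 2

lemma meanSqErr_nonneg (n : ℕ) (t : ℝ) (ω : Ω) :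
    0 ≤ meanSqErr x β v T e p K h N n t ω :=
  mul_nonneg (inv_nonneg.2 (Nat.cast_nonneg n)) (Finset.sum_nonneg fun _ _ => sq_nonneg _)

/-- An observation evaluates a random path at a random time. Almost surely it agrees with the
jointly measurable evaluation, because the path is continuous on `U` and the design lies in `U`. -/
lemma aemeasurable_obs (hU : U = Ioo a b ∨ U = Icc a b) (hne : U.Nonempty)
    (hmodel : IsModel P P₀ a b x v T e ε γ σsq)
    (hA : ConditionA P a b U x β v T γ σsq dens p K N C δ h) (i j : ℕ) :
    AEMeasurable (fun ω => obs x β v T e i j ω) P := by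
  classical
  have hUm := measurableSet_of_eq hU
  obtain ⟨F, hF, hFeq⟩ := exists_measurable_eval (subset_Icc_of_eq hU) hne
  have hTm := hmodel.T_measurable i j
  have hβm : ∀ r, Measurable (U.indicator fun s => β s r) := fun r => by
    rw [← piecewise_eq_indicator]
    exact ((continuous_apply r).comp_continuousOn
      hA.beta_smooth.continuousOn).measurable_piecewise continuousOn_const hUm
  have hxm : ∀ r, Measurable fun ω => x i ω r := fun r =>
    (measurable_pi_apply r).comp (hmodel.x_measurable i)
  have hpath : Measurable fun ω (s : Icc a b) => v i s ω :=
    measurable_pi_lambda _ fun s => (hmodel.v_sp i).measurable s s.2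
  have hmeas : Measurable fun ω => (∑ r, x i ω r * U.indicator (fun s => β s r) (T i j ω))
      + F (fun s : Icc a b => v i s ω, T i j ω) + e i j ω :=
    ((Finset.measurable_sum _ fun r _ => (hxm r).mul ((hβm r).comp hTm)).add
      (hF.comp (hpath.prodMk hTm))).add (hmodel.e_measurable i j)
  refine ⟨_, hmeas, ?_⟩
  filter_upwards [hA.ae_design_mem hU hmodel, hA.ae_continuousOn_effect i] with ω h1 h2
  rw [hFeq _ h2 _ (h1 i j)]
  simp [obs, indiv, dotProduct, indicator_of_mem (h1 i j)]

lemma aemeasurable_fHatVec (hU : U = Ioo a b ∨ U = Icc a b) (hne : U.Nonempty)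
    (hmodel : IsModel P P₀ a b x v T e ε γ σsq)
    (hA : ConditionA P a b U x β v T γ σsq dens p K N C δ h) (n : ℕ) (t : ℝ) (i : Fin n) :
    AEMeasurable (fun ω => fHatVec x β v T e p K h N n t ω i) P := by
  simp only [fHatVec, lpk_eq_sum]
  refine Finset.aemeasurable_fun_sum _ fun j _ => AEMeasurable.mul (Measurable.aemeasurable ?_)
    (aemeasurable_obs hU hne hmodel hA _ _)
  exact (measurable_lpkCoef p hA.K_measurable (h n) t j).comp
    (measurable_pi_lambda _ fun j => hmodel.T_measurable i j)

lemma measurable_fVec (hU : U ⊆ Icc a b) (hmodel : IsModel P P₀ a b x v T e ε γ σsq) (n : ℕ) {t : ℝ}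
    (ht : t ∈ U) (i : Fin n) : Measurable fun ω => fVec x β v n t ω i := by
  simp only [fVec, indiv, dotProduct]
  exact (Finset.measurable_sum _ fun r _ => ((measurable_pi_apply r).comp
    (hmodel.x_measurable i)).mul_const _).add ((hmodel.v_sp i).measurable t (hU ht))

set_option maxHeartbeats 1000000 in
/-- The mean squared reconstruction error is of order `n^(-2(p+1)δ/(2p+3))`. -/
lemma meanSqErr_oup (hab : a < b) (hU : U = Ioo a b ∨ U = Icc a b)
    (hmodel : IsModel P P₀ a b x v T e ε γ σsq)
    (hA : ConditionA P a b U x β v T γ σsq dens p K N C δ h) (hB : ConditionB P U x v)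
    (hh : h =Θ[atTop] (fun n : ℕ => (n : ℝ) ^ (-(δ / (2 * (p : ℝ) + 3)))))
    {S : Set ℝ} (hSU : S ⊆ U) (hS : IsCompact S) :
    IsOUP P (fun _ => S) fun (n : ℕ) (t : ℝ) (ω : Ω) =>
      ((n : ℝ) ^ (((p : ℝ) + 1) * δ / (2 * (p : ℝ) + 3))) ^ 2 *
        meanSqErr x β v T e p K h N n t ω := by
  obtain ⟨ρ, hρ, κ, hκ, D, hD, Herr⟩ := exists_error_bound hab hU hmodel hA hB hSU hS
  have hδ := hA.delta_pos
  have hC := hA.C_pos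
  obtain ⟨c₂, hc₂, hh₂⟩ := hh.1.exists_pos
  obtain ⟨c₁, hc₁, hh₁⟩ := hh.2.exists_pos
  have hp3 : (0 : ℝ) < 2 * p + 3 := by positivity
  set α : ℝ := δ / (2 * (p : ℝ) + 3) with hα
  set η : ℝ := ((p : ℝ) + 1) * δ / (2 * (p : ℝ) + 3) with hη
  -- The bandwidth is of order `n ^ (-α)`. These two identities are the bias–variance balance: `h ^
  -- (2 * (p + 1))` and `1 / (n ^ δ * h)` are both of order `n ^ (-2 * η)`.
  have hαη : 2 * ((p : ℝ) + 1) * α = 2 * η := by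
    rw [hα, hη]
    field_simp
  have hδα : δ = α + 2 * η := by
    rw [hα, hη]
    field_simp
    ring
  -- The Hoeffding exponent is at least of order `n ^ δ * h ^ 2`, that is `n ^ (δ - 2 * α)`; a
  -- positive power of `n` suffices to beat the union over subjects.
  have hθ : 0 < δ - 2 * α := by
    have : δ - 2 * α = δ * (2 * p + 1) / (2 * p + 3) := by
      rw [hα]
      field_simp
      ring
    rw [this]
    positivity
  have hrate : Tendsto (fun n : ℕ => D * ((n : ℝ) *
      Real.exp (-(κ * C * (c₁⁻¹) ^ 2 * (n : ℝ) ^ (δ - 2 * α))))) atTop (nhds 0) := by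
    have hk : 0 < κ * C * (c₁⁻¹) ^ 2 := by positivity
    have := (tendsto_mul_exp_neg_rpow hk hθ).const_mul D
    rwa [mul_zero] at this
  set D' : ℝ := D * (c₂ ^ (2 * (p + 1)) + c₁ / C) with hD'
  have hD'0 : 0 ≤ D' := by positivity
  -- bounds valid for large `n`
  have hlarge : ∀ᶠ n : ℕ in atTop, 0 < n ∧ h n ≤ ρ ∧ c₁⁻¹ * (n : ℝ) ^ (-α) ≤ h n ∧
      h n ≤ c₂ * (n : ℝ) ^ (-α) := by
    filter_upwards [eventually_gt_atTop 0, hA.h_zero.eventually_le_const hρ, hh₁.bound,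
      hh₂.bound] with n h1 h2 h3 h4
    have hn : (0 : ℝ) ≤ (n : ℝ) ^ (-α) := by positivity
    rw [Real.norm_of_nonneg hn, Real.norm_of_nonneg (hA.h_pos n).le] at h3 h4
    refine ⟨h1, h2, ?_, h4⟩
    rw [inv_mul_le_iff₀ hc₁]
    exact h3
  intro ε' hε'
  -- Half of the allowed probability pays for ill-conditioned designs, the other half for Markov's
  -- inequality on the truncated error.
  refine ⟨max D' 1 / (ε' / 2), ?_⟩
  filter_upwards [hlarge, hrate.eventually_le_const (half_pos hε')] with n ⟨hn, hnρ, hlo, hhi⟩ hexp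
  intro t ht
  have hn' : (0 : ℝ) < n := by exact_mod_cast hn
  have htU := hSU ht
  have hNpos : ∀ i : Fin n, 0 < N n i := fun i => by
    have h1 := hA.N_ge n i i.2
    have h2 : 0 < C * (n : ℝ) ^ δ := by positivity
    exact_mod_cast h2.trans_le h1
  choose G hG hGP hGE using fun i : Fin n => Herr t ht (h n) (hA.h_pos n) hnρ i (N n i) (hNpos i)
  set d : Fin n → Ω → ℝ := fun i ω =>
    fHatVec x β v T e p K h N n t ω i - fVec x β v n t ω i with hd
  set Eset : Fin n → Set Ω := fun i => {ω | (fun j : Fin (N n i) => T i j ω) ∈ G i} with hEset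
  have hEm : ∀ i, MeasurableSet (Eset i) := fun i => by
    have : Measurable fun ω (j : Fin (N n i)) => T i j ω :=
      measurable_pi_lambda _ fun j => hmodel.T_measurable i j
    exact this (hG i)
  have hdm : ∀ i, AEMeasurable (d i) P := fun i =>
    (aemeasurable_fHatVec hU ⟨t, htU⟩ hmodel hA n t i).sub
      (measurable_fVec (subset_Icc_of_eq hU) hmodel n htU i).aemeasurable
  have hm_h : ∀ i : Fin n, C * (n : ℝ) ^ δ * (c₁⁻¹ * (n : ℝ) ^ (-α)) ≤ N n i * h n := fun i =>
    mul_le_mul (hA.N_ge n i i.2) hlo (by positivity) (Nat.cast_nonneg _)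
  -- probability of an ill-conditioned design
  have hbad : P (⋃ i, (Eset i)ᶜ) ≤ ENNReal.ofReal (ε' / 2) := by
    have h1 : ∀ i, P ((Eset i)ᶜ) ≤
        ENNReal.ofReal (D * Real.exp (-(κ * C * (c₁⁻¹) ^ 2 * (n : ℝ) ^ (δ - 2 * α)))) := by
      intro i
      rw [← ofReal_measureReal]
      refine ENNReal.ofReal_le_ofReal ((hGP i).trans ?_)
      refine mul_le_mul_of_nonneg_left (Real.exp_le_exp.2 (neg_le_neg ?_)) hD
      have h2 : (n : ℝ) ^ (δ - 2 * α) = (n : ℝ) ^ δ * ((n : ℝ) ^ (-α)) ^ 2 := by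
        rw [← Real.rpow_natCast, ← Real.rpow_mul hn'.le, ← Real.rpow_add hn']
        congr 1
        push_cast
        ring
      calc κ * C * (c₁⁻¹) ^ 2 * (n : ℝ) ^ (δ - 2 * α)
          = κ * (C * (n : ℝ) ^ δ * (c₁⁻¹ * (n : ℝ) ^ (-α)) ^ 2) := by rw [h2]; ring
        _ ≤ κ * (N n i * h n ^ 2) := by
            have := hA.N_ge n i i.2
            gcongr
    calc P (⋃ i, (Eset i)ᶜ) ≤ ∑ i, P ((Eset i)ᶜ) := measure_iUnion_fintype_le _ _
      _ ≤ ∑ _i : Fin n,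
          ENNReal.ofReal (D * Real.exp (-(κ * C * (c₁⁻¹) ^ 2 * (n : ℝ) ^ (δ - 2 * α)))) :=
          Finset.sum_le_sum fun i _ => h1 i
      _ = ENNReal.ofReal (D * ((n : ℝ) *
          Real.exp (-(κ * C * (c₁⁻¹) ^ 2 * (n : ℝ) ^ (δ - 2 * α))))) := by
          rw [Finset.sum_const, Finset.card_univ, Fintype.card_fin, nsmul_eq_mul,
            ← ENNReal.ofReal_natCast, ← ENNReal.ofReal_mul hn'.le]
          congr 1
          ring
      _ ≤ _ := ENNReal.ofReal_le_ofReal hexp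
  -- truncated mean squared error
  set Y : Ω → ℝ≥0∞ := fun ω => ENNReal.ofReal (((n : ℝ) ^ η) ^ 2 * (n : ℝ)⁻¹) *
    ∑ i, (Eset i).indicator (fun ω => ENNReal.ofReal (d i ω ^ 2)) ω with hY
  have hYm : AEMeasurable Y P := by
    refine AEMeasurable.const_mul (Finset.aemeasurable_fun_sum _ fun i _ => ?_) _
    exact ((hdm i).pow_const 2).ennreal_ofReal.indicator (hEm i)
  have hpow : ∀ i : Fin n, D * (h n ^ (2 * (p + 1)) + 1 / (N n i * h n))
      ≤ D' * ((n : ℝ) ^ (-η)) ^ 2 := by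
    intro i
    have e1 : ((n : ℝ) ^ (-η)) ^ 2 = (n : ℝ) ^ (-(2 * η)) := by
      rw [← Real.rpow_natCast, ← Real.rpow_mul hn'.le]
      congr 1
      push_cast
      ring
    have h1 : h n ^ (2 * (p + 1)) ≤ c₂ ^ (2 * (p + 1)) * ((n : ℝ) ^ (-η)) ^ 2 := by
      calc h n ^ (2 * (p + 1)) ≤ (c₂ * (n : ℝ) ^ (-α)) ^ (2 * (p + 1)) :=
            pow_le_pow_left₀ (hA.h_pos n).le hhi _
        _ = c₂ ^ (2 * (p + 1)) * ((n : ℝ) ^ (-η)) ^ 2 := by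
            rw [mul_pow, e1]
            congr 1
            rw [← Real.rpow_natCast, ← Real.rpow_mul hn'.le]
            congr 1
            push_cast
            linarith
    have h2 : 1 / (N n i * h n) ≤ c₁ / C * ((n : ℝ) ^ (-η)) ^ 2 := by
      have h3 : C * (n : ℝ) ^ δ * (c₁⁻¹ * (n : ℝ) ^ (-α)) = (c₁ / C * ((n : ℝ) ^ (-η)) ^ 2)⁻¹ := by
        rw [e1, Real.rpow_neg hn'.le (2 * η)]
        have : (n : ℝ) ^ δ * (n : ℝ) ^ (-α) = (n : ℝ) ^ (2 * η) := by
          rw [← Real.rpow_add hn']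
          congr 1
          linarith
        rw [← this]
        field_simp
      rw [one_div]
      refine inv_le_of_inv_le₀ (by positivity) ?_
      rw [← h3]
      exact hm_h i
    calc _ ≤ D * (c₂ ^ (2 * (p + 1)) * ((n : ℝ) ^ (-η)) ^ 2
          + c₁ / C * ((n : ℝ) ^ (-η)) ^ 2) := by gcongr
      _ = _ := by rw [hD']; ring
  have hYint : ∫⁻ ω, Y ω ∂P ≤ ENNReal.ofReal D' := by
    rw [hY, lintegral_const_mul' _ _ ENNReal.ofReal_ne_top, lintegral_finsetSum' _ fun i _ =>
      ((hdm i).pow_const 2).ennreal_ofReal.indicator (hEm i)]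
    have h1 : ∀ i, ∫⁻ ω, (Eset i).indicator (fun ω => ENNReal.ofReal (d i ω ^ 2)) ω ∂P
        ≤ ENNReal.ofReal (D' * ((n : ℝ) ^ (-η)) ^ 2) := by
      intro i
      rw [lintegral_indicator (hEm i)]
      exact (hGE i).trans (ENNReal.ofReal_le_ofReal (hpow i))
    calc _ ≤ ENNReal.ofReal (((n : ℝ) ^ η) ^ 2 * (n : ℝ)⁻¹) *
          ∑ _i : Fin n, ENNReal.ofReal (D' * ((n : ℝ) ^ (-η)) ^ 2) := by
          gcongr with i _
          exact h1 i
      _ = ENNReal.ofReal D' := by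
          rw [Finset.sum_const, Finset.card_univ, Fintype.card_fin, nsmul_eq_mul,
            ← ENNReal.ofReal_natCast, ← ENNReal.ofReal_mul hn'.le,
            ← ENNReal.ofReal_mul (by positivity)]
          congr 1
          rw [Real.rpow_neg hn'.le]
          have : (0 : ℝ) < (n : ℝ) ^ η := by positivity
          field_simp
  have hM : 0 < max D' 1 / (ε' / 2) := by positivity
  have hsub : {ω | max D' 1 / (ε' / 2) < ‖((n : ℝ) ^ η) ^ 2 * meanSqErr x β v T e p K h N n t ω‖} ⊆
      (⋃ i, (Eset i)ᶜ) ∪ {ω | ENNReal.ofReal (max D' 1 / (ε' / 2)) ≤ Y ω} := by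
    intro ω hω
    by_cases hgood : ω ∈ ⋃ i, (Eset i)ᶜ
    · exact Or.inl hgood
    right
    have hgood' : ∀ i, ω ∈ Eset i := by simpa using hgood
    have hω' : max D' 1 / (ε' / 2) < ‖((n : ℝ) ^ η) ^ 2 * meanSqErr x β v T e p K h N n t ω‖ := hω
    rw [Real.norm_of_nonneg (mul_nonneg (sq_nonneg _) (meanSqErr_nonneg n t ω))] at hω'
    refine (ENNReal.ofReal_le_ofReal hω'.le).trans (le_of_eq ?_)
    simp only [hY, indicator_of_mem (hgood' _)]
    rw [← ENNReal.ofReal_sum_of_nonneg fun i _ => sq_nonneg _, ← ENNReal.ofReal_mul (by positivity),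
      meanSqErr, mul_assoc]
  calc _ ≤ _ := measure_mono hsub
    _ ≤ _ := measure_union_le _ _
    _ ≤ ENNReal.ofReal (ε' / 2) + ENNReal.ofReal (ε' / 2) := by
        refine add_le_add hbad ?_
        calc _ ≤ (∫⁻ ω, Y ω ∂P) / ENNReal.ofReal (max D' 1 / (ε' / 2)) :=
              meas_ge_le_lintegral_div hYm (by simpa using hM) ENNReal.ofReal_ne_top
          _ ≤ ENNReal.ofReal (max D' 1) / ENNReal.ofReal (max D' 1 / (ε' / 2)) := by
              gcongr
              exact hYint.trans (ENNReal.ofReal_le_ofReal (le_max_left _ _))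
          _ = ENNReal.ofReal (ε' / 2) := by
              rw [← ENNReal.ofReal_div_of_pos hM]
              congr 1
              have : 0 < max D' 1 := by positivity
              field_simp
    _ = ENNReal.ofReal ε' := by
        rw [← ENNReal.ofReal_add (half_pos hε').le (half_pos hε').le, add_halves]

end Model

/-! ### Least squares -/

section LeastSquares

variable {n q : ℕ} (X : Matrix (Fin n) (Fin q) ℝ)

lemma lsCoef_sub (f g : Fin n → ℝ) : lsCoef X (f - g) = lsCoef X f - lsCoef X g := by
  simp [lsCoef, Matrix.mulVec_sub]

lemma lsCoef_add (f g : Fin n → ℝ) : lsCoef X (f + g) = lsCoef X f + lsCoef X g := by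
  simp [lsCoef, Matrix.mulVec_add]

lemma lsResid_sub (f g : Fin n → ℝ) : lsResid X (f - g) = lsResid X f - lsResid X g := by
  simp only [lsResid, lsCoef_sub, Matrix.mulVec_sub]
  abel

lemma abs_dotProduct_le (f g : Fin n → ℝ) : |f ⬝ᵥ g| ≤ √(f ⬝ᵥ f) * √(g ⬝ᵥ g) := by
  have hf : 0 ≤ f ⬝ᵥ f := Finset.sum_nonneg fun i _ => mul_self_nonneg _
  rw [← Real.sqrt_mul hf, ← Real.sqrt_sq_eq_abs]
  refine Real.sqrt_le_sqrt ?_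
  have := Finset.sum_mul_sq_le_sq_mul_sq Finset.univ f g
  simpa [dotProduct, pow_two] using this

/-- Least squares residuals are at most as long as the data. -/
lemma lsResid_dotProduct_self_le (f : Fin n → ℝ) : lsResid X f ⬝ᵥ lsResid X f ≤ f ⬝ᵥ f := by
  by_cases hdet : IsUnit (Xᵀ * X).det
  · have h0 : Xᵀ *ᵥ lsResid X f = 0 := by
      rw [lsResid, Matrix.mulVec_sub, Matrix.mulVec_mulVec, lsCoef, Matrix.mulVec_mulVec,
        Matrix.mul_nonsing_inv _ hdet, Matrix.one_mulVec, sub_self]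
    have h1 : lsResid X f ⬝ᵥ (X *ᵥ lsCoef X f) = 0 := by
      rw [Matrix.dotProduct_mulVec, ← Matrix.mulVec_transpose, h0, zero_dotProduct]
    have h2 : f = lsResid X f + X *ᵥ lsCoef X f := by
      rw [lsResid, sub_add_cancel]
    have h3 : 0 ≤ (X *ᵥ lsCoef X f) ⬝ᵥ (X *ᵥ lsCoef X f) :=
      Finset.sum_nonneg fun i _ => mul_self_nonneg _
    have h4 : f ⬝ᵥ f = lsResid X f ⬝ᵥ lsResid X f
        + (X *ᵥ lsCoef X f) ⬝ᵥ (X *ᵥ lsCoef X f) := by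
      conv_lhs => rw [h2]
      rw [add_dotProduct, dotProduct_add, dotProduct_add, h1,
        dotProduct_comm (X *ᵥ lsCoef X f) (lsResid X f), h1]
      ring
    linarith
  -- For a singular Gram matrix the inverse is zero by convention and the residual is the data
  -- itself.
  · have : lsCoef X f = 0 := by
      rw [lsCoef, Matrix.nonsing_inv_apply_not_isUnit _ hdet, Matrix.zero_mulVec]
    simp [lsResid, this]

/-- The covariance is bilinear in the residuals, so the difference expands into three products, each
with at least one error factor. Cauchy–Schwarz and the contraction property bound each product by
lengths of the unprojected vectors. -/
lemma abs_residCov_sub_le (f f' g g' : Fin n → ℝ) :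
    |residCov X f' g' - residCov X f g| ≤ |((n : ℝ) - q)⁻¹| *
      (√((f' - f) ⬝ᵥ (f' - f)) * √((g' - g) ⬝ᵥ (g' - g)) + √((f' - f) ⬝ᵥ (f' - f)) * √(g ⬝ᵥ g)
        + √(f ⬝ᵥ f) * √((g' - g) ⬝ᵥ (g' - g))) := by
  have hb : ∀ y z : Fin n → ℝ, |lsResid X y ⬝ᵥ lsResid X z| ≤ √(y ⬝ᵥ y) * √(z ⬝ᵥ z) := fun y z =>
    (abs_dotProduct_le _ _).trans (mul_le_mul
      (Real.sqrt_le_sqrt (lsResid_dotProduct_self_le X y))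
      (Real.sqrt_le_sqrt (lsResid_dotProduct_self_le X z)) (Real.sqrt_nonneg _)
      (Real.sqrt_nonneg _))
  have h1 : residCov X f' g' - residCov X f g = ((n : ℝ) - q)⁻¹ *
      (lsResid X (f' - f) ⬝ᵥ lsResid X (g' - g) + lsResid X (f' - f) ⬝ᵥ lsResid X g
        + lsResid X f ⬝ᵥ lsResid X (g' - g)) := by
    simp only [residCov, lsResid_sub, sub_dotProduct, dotProduct_sub]
    ring
  rw [h1, abs_mul]
  refine mul_le_mul_of_nonneg_left ?_ (abs_nonneg _)
  exact (abs_add_three _ _ _).trans (add_le_add (add_le_add (hb _ _) (hb _ _)) (hb _ _))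

/-- The coefficient is split into `n` times the inverse Gram matrix, which stabilises, and the
average of covariate times data, to which Cauchy–Schwarz over subjects applies. This avoids any
uniform bound over subjects on the individual errors. -/
lemma norm_lsCoef_le (hn : 0 < n) (d : Fin n → ℝ) :
    ‖lsCoef X d‖ ≤ (∑ r, ∑ s, |(n : ℝ) * (Xᵀ * X)⁻¹ r s|) *
      (√((n : ℝ)⁻¹ * ∑ i, ∑ s, X i s ^ 2) * √((n : ℝ)⁻¹ * ∑ i, d i ^ 2)) := by
  have hn' : (0 : ℝ) < n := by exact_mod_cast hn
  set Q := √((n : ℝ)⁻¹ * ∑ i, ∑ s, X i s ^ 2) * √((n : ℝ)⁻¹ * ∑ i, d i ^ 2) with hQ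
  have hQ0 : 0 ≤ Q := by positivity
  have h1 : ∀ s, |(n : ℝ)⁻¹ * ∑ i, X i s * d i| ≤ Q := by
    intro s
    have h2 : |∑ i, X i s * d i| ≤ √(∑ i, X i s ^ 2) * √(∑ i, d i ^ 2) := by
      rw [← Real.sqrt_mul (Finset.sum_nonneg fun i _ => sq_nonneg _), ← Real.sqrt_sq_eq_abs]
      exact Real.sqrt_le_sqrt (Finset.sum_mul_sq_le_sq_mul_sq _ _ _)
    have h3 : ∑ i, X i s ^ 2 ≤ ∑ i, ∑ s, X i s ^ 2 := Finset.sum_le_sum fun i _ =>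
      Finset.single_le_sum (f := fun s => X i s ^ 2) (fun s _ => sq_nonneg _) (Finset.mem_univ s)
    rw [abs_mul, abs_of_pos (inv_pos.2 hn'), hQ, Real.sqrt_mul (inv_nonneg.2 hn'.le),
      Real.sqrt_mul (inv_nonneg.2 hn'.le)]
    calc (n : ℝ)⁻¹ * |∑ i, X i s * d i|
        ≤ (n : ℝ)⁻¹ * (√(∑ i, ∑ s, X i s ^ 2) * √(∑ i, d i ^ 2)) := by
          refine mul_le_mul_of_nonneg_left (h2.trans ?_) (inv_nonneg.2 hn'.le)
          gcongr
      _ = √((n : ℝ)⁻¹) * √((n : ℝ)⁻¹) * (√(∑ i, ∑ s, X i s ^ 2) * √(∑ i, d i ^ 2)) := by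
          rw [Real.mul_self_sqrt (inv_nonneg.2 hn'.le)]
      _ = _ := by ring
  rw [pi_norm_le_iff_of_nonneg (mul_nonneg (Finset.sum_nonneg fun r _ =>
    Finset.sum_nonneg fun s _ => abs_nonneg _) hQ0)]
  intro r
  have h4 : lsCoef X d r = ∑ s, ((n : ℝ) * (Xᵀ * X)⁻¹ r s) * ((n : ℝ)⁻¹ * ∑ i, X i s * d i) := by
    simp only [lsCoef, Matrix.mulVec, dotProduct, Matrix.transpose_apply]
    refine Finset.sum_congr rfl fun s _ => ?_
    field_simp
  rw [h4, Real.norm_eq_abs]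
  calc |∑ s, ((n : ℝ) * (Xᵀ * X)⁻¹ r s) * ((n : ℝ)⁻¹ * ∑ i, X i s * d i)|
      ≤ ∑ s, |(n : ℝ) * (Xᵀ * X)⁻¹ r s| * Q := by
        refine (Finset.abs_sum_le_sum_abs _ _).trans (Finset.sum_le_sum fun s _ => ?_)
        rw [abs_mul]
        exact mul_le_mul_of_nonneg_left (h1 s) (abs_nonneg _)
    _ = (∑ s, |(n : ℝ) * (Xᵀ * X)⁻¹ r s|) * Q := by rw [Finset.sum_mul]
    _ ≤ _ := by
        refine mul_le_mul_of_nonneg_right ?_ hQ0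
        exact Finset.single_le_sum (f := fun r => ∑ s, |(n : ℝ) * (Xᵀ * X)⁻¹ r s|)
          (fun r _ => Finset.sum_nonneg fun s _ => abs_nonneg _) (Finset.mem_univ r)

end LeastSquares

lemma tendsto_inv_apply {α n : Type*} [Fintype n] [DecidableEq n] {l : Filter α}
    {A : α → Matrix n n ℝ} {B : Matrix n n ℝ}
    (hA : ∀ r s, Tendsto (fun y => A y r s) l (nhds (B r s))) (hB : IsUnit B) (r s : n) :
    Tendsto (fun y => (A y)⁻¹ r s) l (nhds (B⁻¹ r s)) := by
  have hA' : Tendsto A l (nhds B) := tendsto_pi_nhds.2 fun r => tendsto_pi_nhds.2 fun s => hA r s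
  have hdet : Tendsto (fun y => (A y).det) l (nhds B.det) :=
    ((Continuous.matrix_det continuous_id).tendsto B).comp hA'
  have hadj : Tendsto (fun y => (A y).adjugate r s) l (nhds (B.adjugate r s)) :=
    ((Continuous.matrix_elem (Continuous.matrix_adjugate continuous_id) r s).tendsto B).comp hA'
  have hB0 : B.det ≠ 0 := ((Matrix.isUnit_iff_isUnit_det B).1 hB).ne_zero
  simp only [Matrix.inv_def, Ring.inverse_eq_inv', Matrix.smul_apply, smul_eq_mul]
  exact (hdet.inv₀ hB0).mul hadj

/-- The singular case is included, both sides being zero there: the sample Gram matrix may be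
singular for any finite `n`. -/
lemma inv_smul_apply {n : Type*} [Fintype n] [DecidableEq n] (A : Matrix n n ℝ) {c : ℝ}
    (hc : c ≠ 0) (r s : n) : (c • A)⁻¹ r s = c⁻¹ * A⁻¹ r s := by
  by_cases hdet : IsUnit A.det
  · have := invertibleOfNonzero hc
    have e := Matrix.inv_smul A c hdet
    rw [e, invOf_eq_inv]
    rfl
  · have h2 : ¬ IsUnit (c • A).det := by
      rw [isUnit_iff_ne_zero, not_not] at hdet ⊢
      rw [Matrix.det_smul, hdet, mul_zero]
    rw [Matrix.nonsing_inv_apply_not_isUnit _ hdet, Matrix.nonsing_inv_apply_not_isUnit _ h2]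
    simp


/-! ### Limits of the Gram matrix and comparison with the ideal estimators -/

section Model

variable {Ω Ω₀ : Type*} [MeasurableSpace Ω] [MeasurableSpace Ω₀]
  {P : Measure Ω} [IsProbabilityMeasure P] {P₀ : Measure Ω₀} [IsProbabilityMeasure P₀]
  {a b : ℝ} {U : Set ℝ} {q : ℕ} {x : ℕ → Ω → (Fin q → ℝ)} {β : ℝ → (Fin q → ℝ)}
  {v : ℕ → ℝ → Ω → ℝ} {T e : ℕ → ℕ → Ω → ℝ} {ε : ℝ → Ω₀ → ℝ} {γ : ℝ → ℝ → ℝ} {σsq dens : ℝ → ℝ}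
  {p : ℕ} {K : ℝ → ℝ} {N : ℕ → ℕ → ℕ} {C δ : ℝ} {h : ℕ → ℝ}

lemma covGram_apply (x : ℕ → Ω → (Fin q → ℝ)) (n : ℕ) (ω : Ω) (r s : Fin q) :
    ((covMat x n ω)ᵀ * covMat x n ω) r s = ∑ i ∈ Finset.range n, x i ω r * x i ω s := by
  rw [Matrix.mul_apply, Finset.sum_range]
  rfl

/-- The strong law of large numbers, entry by entry. -/
lemma ConditionB.ae_tendsto_gram (hB : ConditionB P U x v) :
    ∀ᵐ ω ∂P, ∀ r s, Tendsto
      (fun n : ℕ => (((n : ℝ)⁻¹ • ((covMat x n ω)ᵀ * covMat x n ω)) r s)) atTop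
      (nhds (secondMoment P x r s)) := by
  rw [ae_all_iff]
  intro r
  rw [ae_all_iff]
  intro s
  have hφ : Measurable fun y : Fin q → ℝ => y r * y s := by fun_prop
  have := strong_law_ae_real (μ := P) (fun i ω => x i ω r * x i ω s)
    ((hB.memLp_apply 0 r).integrable_mul (hB.memLp_apply 0 s))
    (fun i j hij => (hB.x_indep.indepFun hij).comp hφ hφ)
    (fun i => (hB.x_ident i).comp hφ)
  filter_upwards [this] with ω hω
  refine hω.congr fun n => ?_
  rw [Matrix.smul_apply, covGram_apply, smul_eq_mul, div_eq_inv_mul]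

lemma ConditionB.ae_tendsto_inv_gram (hB : ConditionB P U x v) :
    ∀ᵐ ω ∂P, ∀ r s, Tendsto
      (fun n : ℕ => (n : ℝ) * ((covMat x n ω)ᵀ * covMat x n ω)⁻¹ r s) atTop
      (nhds ((secondMoment P x)⁻¹ r s)) := by
  filter_upwards [hB.ae_tendsto_gram] with ω hω r s
  refine (tendsto_inv_apply hω hB.x_inv r s).congr' ?_
  filter_upwards [eventually_gt_atTop 0] with n hn
  have hn' : (n : ℝ) ≠ 0 := by positivity
  rw [inv_smul_apply _ (inv_ne_zero hn'), inv_inv]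

lemma measurable_inv_gram (hx : ∀ i, Measurable (x i)) (n : ℕ) (r s : Fin q) :
    Measurable fun ω => ((covMat x n ω)ᵀ * covMat x n ω)⁻¹ r s := by
  refine measurable_inv_apply (fun r s => ?_) r s
  simp only [covGram_apply]
  exact Finset.measurable_sum _ fun i _ => ((measurable_pi_apply r).comp (hx i)).mul
    ((measurable_pi_apply s).comp (hx i))

lemma inv_gram_oup (hx : ∀ i, Measurable (x i)) (hB : ConditionB P U x v) {ι : Type*}
    {A : ℕ → Set ι} :
    IsOUP P A fun (n : ℕ) (_ : ι) (ω : Ω) =>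
      ∑ r, ∑ s, |(n : ℝ) * ((covMat x n ω)ᵀ * covMat x n ω)⁻¹ r s| := by
  refine IsOUP.of_tendsto_ae (c := ∑ r, ∑ s, |(secondMoment P x)⁻¹ r s|) (fun n => ?_) ?_
  · refine Measurable.aestronglyMeasurable ?_
    exact Finset.measurable_sum _ fun r _ => Finset.measurable_sum _ fun s _ =>
      ((measurable_inv_gram hx n r s).const_mul _).norm
  · filter_upwards [hB.ae_tendsto_inv_gram] with ω hω
    exact tendsto_finsetSum _ fun r _ => tendsto_finsetSum _ fun s _ => (hω r s).abs

/-- Averages over subjects of squares with uniformly bounded expectations. -/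
lemma mean_sq_oup {ι κ : Type*} [Fintype κ] {A : Set ι} {Y : ℕ → ι → κ → Ω → ℝ}
    (hY : ∀ i, ∀ α ∈ A, ∀ k, MemLp (Y i α k) 2 P) {M : ℝ}
    (hM : ∀ i, ∀ α ∈ A, ∀ k, ∫ ω, Y i α k ω ^ 2 ∂P ≤ M) :
    IsOUP P (fun _ => A) fun (n : ℕ) (α : ι) (ω : Ω) =>
      (n : ℝ)⁻¹ * ∑ i : Fin n, ∑ k, Y i α k ω ^ 2 := by
  refine IsOUP.of_lintegral_le (C := Fintype.card κ * M) ?_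
  filter_upwards [eventually_gt_atTop 0] with n hn α hα
  have hn' : (0 : ℝ) < n := by exact_mod_cast hn
  have hint : ∀ (i : ℕ) k, Integrable (fun ω => Y i α k ω ^ 2) P := fun i k =>
    (hY i α hα k).integrable_sq
  have h0 : ∀ ω, 0 ≤ (n : ℝ)⁻¹ * ∑ i : Fin n, ∑ k, Y i α k ω ^ 2 := fun ω => by positivity
  have hI : Integrable (fun ω => (n : ℝ)⁻¹ * ∑ i : Fin n, ∑ k, Y i α k ω ^ 2) P :=
    (integrable_finsetSum _ fun (i : Fin n) _ =>
      integrable_finsetSum _ fun k _ => hint i k).const_mul _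
  refine ⟨hI.aemeasurable, h0, ?_⟩
  rw [← ofReal_integral_eq_lintegral_ofReal hI (ae_of_all _ h0)]
  apply ENNReal.ofReal_le_ofReal
  rw [integral_const_mul, integral_finsetSum _ fun (i : Fin n) _ =>
      integrable_finsetSum _ fun k _ => hint i k,
    inv_mul_le_iff₀ hn']
  calc ∑ i : Fin n, ∫ ω, ∑ k, Y i α k ω ^ 2 ∂P ≤ ∑ _i : Fin n, Fintype.card κ * M := by
        refine Finset.sum_le_sum fun i _ => ?_
        rw [integral_finsetSum _ fun k _ => hint i k]
        calc ∑ k, ∫ ω, Y i α k ω ^ 2 ∂P ≤ ∑ _k : κ, M :=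
              Finset.sum_le_sum fun k _ => hM i α hα k
          _ = _ := by simp
    _ = _ := by simp

lemma covariate_oup (hB : ConditionB P U x v) {ι : Type*} {A : Set ι} :
    IsOUP P (fun _ => A) fun (n : ℕ) (_ : ι) (ω : Ω) =>
      (n : ℝ)⁻¹ * ∑ i, ∑ s, covMat x n ω i s ^ 2 := by
  refine mean_sq_oup (Y := fun i _ s ω => x i ω s) (fun i _ _ s => hB.memLp_apply i s)
    (M := ∑ s, ∫ ω, x 0 ω s ^ 2 ∂P) fun i _ _ s => ?_
  have h1 : ∫ ω, x i ω s ^ 2 ∂P = ∫ ω, x 0 ω s ^ 2 ∂P :=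
    ((hB.x_ident i).comp (u := fun y : Fin q → ℝ => y s ^ 2) (by fun_prop)).integral_eq
  rw [h1]
  exact Finset.single_le_sum (f := fun s => ∫ ω, x 0 ω s ^ 2 ∂P)
    (fun s _ => integral_nonneg fun ω => sq_nonneg _) (Finset.mem_univ s)

/-- The second moment of an individual function is at most twice that of its regression part plus
twice `γ t t`; both are bounded for `t` in the compact set. -/
lemma fVec_oup (hUI : U ⊆ Icc a b) (hmodel : IsModel P P₀ a b x v T e ε γ σsq)
    (hA : ConditionA P a b U x β v T γ σsq dens p K N C δ h) (hB : ConditionB P U x v)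
    {S : Set ℝ} (hSU : S ⊆ U) (hS : IsCompact S) :
    IsOUP P (fun _ => S) fun (n : ℕ) (t : ℝ) (ω : Ω) => (n : ℝ)⁻¹ * ∑ i, fVec x β v n t ω i ^ 2 := by
  obtain ⟨g, hg0, hgc, -, -⟩ := hA.cov_smooth
  obtain ⟨Mγ, hMγ0, hMγ⟩ := exists_abs_bound_of_continuousOn (hS.prod hS)
    ((hgc 0 (Nat.zero_le _) 0 (Nat.zero_le _)).mono (prod_mono hSU hSU))
  have hβb : ∀ r, ∃ M : ℝ, 0 ≤ M ∧ ∀ s ∈ S, |β s r| ≤ M := fun r =>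
    exists_abs_bound_of_continuousOn hS (((continuous_apply r).comp_continuousOn
      hA.beta_smooth.continuousOn).mono hSU)
  choose Mβ hMβ0 hMβ using hβb
  have hmem : ∀ i : ℕ, ∀ t ∈ S, MemLp (fun ω => indiv x β v i t ω) 2 P := by
    intro i t ht
    simp only [indiv, dotProduct]
    exact (memLp_finsetSum _ fun r _ => (hB.memLp_apply i r).mul_const _).add
      ((hmodel.v_sp i).memLp t (hUI (hSU ht)))
  have h1 := mean_sq_oup (P := P) (κ := Unit) (A := S) (Y := fun i t _ ω => indiv x β v i t ω)
    (fun i t ht _ => hmem i t ht)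
    (M := 2 * (q * (∑ r, Mβ r) ^ 2 * ∫ ω, ∑ r, x 0 ω r ^ 2 ∂P) + 2 * Mγ) (by
      intro i t ht _
      have htI := hUI (hSU ht)
      have hx : Integrable (fun ω => ∑ r, x i ω r ^ 2) P :=
        integrable_finsetSum _ fun r _ => (hB.memLp_apply i r).integrable_sq
      have hv : Integrable (fun ω => v i t ω ^ 2) P := ((hmodel.v_sp i).memLp t htI).integrable_sq
      have hX : ∫ ω, ∑ r, x i ω r ^ 2 ∂P = ∫ ω, ∑ r, x 0 ω r ^ 2 ∂P :=
        ((hB.x_ident i).comp (u := fun y : Fin q → ℝ => ∑ r, y r ^ 2) (by fun_prop)).integral_eq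
      have hV : ∫ ω, v i t ω ^ 2 ∂P ≤ Mγ := by
        simp_rw [pow_two]
        rw [(hmodel.v_sp i).integral_mul htI htI, ← hg0 t (hSU ht) t (hSU ht)]
        exact (le_abs_self _).trans (hMγ (t, t) ⟨ht, ht⟩)
      calc ∫ ω, indiv x β v i t ω ^ 2 ∂P
          ≤ ∫ ω, (2 * (q * (∑ r, Mβ r) ^ 2 * ∑ r, x i ω r ^ 2) + 2 * v i t ω ^ 2) ∂P := by
            refine integral_mono (hmem i t ht).integrable_sq
              (((hx.const_mul _).const_mul _).add (hv.const_mul _)) fun ω => ?_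
            have h2 := sq_dotProduct_le (x' := x i ω) (b' := β t) (A := ∑ r, Mβ r) fun r =>
              (hMβ r t ht).trans (Finset.single_le_sum (fun r _ => hMβ0 r) (Finset.mem_univ r))
            have h3 : indiv x β v i t ω ^ 2
                ≤ 2 * (∑ r, x i ω r * β t r) ^ 2 + 2 * v i t ω ^ 2 := by
              rw [indiv, dotProduct]
              nlinarith [sq_nonneg ((∑ r, x i ω r * β t r) - v i t ω)]
            simp only
            linarith
        _ = 2 * (q * (∑ r, Mβ r) ^ 2 * ∫ ω, ∑ r, x i ω r ^ 2 ∂P) + 2 * ∫ ω, v i t ω ^ 2 ∂P := by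
            rw [integral_add ((hx.const_mul _).const_mul _) (hv.const_mul _)]
            simp_rw [integral_const_mul]
        _ ≤ _ := by
            rw [hX]
            linarith)
  refine h1.mono (Eventually.of_forall fun n t _ => ae_of_all _ fun ω => le_of_eq ?_)
  simp [fVec]

/-- The estimated coefficient functions are close to the ideal least-squares estimators. -/
lemma lsCoef_fHat_oup (hab : a < b) (hU : U = Ioo a b ∨ U = Icc a b)
    (hmodel : IsModel P P₀ a b x v T e ε γ σsq)
    (hA : ConditionA P a b U x β v T γ σsq dens p K N C δ h) (hB : ConditionB P U x v)
    (hh : h =Θ[atTop] (fun n : ℕ => (n : ℝ) ^ (-(δ / (2 * (p : ℝ) + 3)))))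
    {S : Set ℝ} (hSU : S ⊆ U) (hS : IsCompact S) :
    IsOUP P (fun _ => S) (fun (n : ℕ) (t : ℝ) (ω : Ω) =>
      (n : ℝ) ^ (((p : ℝ) + 1) * δ / (2 * (p : ℝ) + 3)) •
        (lsCoef (covMat x n ω) (fHatVec x β v T e p K h N n t ω)
          - lsCoef (covMat x n ω) (fVec x β v n t ω))) := by
  have h1 := ((inv_gram_oup (A := fun _ => S) hmodel.x_measurable hB).mul
    ((covariate_oup hB (A := S)).sqrt.mul (meanSqErr_oup hab hU hmodel hA hB hh hSU hS).sqrt))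
  refine h1.mono ?_
  filter_upwards [eventually_gt_atTop 0] with n hn t _
  refine ae_of_all _ fun ω => ?_
  have hr : 0 ≤ (n : ℝ) ^ (((p : ℝ) + 1) * δ / (2 * (p : ℝ) + 3)) := by positivity
  refine le_trans ?_ (le_abs_self _)
  rw [norm_smul, Real.norm_of_nonneg hr, ← lsCoef_sub, Real.sqrt_mul (sq_nonneg _),
    Real.sqrt_sq hr]
  refine (mul_le_mul_of_nonneg_left (norm_lsCoef_le _ hn _) hr).trans (le_of_eq ?_)
  simp only [meanSqErr, Pi.sub_apply]
  ring

/-- The estimated covariance function is close to the ideal residual covariance. -/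
lemma residCov_fHat_oup (hab : a < b) (hU : U = Ioo a b ∨ U = Icc a b)
    (hmodel : IsModel P P₀ a b x v T e ε γ σsq)
    (hA : ConditionA P a b U x β v T γ σsq dens p K N C δ h) (hB : ConditionB P U x v)
    (hh : h =Θ[atTop] (fun n : ℕ => (n : ℝ) ^ (-(δ / (2 * (p : ℝ) + 3)))))
    {S : Set ℝ} (hSU : S ⊆ U) (hS : IsCompact S) :
    IsOUP P (fun _ => S ×ˢ S) (fun (n : ℕ) (st : ℝ × ℝ) (ω : Ω) =>
      (n : ℝ) ^ (((p : ℝ) + 1) * δ / (2 * (p : ℝ) + 3)) *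
        (residCov (covMat x n ω) (fHatVec x β v T e p K h N n st.1 ω)
            (fHatVec x β v T e p K h N n st.2 ω)
          - residCov (covMat x n ω) (fVec x β v n st.1 ω) (fVec x β v n st.2 ω))) := by
  have hm := (meanSqErr_oup hab hU hmodel hA hB hh hSU hS).sqrt
  have hf := (fVec_oup (subset_Icc_of_eq hU) hmodel hA hB hSU hS).sqrt
  have m1 := hm.comp (B := fun _ => S ×ˢ S) Prod.fst fun _ z hz => hz.1
  have m2 := hm.comp (B := fun _ => S ×ˢ S) Prod.snd fun _ z hz => hz.2
  have f1 := hf.comp (B := fun _ => S ×ˢ S) Prod.fst fun _ z hz => hz.1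
  have f2 := hf.comp (B := fun _ => S ×ˢ S) Prod.snd fun _ z hz => hz.2
  have htot := ((m1.mul m2).add (m1.mul f2)).add (f1.mul m2)
  -- The doubling provides the factor two that bounds `n / (n - q)` once `n` exceeds `2 * q`.
  have htot2 := htot.add htot
  refine htot2.mono ?_
  filter_upwards [eventually_gt_atTop (2 * q + 1)] with n hn st _
  refine ae_of_all _ fun ω => ?_
  refine le_trans ?_ (le_abs_self _)
  have hnq : 2 * (q : ℝ) + 1 < n := by exact_mod_cast hn
  have hq0 : (0 : ℝ) ≤ q := Nat.cast_nonneg q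
  have hn1 : (1 : ℝ) ≤ n := by linarith
  have hn0 : (0 : ℝ) < n := by linarith
  set R : ℝ := (n : ℝ) ^ (((p : ℝ) + 1) * δ / (2 * (p : ℝ) + 3)) with hR
  have hR1 : 1 ≤ R := Real.one_le_rpow hn1 (by have := hA.delta_pos; positivity)
  have hR0 : 0 ≤ R := by linarith
  have hscale : ∀ w : Fin n → ℝ, √(w ⬝ᵥ w) = √n * √((n : ℝ)⁻¹ * ∑ i, w i ^ 2) := by
    intro w
    rw [← Real.sqrt_mul hn0.le, mul_inv_cancel_left₀ hn0.ne']
    simp [dotProduct, pow_two]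
  have hm' : ∀ t, √(R ^ 2 * meanSqErr x β v T e p K h N n t ω)
      = R * √(meanSqErr x β v T e p K h N n t ω) := fun t => by
    rw [Real.sqrt_mul (sq_nonneg _), Real.sqrt_sq hR0]
  have hb := abs_residCov_sub_le (covMat x n ω) (fVec x β v n st.1 ω)
    (fHatVec x β v T e p K h N n st.1 ω) (fVec x β v n st.2 ω) (fHatVec x β v T e p K h N n st.2 ω)
  simp only [hscale, Pi.sub_apply] at hb
  rw [norm_mul, Real.norm_of_nonneg hR0, Real.norm_eq_abs]
  refine (mul_le_mul_of_nonneg_left hb hR0).trans ?_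
  rw [hm', hm']
  simp only [meanSqErr]
  set d₁ := √((n : ℝ)⁻¹ * ∑ i, (fHatVec x β v T e p K h N n st.1 ω i - fVec x β v n st.1 ω i) ^ 2)
  set d₂ := √((n : ℝ)⁻¹ * ∑ i, (fHatVec x β v T e p K h N n st.2 ω i - fVec x β v n st.2 ω i) ^ 2)
  set w₁ := √((n : ℝ)⁻¹ * ∑ i, fVec x β v n st.1 ω i ^ 2)
  set w₂ := √((n : ℝ)⁻¹ * ∑ i, fVec x β v n st.2 ω i ^ 2)
  have hd₁ : 0 ≤ d₁ := Real.sqrt_nonneg _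
  have hd₂ : 0 ≤ d₂ := Real.sqrt_nonneg _
  have hw₁ : 0 ≤ w₁ := Real.sqrt_nonneg _
  have hw₂ : 0 ≤ w₂ := Real.sqrt_nonneg _
  have hinv : |((n : ℝ) - q)⁻¹| * n ≤ 2 := by
    rw [abs_of_pos (inv_pos.2 (by linarith)), inv_mul_le_iff₀ (by linarith)]
    linarith
  have hsq : √(n : ℝ) * √(n : ℝ) = n := Real.mul_self_sqrt hn0.le
  -- The product of two errors is controlled at the better rate `R ^ 2`; only one factor `R` is
  -- required, and `R ≥ 1`.
  have hdd : d₁ * d₂ ≤ R * (d₁ * d₂) := le_mul_of_one_le_left (by positivity) hR1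
  calc R * (|((n : ℝ) - q)⁻¹| * (√n * d₁ * (√n * d₂) + √n * d₁ * (√n * w₂)
        + √n * w₁ * (√n * d₂)))
      = (|((n : ℝ) - q)⁻¹| * (√n * √n)) * (R * (d₁ * d₂ + d₁ * w₂ + w₁ * d₂)) := by ring
    _ ≤ 2 * (R * (d₁ * d₂ + d₁ * w₂ + w₁ * d₂)) := by
        rw [hsq]
        exact mul_le_mul_of_nonneg_right hinv (by positivity)
    _ ≤ 2 * (R * (R * (d₁ * d₂) + d₁ * w₂ + w₁ * d₂)) := by gcongr
    _ = _ := by ring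

end Model

/-! ### A multivariate central limit theorem -/


section CLT

variable {Ω : Type*} [MeasurableSpace Ω] {P : Measure Ω} [IsProbabilityMeasure P]
  {ι : Type*} [Fintype ι] [DecidableEq ι]

lemma charFun_map_inner {μ : Measure (EuclideanSpace ℝ ι)} (t : EuclideanSpace ℝ ι) :
    charFun (μ.map fun y => inner ℝ y t) 1 = charFun μ t := by
  rw [charFun_apply, charFun_apply, integral_map (by fun_prop) (by fun_prop)]
  simp

/-- Linear combination of the coordinates. -/
lemma inner_eq_sum_mul (y t : EuclideanSpace ℝ ι) : inner ℝ y t = ∑ c, t c * y c := by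
  simp [PiLp.inner_apply]

lemma integral_sq_sum_eq {Y : Ω → ι → ℝ} {V : Matrix ι ι ℝ} (hY : ∀ c, MemLp (fun ω => Y ω c) 2 P)
    (hV : ∀ c d, ∫ ω, Y ω c * Y ω d ∂P = V c d) (t : ι → ℝ) :
    ∫ ω, (∑ c, t c * Y ω c) ^ 2 ∂P = t ⬝ᵥ V *ᵥ t := by
  have h1 : ∀ ω, (∑ c, t c * Y ω c) ^ 2 = ∑ c, ∑ d, t c * t d * (Y ω c * Y ω d) := by
    intro ω
    rw [pow_two, Finset.sum_mul_sum]
    exact Finset.sum_congr rfl fun c _ => Finset.sum_congr rfl fun d _ => by ring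
  have hi : ∀ c d, Integrable (fun ω => t c * t d * (Y ω c * Y ω d)) P := fun c d =>
    ((hY c).integrable_mul (hY d)).const_mul _
  simp_rw [h1]
  rw [integral_finsetSum _ fun c _ => integrable_finsetSum _ fun d _ => hi c d]
  simp only [dotProduct, Matrix.mulVec, Finset.mul_sum]
  refine Finset.sum_congr rfl fun c _ => ?_
  rw [integral_finsetSum _ fun d _ => hi c d]
  refine Finset.sum_congr rfl fun d _ => ?_
  rw [integral_const_mul, hV]
  ring

lemma posSemidef_of_integral_mul {Y : Ω → ι → ℝ} {V : Matrix ι ι ℝ}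
    (hY : ∀ c, MemLp (fun ω => Y ω c) 2 P) (hV : ∀ c d, ∫ ω, Y ω c * Y ω d ∂P = V c d) :
    V.PosSemidef := by
  refine Matrix.PosSemidef.of_dotProduct_mulVec_nonneg ?_ fun t => ?_
  · ext c d
    simp only [Matrix.conjTranspose_apply, star_trivial]
    rw [← hV, ← hV]
    simp only [mul_comm]
  · rw [star_trivial, ← integral_sq_sum_eq hY hV]
    exact integral_nonneg fun ω => sq_nonneg _

/-- **Multivariate central limit theorem** for centred square-integrable i.i.d. vectors. -/
theorem tendstoInDistribution_inv_sqrt_smul_sum {Y : ℕ → Ω → EuclideanSpace ℝ ι}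
    {V : Matrix ι ι ℝ} (hind : iIndepFun Y P) (hid : ∀ i, IdentDistrib (Y i) (Y 0) P P)
    (hL : ∀ c, MemLp (fun ω => Y 0 ω c) 2 P) (h0 : ∀ c, ∫ ω, Y 0 ω c ∂P = 0)
    (hV : ∀ c d, ∫ ω, Y 0 ω c * Y 0 ω d ∂P = V c d) :
    TendstoInDistribution (fun (n : ℕ) ω => (√(n : ℝ))⁻¹ • ∑ i ∈ Finset.range n, Y i ω) atTop id
      (fun _ => P) (multivariateGaussian 0 V) where
  forall_aemeasurable n := by
    have := fun i => (hid i).aemeasurable_fst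
    fun_prop
  tendsto := by
    have hVpos : V.PosSemidef := posSemidef_of_integral_mul (Y := fun ω => Y 0 ω) hL hV
    refine ProbabilityMeasure.tendsto_iff_tendsto_charFun.2 fun t => ?_
    let φ : EuclideanSpace ℝ ι → ℝ := fun y => inner ℝ y t
    have hφ : Measurable φ := by fun_prop
    have hφY : ∀ ω, φ (Y 0 ω) = ∑ c, t c * Y 0 ω c := fun ω => inner_eq_sum_mul _ _
    have hZL : MemLp (fun ω => φ (Y 0 ω)) 2 P := by
      simp only [hφY]
      exact memLp_finsetSum _ fun c _ => (hL c).const_mul _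
    have hZ0 : ∫ ω, φ (Y 0 ω) ∂P = 0 := by
      simp only [hφY]
      rw [integral_finsetSum _ fun c _ => ((hL c).integrable (by norm_num)).const_mul _]
      simp [integral_const_mul, h0]
    have hvar : Var[fun ω => φ (Y 0 ω); P] = t ⬝ᵥ V *ᵥ t := by
      rw [variance_of_integral_eq_zero hZL.aemeasurable hZ0]
      simp only [hφY]
      exact integral_sq_sum_eq (Y := fun ω => Y 0 ω) hL hV t
    -- Cramér–Wold: the characteristic function of the vector sum at `t` is that of its projection
    -- onto `t` at the point one, to which the scalar central limit theorem applies.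
    have hscal := tendstoInDistribution_inv_sqrt_mul_sum_sub (P := P)
      (X := fun i ω => φ (Y i ω)) (Y := id)
      (P' := gaussianReal 0 Var[fun ω => φ (Y 0 ω); P].toNNReal) HasLaw.id hZL
      (hind.comp (fun _ => φ) fun _ => hφ) (fun i => (hid i).comp hφ)
    have hc := ProbabilityMeasure.tendsto_iff_tendsto_charFun.1 hscal.tendsto 1
    simp only [ProbabilityMeasure.coe_mk] at hc ⊢
    rw [Measure.map_id] at hc ⊢
    rw [charFun_multivariateGaussian hVpos]
    rw [charFun_gaussianReal] at hc
    convert hc using 1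
    · funext n
      rw [← charFun_map_inner, AEMeasurable.map_map_of_aemeasurable]
      · congr 2
        funext ω
        simp only [Function.comp, hZ0, mul_zero, sub_zero, inner_smul_left, sum_inner]
        simp [φ]
      · exact Measurable.aemeasurable (by fun_prop)
      · have := fun i => (hid i).aemeasurable_fst
        fun_prop
    · rw [hvar]
      have hnn : 0 ≤ t ⬝ᵥ V *ᵥ t := by
        rw [← hvar]
        exact variance_nonneg _ _
      simp [Real.coe_toNNReal _ hnn]

end CLT

/-! ### Asymptotic normality of the ideal estimator -/

section Aux

variable {Ω : Type*} [MeasurableSpace Ω] {P : Measure Ω}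

/-- Independence factorises the expectation of the product of squares, so no fourth moments are
needed. -/
lemma memLp_two_mul_of_indepFun {f g : Ω → ℝ} (hfg : IndepFun f g P) (hf : MemLp f 2 P)
    (hg : MemLp g 2 P) : MemLp (fun ω => f ω * g ω) 2 P := by
  have hm : AEStronglyMeasurable (fun ω => f ω * g ω) P :=
    hf.aestronglyMeasurable.mul hg.aestronglyMeasurable
  rw [memLp_two_iff_integrable_sq hm]
  have h1 := (hfg.comp (φ := fun y : ℝ => y ^ 2) (ψ := fun y : ℝ => y ^ 2) (by fun_prop)
    (by fun_prop)).integrable_mul hf.integrable_sq hg.integrable_sq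
  refine h1.congr (ae_of_all _ fun ω => ?_)
  simp [mul_pow]

/-- Sums of norms at finitely many parameters are bounded in probability. -/
lemma IsOUP.sum_range {E : Type*} [NormedAddCommGroup E] {κ : Type*} [Fintype κ] {s : κ → ℝ}
    {X : ℕ → ℝ → Ω → E} (hX : IsOUP P (fun _ => range s) X) :
    IsOUP P (fun _ => (univ : Set Unit)) fun n _ ω => ∑ c, ‖X n (s c) ω‖ := by
  classical
  have hc : ∀ c, IsOUP P (fun _ => (univ : Set Unit)) fun n _ ω => ‖X n (s c) ω‖ := fun c =>
    (hX.comp (B := fun _ => (univ : Set Unit)) (fun _ => s c) fun _ _ _ => mem_range_self c).mono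
      (Eventually.of_forall fun n _ _ => ae_of_all _ fun ω => by simp)
  have : ∀ F : Finset κ, IsOUP P (fun _ => (univ : Set Unit))
      fun n _ ω => ∑ c ∈ F, ‖X n (s c) ω‖ := by
    intro F
    induction F using Finset.induction_on with
    | empty =>
      intro ε hε
      exact ⟨0, Eventually.of_forall fun n _ _ => by simp⟩
    | insert c F hcF ih =>
      simp only [Finset.sum_insert hcF]
      exact (hc c).add ih
  exact this Finset.univ

/-- A null sequence times a sequence bounded in probability tends to zero in probability. -/
lemma IsOUP.tendstoInMeasure_zero {E : Type*} [NormedAddCommGroup E] {R : ℕ → Unit → Ω → ℝ}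
    (hR : IsOUP P (fun _ => univ) R) {r : ℕ → ℝ} (hr0 : ∀ n, 0 ≤ r n)
    (hr : Tendsto r atTop (nhds 0)) {Z : ℕ → Ω → E}
    (hZ : ∀ᶠ n in atTop, ∀ ω, ‖Z n ω‖ ≤ r n * ‖R n () ω‖) :
    TendstoInMeasure P Z atTop 0 := by
  rw [tendstoInMeasure_iff_norm]
  intro ε hε
  rw [ENNReal.tendsto_nhds_zero]
  intro η hη
  by_cases hη_top : η = ∞
  · simp [hη_top]
  obtain ⟨M, hM⟩ := hR η.toReal (ENNReal.toReal_pos hη.ne' hη_top)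
  rw [ENNReal.ofReal_toReal hη_top] at hM
  have hrM : ∀ᶠ n in atTop, r n * M < ε := by
    have := hr.mul_const M
    rw [zero_mul] at this
    exact this.eventually_lt_const hε
  filter_upwards [hM, hrM, hZ] with n h1 h2 h3
  refine (measure_mono fun ω hω => ?_).trans (h1 () (mem_univ _))
  have hω' : ε ≤ ‖Z n ω‖ := by simpa using hω
  change M < ‖R n () ω‖
  by_contra hcon
  have := mul_le_mul_of_nonneg_left (not_lt.1 hcon) (hr0 n)
  linarith [h3 ω]

lemma norm_toLp_le_sum {κ ι : Type*} [Fintype κ] [Fintype ι] (w : κ → ι → ℝ) :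
    ‖(WithLp.toLp 2 (fun cr : κ × ι => w cr.1 cr.2) : EuclideanSpace ℝ (κ × ι))‖
      ≤ Fintype.card ι * ∑ c, ‖w c‖ := by
  have h1 : ‖(WithLp.toLp 2 (fun cr : κ × ι => w cr.1 cr.2) : EuclideanSpace ℝ (κ × ι))‖
      ≤ ∑ cr : κ × ι, |w cr.1 cr.2| := by
    rw [EuclideanSpace.norm_eq]
    refine Real.sqrt_le_iff.2 ⟨Finset.sum_nonneg fun _ _ => abs_nonneg _, ?_⟩
    exact Finset.sum_sq_le_sq_sum_of_nonneg fun _ _ => abs_nonneg _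
  refine h1.trans ?_
  rw [Fintype.sum_prod_type, Finset.mul_sum]
  refine Finset.sum_le_sum fun c _ => ?_
  calc ∑ r, |w c r| ≤ ∑ _r : ι, ‖w c‖ := Finset.sum_le_sum fun r _ => norm_le_pi_norm (w c) r
    _ = _ := by simp

end Aux

section Model

variable {Ω Ω₀ : Type*} [MeasurableSpace Ω] [MeasurableSpace Ω₀]
  {P : Measure Ω} [IsProbabilityMeasure P] {P₀ : Measure Ω₀} [IsProbabilityMeasure P₀]
  {a b : ℝ} {U : Set ℝ} {q : ℕ} {x : ℕ → Ω → (Fin q → ℝ)} {β : ℝ → (Fin q → ℝ)}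
  {v : ℕ → ℝ → Ω → ℝ} {T e : ℕ → ℕ → Ω → ℝ} {ε : ℝ → Ω₀ → ℝ} {γ : ℝ → ℝ → ℝ} {σsq dens : ℝ → ℝ}
  {p : ℕ} {K : ℝ → ℝ} {N : ℕ → ℕ → ℕ} {C δ : ℝ} {h : ℕ → ℝ}

/-- The subject effects of the first `n` subjects. -/
def effVec (v : ℕ → ℝ → Ω → ℝ) (n : ℕ) (t : ℝ) (ω : Ω) : Fin n → ℝ := fun i => v i t ω

lemma secondMoment_transpose : (secondMoment P x)ᵀ = secondMoment P x := by
  ext r s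
  simp [secondMoment, mul_comm]

lemma inv_secondMoment_symm (r s : Fin q) :
    (secondMoment P x)⁻¹ r s = (secondMoment P x)⁻¹ s r := by
  have := Matrix.transpose_nonsing_inv (secondMoment P x)
  rw [secondMoment_transpose] at this
  exact (congrFun (congrFun this s) r)

/-- Whitening turns the second moment `Om` into `Om⁻¹ * Om * Om⁻¹ = Om⁻¹`, by symmetry of `Om`. -/
lemma integral_whitened_mul (hB : ConditionB P U x v) (r s : Fin q) :
    ∫ ω, ((secondMoment P x)⁻¹ *ᵥ x 0 ω) r * ((secondMoment P x)⁻¹ *ᵥ x 0 ω) s ∂P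
      = (secondMoment P x)⁻¹ r s := by
  set Om := secondMoment P x with hOm
  have hdet : IsUnit Om.det := (Matrix.isUnit_iff_isUnit_det _).1 hB.x_inv
  have h1 : ∀ ω, (Om⁻¹ *ᵥ x 0 ω) r * (Om⁻¹ *ᵥ x 0 ω) s
      = ∑ k, ∑ l, Om⁻¹ r k * Om⁻¹ s l * (x 0 ω k * x 0 ω l) := by
    intro ω
    simp only [Matrix.mulVec, dotProduct]
    rw [Finset.sum_mul_sum]
    exact Finset.sum_congr rfl fun k _ => Finset.sum_congr rfl fun l _ => by ring
  have hi : ∀ k l, Integrable (fun ω => Om⁻¹ r k * Om⁻¹ s l * (x 0 ω k * x 0 ω l)) P := fun k l =>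
    ((hB.memLp_apply 0 k).integrable_mul (hB.memLp_apply 0 l)).const_mul _
  simp_rw [h1]
  rw [integral_finsetSum _ fun k _ => integrable_finsetSum _ fun l _ => hi k l]
  have h2 : ∀ k, ∫ ω, ∑ l, Om⁻¹ r k * Om⁻¹ s l * (x 0 ω k * x 0 ω l) ∂P
      = Om⁻¹ r k * ∑ l, Om k l * Om⁻¹ l s := by
    intro k
    rw [integral_finsetSum _ fun l _ => hi k l, Finset.mul_sum]
    refine Finset.sum_congr rfl fun l _ => ?_
    rw [integral_const_mul, inv_secondMoment_symm l s]
    change _ * Om k l = _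
    ring
  have h3 : ∀ k, ∑ l, Om k l * Om⁻¹ l s = (1 : Matrix (Fin q) (Fin q) ℝ) k s := fun k => by
    rw [← Matrix.mul_nonsing_inv _ hdet, Matrix.mul_apply]
  simp only [h2, h3, Matrix.one_apply, mul_ite, mul_one, mul_zero, Finset.sum_ite_eq',
    Finset.mem_univ, if_true]

/-- The summands are i.i.d. across subjects. Independence of covariate and effect makes them centred
and square-integrable, and their covariance factors into `γ` times the inverse second moment. -/
lemma clt_whitened (hmodel : IsModel P P₀ a b x v T e ε γ σsq) (hB : ConditionB P U x v) {k : ℕ}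
    {s : Fin k → ℝ} (hs : ∀ c, s c ∈ Icc a b) :
    TendstoInDistribution (fun (n : ℕ) ω => (√(n : ℝ))⁻¹ • ∑ i ∈ Finset.range n,
        (WithLp.toLp 2 (fun cr : Fin k × Fin q => ((secondMoment P x)⁻¹ *ᵥ x i ω) cr.2 *
          v i (s cr.1) ω) : EuclideanSpace ℝ (Fin k × Fin q))) atTop id (fun _ => P)
      (multivariateGaussian 0 (Matrix.of fun cr ds : Fin k × Fin q =>
        (γ (s cr.1) (s ds.1) • (secondMoment P x)⁻¹) cr.2 ds.2)) := by
  set Oi := (secondMoment P x)⁻¹ with hOi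
  let Ψ : (Fin q → ℝ) × (Icc a b → ℝ) × (ℕ → ℝ) × (ℕ → ℝ) → EuclideanSpace ℝ (Fin k × Fin q) :=
    fun z => WithLp.toLp 2 fun cr : Fin k × Fin q =>
      (Oi *ᵥ z.1) cr.2 * z.2.1 ⟨s cr.1, hs cr.1⟩
  have hΨ : Measurable Ψ := by
    refine (WithLp.measurable_toLp 2 _).comp (measurable_pi_lambda _ fun cr => ?_)
    simp only [Matrix.mulVec, dotProduct]
    fun_prop
  have hlin : ∀ r, Measurable fun y : Fin q → ℝ => (Oi *ᵥ y) r := fun r => by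
    simp only [Matrix.mulVec, dotProduct]
    fun_prop
  have hxL : ∀ r, MemLp (fun ω => (Oi *ᵥ x 0 ω) r) 2 P := fun r => by
    simp only [Matrix.mulVec, dotProduct]
    exact memLp_finsetSum _ fun m _ => (hB.memLp_apply 0 m).const_mul _
  have hvL : ∀ c, MemLp (v 0 (s c)) 2 P := fun c => (hmodel.v_sp 0).memLp _ (hs c)
  have hev : ∀ c, Measurable fun z : (Icc a b → ℝ) × (ℕ → ℝ) => z.1 ⟨s c, hs c⟩ := fun c => by
    fun_prop
  have hind : ∀ r c, IndepFun (fun ω => (Oi *ᵥ x 0 ω) r) (v 0 (s c)) P := fun r c =>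
    (hmodel.x_indep 0).comp (hlin r) (hev c)
  refine tendstoInDistribution_inv_sqrt_smul_sum
    (Y := fun i ω => Ψ (x i ω, vPath a b v i ω, design T i ω, design e i ω))
    (hmodel.subjects_indep.comp (fun _ => Ψ) fun _ => hΨ)
    (fun i => (hmodel.subjects_ident i).comp hΨ) (fun cr => ?_) (fun cr => ?_) (fun cr ds => ?_)
  · exact memLp_two_mul_of_indepFun (hind cr.2 cr.1) (hxL cr.2) (hvL cr.1)
  · change ∫ ω, (Oi *ᵥ x 0 ω) cr.2 * v 0 (s cr.1) ω ∂P = 0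
    rw [(hind cr.2 cr.1).integral_fun_mul_eq_mul_integral (hxL _).aestronglyMeasurable
      (hvL _).aestronglyMeasurable, (hmodel.v_sp 0).mean _ (hs _)]
    simp
  · change ∫ ω, (Oi *ᵥ x 0 ω) cr.2 * v 0 (s cr.1) ω * ((Oi *ᵥ x 0 ω) ds.2 * v 0 (s ds.1) ω) ∂P
      = γ (s cr.1) (s ds.1) * Oi cr.2 ds.2
    have hprod : IndepFun (fun ω => (Oi *ᵥ x 0 ω) cr.2 * (Oi *ᵥ x 0 ω) ds.2)
        (fun ω => v 0 (s cr.1) ω * v 0 (s ds.1) ω) P :=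
      (hmodel.x_indep 0).comp ((hlin cr.2).mul (hlin ds.2)) ((hev cr.1).mul (hev ds.1))
    have h1 := hprod.integral_fun_mul_eq_mul_integral
      ((hxL _).aestronglyMeasurable.mul (hxL _).aestronglyMeasurable)
      ((hvL _).aestronglyMeasurable.mul (hvL _).aestronglyMeasurable)
    rw [integral_whitened_mul hB, (hmodel.v_sp 0).integral_mul (hs _) (hs _)] at h1
    rw [mul_comm (γ _ _), ← h1]
    exact integral_congr_ae (ae_of_all _ fun ω => by ring)

/-- The second-moment matrix and its inverse are inserted between the inverse Gram matrix and the
covariates. The first factor then tends to the identity and the second is the whitened sum, which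
already has the desired limit: the form suited to Slutsky's lemma. -/
lemma sqrt_smul_lsCoef_effVec (hB : ConditionB P U x v) (n : ℕ) (t : ℝ) (ω : Ω) (r : Fin q) :
    (√(n : ℝ) • lsCoef (covMat x n ω) (effVec v n t ω)) r
      = ∑ l, (∑ m, ((n : ℝ) * ((covMat x n ω)ᵀ * covMat x n ω)⁻¹ r m) * secondMoment P x m l) *
        ((√(n : ℝ))⁻¹ * ∑ i ∈ Finset.range n, ((secondMoment P x)⁻¹ *ᵥ x i ω) l * v i t ω) := by
  set Om := secondMoment P x with hOm
  set G := ((covMat x n ω)ᵀ * covMat x n ω)⁻¹ with hG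
  have hdet : IsUnit Om.det := (Matrix.isUnit_iff_isUnit_det _).1 hB.x_inv
  have hx : ∀ i m, ∑ l, Om m l * (Om⁻¹ *ᵥ x i ω) l = x i ω m := by
    intro i m
    have : Om *ᵥ (Om⁻¹ *ᵥ x i ω) = x i ω := by
      rw [Matrix.mulVec_mulVec, Matrix.mul_nonsing_inv _ hdet, Matrix.one_mulVec]
    exact congrFun this m
  have hn : (n : ℝ) * (√(n : ℝ))⁻¹ = √(n : ℝ) := by
    rw [← div_eq_mul_inv, Real.div_sqrt]
  have hL : (√(n : ℝ) • lsCoef (covMat x n ω) (effVec v n t ω)) r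
      = √(n : ℝ) * ∑ m, G r m * ∑ i ∈ Finset.range n, x i ω m * v i t ω := by
    simp only [Pi.smul_apply, smul_eq_mul, lsCoef, Matrix.mulVec, dotProduct,
      Matrix.transpose_apply, Finset.sum_range]
    rfl
  rw [hL]
  calc √(n : ℝ) * ∑ m, G r m * ∑ i ∈ Finset.range n, x i ω m * v i t ω
      = ∑ m, ((n : ℝ) * G r m) * ((√(n : ℝ))⁻¹ *
          ∑ i ∈ Finset.range n, (∑ l, Om m l * (Om⁻¹ *ᵥ x i ω) l) * v i t ω) := by
        simp only [hx, Finset.mul_sum]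
        refine Finset.sum_congr rfl fun m _ => Finset.sum_congr rfl fun i _ => ?_
        linear_combination (-(G r m * (x i ω m * v i t ω))) * hn
    _ = ∑ m, ∑ l, ((n : ℝ) * G r m) * Om m l *
          ((√(n : ℝ))⁻¹ * ∑ i ∈ Finset.range n, (Om⁻¹ *ᵥ x i ω) l * v i t ω) := by
        refine Finset.sum_congr rfl fun m _ => ?_
        simp only [Finset.sum_mul]
        rw [Finset.sum_comm]
        simp only [Finset.mul_sum]
        exact Finset.sum_congr rfl fun l _ => Finset.sum_congr rfl fun i _ => by ring
    _ = _ := by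
        rw [Finset.sum_comm]
        exact Finset.sum_congr rfl fun l _ => by rw [Finset.sum_mul]

/-- The least-squares coefficients of the subject effects are asymptotically Gaussian. -/
lemma clt_lsCoef_effVec (hmodel : IsModel P P₀ a b x v T e ε γ σsq) (hB : ConditionB P U x v)
    {k : ℕ} {s : Fin k → ℝ} (hs : ∀ c, s c ∈ Icc a b) :
    TendstoInDistribution (fun (n : ℕ) ω =>
        (WithLp.toLp 2 (fun cr : Fin k × Fin q =>
          (√(n : ℝ) • lsCoef (covMat x n ω) (effVec v n (s cr.1) ω)) cr.2) :
          EuclideanSpace ℝ (Fin k × Fin q))) atTop id (fun _ => P)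
      (multivariateGaussian 0 (Matrix.of fun cr ds : Fin k × Fin q =>
        (γ (s cr.1) (s ds.1) • (secondMoment P x)⁻¹) cr.2 ds.2)) := by
  have hclt := clt_whitened hmodel hB hs
  set Om := secondMoment P x with hOm
  have hdet : IsUnit Om.det := (Matrix.isUnit_iff_isUnit_det _).1 hB.x_inv
  let A : ℕ → Ω → Fin q → Fin q → ℝ := fun n ω r m =>
    (n : ℝ) * ((covMat x n ω)ᵀ * covMat x n ω)⁻¹ r m
  have hAm : ∀ n, Measurable (A n) := fun n => measurable_pi_lambda _ fun r =>
    measurable_pi_lambda _ fun m => (measurable_inv_gram hmodel.x_measurable n r m).const_mul _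
  have hA : TendstoInMeasure P A atTop fun _ r m => Om⁻¹ r m := by
    refine tendstoInMeasure_of_tendsto_ae (fun n => (hAm n).aestronglyMeasurable) ?_
    filter_upwards [hB.ae_tendsto_inv_gram] with ω hω
    exact tendsto_pi_nhds.2 fun r => tendsto_pi_nhds.2 fun m => hω r m
  let g : EuclideanSpace ℝ (Fin k × Fin q) × (Fin q → Fin q → ℝ) →
      EuclideanSpace ℝ (Fin k × Fin q) := fun z =>
    WithLp.toLp 2 fun cr : Fin k × Fin q => ∑ l, (∑ m, z.2 cr.2 m * Om m l) * z.1 (cr.1, l)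
  have hg : Continuous g := by
    refine (PiLp.continuous_toLp 2 _).comp (continuous_pi fun cr => ?_)
    fun_prop
  have hlim := hclt.continuous_comp_prodMk_of_tendstoInMeasure_const hg hA
    fun n => (hAm n).aemeasurable
  -- In the limit the matrix argument of `g` is the inverse of `Om`, so `g` acts as the identity on
  -- the Gaussian vector.
  refine hlim.congr (fun n => ae_of_all _ fun ω => ?_) (ae_of_all _ fun y => ?_)
  · simp only [g, A]
    congr 1
    funext cr
    rw [sqrt_smul_lsCoef_effVec hB]
    refine Finset.sum_congr rfl fun l _ => ?_
    simp [hOm]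
  · simp only [g, id]
    ext cr
    have h1 : ∀ l, ∑ m, Om⁻¹ cr.2 m * Om m l = (1 : Matrix (Fin q) (Fin q) ℝ) cr.2 l := fun l => by
      rw [← Matrix.nonsing_inv_mul _ hdet, Matrix.mul_apply]
    simp [h1, Matrix.one_apply]

lemma aemeasurable_lsCoef (hx : ∀ i, Measurable (x i)) (n : ℕ) {f : Ω → Fin n → ℝ}
    (hf : ∀ i, AEMeasurable (fun ω => f ω i) P) (r : Fin q) :
    AEMeasurable (fun ω => lsCoef (covMat x n ω) (f ω) r) P := by
  simp only [lsCoef, Matrix.mulVec, dotProduct]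
  refine Finset.aemeasurable_fun_sum _ fun m _ =>
    (measurable_inv_gram hx n r m).aemeasurable.mul ?_
  refine Finset.aemeasurable_fun_sum _ fun i _ => AEMeasurable.mul ?_ (hf i)
  exact ((measurable_pi_apply m).comp (hx i)).aemeasurable

lemma aemeasurable_toLp_sqrt_smul (hx : ∀ i, Measurable (x i)) {k : ℕ} (s : Fin k → ℝ) (n : ℕ)
    {f : ℝ → Ω → Fin n → ℝ} (hf : ∀ c i, AEMeasurable (fun ω => f (s c) ω i) P) :
    AEMeasurable (fun ω => (WithLp.toLp 2 (fun cr : Fin k × Fin q =>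
      (√(n : ℝ) • (lsCoef (covMat x n ω) (f (s cr.1) ω) - β (s cr.1))) cr.2) :
      EuclideanSpace ℝ (Fin k × Fin q))) P := by
  refine (WithLp.measurable_toLp 2 _).comp_aemeasurable (aemeasurable_pi_lambda _ fun cr => ?_)
  exact ((aemeasurable_lsCoef hx n (hf cr.1) cr.2).sub_const _).const_mul _

/-- On nonsingular designs the ideal estimator is the truth plus the regression of the effects. -/
lemma lsCoef_fVec_eq (n : ℕ) (t : ℝ) (ω : Ω)
    (hdet : IsUnit ((covMat x n ω)ᵀ * covMat x n ω).det) :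
    lsCoef (covMat x n ω) (fVec x β v n t ω) - β t
      = lsCoef (covMat x n ω) (effVec v n t ω) := by
  have h1 : fVec x β v n t ω = covMat x n ω *ᵥ β t + effVec v n t ω := rfl
  have h2 : lsCoef (covMat x n ω) (covMat x n ω *ᵥ β t) = β t := by
    rw [lsCoef, Matrix.mulVec_mulVec, Matrix.mulVec_mulVec, Matrix.mul_assoc,
      Matrix.nonsing_inv_mul _ hdet, Matrix.one_mulVec]
  rw [h1, lsCoef_add, h2, add_sub_cancel_left]

lemma ConditionB.ae_eventually_isUnit (hB : ConditionB P U x v) :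
    ∀ᵐ ω ∂P, ∀ᶠ n : ℕ in atTop, IsUnit ((covMat x n ω)ᵀ * covMat x n ω).det := by
  filter_upwards [hB.ae_tendsto_gram] with ω hω
  have hA : Tendsto (fun n : ℕ => (n : ℝ)⁻¹ • ((covMat x n ω)ᵀ * covMat x n ω)) atTop
      (nhds (secondMoment P x)) := tendsto_pi_nhds.2 fun r => tendsto_pi_nhds.2 fun s => hω r s
  have hdet : Tendsto (fun n : ℕ => ((n : ℝ)⁻¹ • ((covMat x n ω)ᵀ * covMat x n ω)).det) atTop
      (nhds (secondMoment P x).det) :=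
    ((Continuous.matrix_det continuous_id).tendsto _).comp hA
  have h0 : (secondMoment P x).det ≠ 0 :=
    ((Matrix.isUnit_iff_isUnit_det _).1 hB.x_inv).ne_zero
  filter_upwards [hdet.eventually_ne h0] with n hn
  rw [isUnit_iff_ne_zero]
  intro hz
  rw [Matrix.det_smul, hz, mul_zero] at hn
  exact hn rfl

/-- The ideal estimator is asymptotically Gaussian. -/
lemma clt_lsCoef_fVec (hUI : U ⊆ Icc a b) (hmodel : IsModel P P₀ a b x v T e ε γ σsq)
    (hB : ConditionB P U x v) {k : ℕ} {s : Fin k → ℝ} (hs : ∀ c, s c ∈ U) :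
    TendstoInDistribution (fun (n : ℕ) ω =>
        (WithLp.toLp 2 (fun cr : Fin k × Fin q =>
          (√(n : ℝ) • (lsCoef (covMat x n ω) (fVec x β v n (s cr.1) ω) - β (s cr.1))) cr.2) :
          EuclideanSpace ℝ (Fin k × Fin q))) atTop id (fun _ => P)
      (multivariateGaussian 0 (Matrix.of fun cr ds : Fin k × Fin q =>
        (γ (s cr.1) (s ds.1) • (secondMoment P x)⁻¹) cr.2 ds.2)) := by
  have hclt := clt_lsCoef_effVec hmodel hB fun c => hUI (hs c)
  have hm : ∀ n : ℕ, AEMeasurable (fun ω => (WithLp.toLp 2 (fun cr : Fin k × Fin q =>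
      (√(n : ℝ) • (lsCoef (covMat x n ω) (fVec x β v n (s cr.1) ω) - β (s cr.1))) cr.2) :
      EuclideanSpace ℝ (Fin k × Fin q))) P := fun n =>
    aemeasurable_toLp_sqrt_smul hmodel.x_measurable s n (f := fun t ω => fVec x β v n t ω)
      fun c i => (measurable_fVec hUI hmodel n (hs c) i).aemeasurable
  refine tendstoInDistribution_of_tendstoInMeasure_sub _ _ hclt ?_ hm
  refine tendstoInMeasure_of_tendsto_ae
    (fun n => ((hm n).sub (hclt.forall_aemeasurable n)).aestronglyMeasurable) ?_
  -- The two vectors can differ only when the Gram matrix is singular, which almost surely happens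
  -- for finitely many `n` only.
  filter_upwards [hB.ae_eventually_isUnit] with ω hω
  refine tendsto_const_nhds.congr' ?_
  filter_upwards [hω] with n hn
  simp only [Pi.sub_apply, Pi.zero_apply, lsCoef_fVec_eq n _ ω hn, sub_self]

/-- The estimated coefficient functions are asymptotically a Gaussian process. -/
lemma isAGP_lsCoef_fHat (hab : a < b) (hU : U = Ioo a b ∨ U = Icc a b)
    (hmodel : IsModel P P₀ a b x v T e ε γ σsq)
    (hA : ConditionA P a b U x β v T γ σsq dens p K N C δ h) (hB : ConditionB P U x v)
    (hh : h =Θ[atTop] (fun n : ℕ => (n : ℝ) ^ (-(δ / (2 * (p : ℝ) + 3)))))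
    (hδ : 1 + 1 / (2 * ((p : ℝ) + 1)) < δ) :
    IsAGP P U (fun (n : ℕ) (t : ℝ) (ω : Ω) => √(n : ℝ) •
        (lsCoef (covMat x n ω) (fHatVec x β v T e p K h N n t ω) - β t))
      (fun s t => γ s t • (secondMoment P x)⁻¹) := by
  intro k s hs
  have hUI := subset_Icc_of_eq hU
  have hm : ∀ n : ℕ, AEMeasurable (fun ω => (WithLp.toLp 2 (fun cr : Fin k × Fin q =>
      (√(n : ℝ) • (lsCoef (covMat x n ω) (fHatVec x β v T e p K h N n (s cr.1) ω)
        - β (s cr.1))) cr.2) : EuclideanSpace ℝ (Fin k × Fin q))) P := fun n =>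
    aemeasurable_toLp_sqrt_smul hmodel.x_measurable s n
      (f := fun t ω => fHatVec x β v T e p K h N n t ω)
      fun c i => aemeasurable_fHatVec hU ⟨s c, hs c⟩ hmodel hA n _ i
  refine tendstoInDistribution_of_tendstoInMeasure_sub _ _
    (clt_lsCoef_fVec (β := β) hUI hmodel hB hs) ?_ hm
  set η : ℝ := ((p : ℝ) + 1) * δ / (2 * (p : ℝ) + 3) with hη
  -- Multiplied by `2 * (p + 1)`, the assumption on `δ` reads `2 * p + 3 < 2 * (p + 1) * δ`, which
  -- is `η > 1 / 2`.
  have hηhalf : 0 < η - 1 / 2 := by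
    have hp : (0 : ℝ) ≤ p := Nat.cast_nonneg p
    have h1 : (1 + 1 / (2 * ((p : ℝ) + 1))) * (2 * (p + 1)) < δ * (2 * (p + 1)) :=
      mul_lt_mul_of_pos_right hδ (by positivity)
    have h2 : (1 + 1 / (2 * ((p : ℝ) + 1))) * (2 * (p + 1)) = 2 * p + 3 := by
      field_simp
      ring
    rw [h2] at h1
    rw [hη, sub_pos, div_lt_div_iff₀ (by norm_num) (by positivity)]
    linarith
  -- Finitely many times form a compact subset of `U`, so the uniform rate applies to them directly.
  have hOUP := (lsCoef_fHat_oup hab hU hmodel hA hB hh (S := range s)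
    (range_subset_iff.2 hs) (finite_range s).isCompact).sum_range
  have hr : Tendsto (fun n : ℕ => (q : ℝ) * (n : ℝ) ^ (-(η - 1 / 2))) atTop (nhds 0) := by
    have := ((tendsto_rpow_neg_atTop hηhalf).comp tendsto_natCast_atTop_atTop).const_mul (q : ℝ)
    rwa [mul_zero] at this
  refine hOUP.tendstoInMeasure_zero (fun n => by positivity) hr ?_
  filter_upwards [eventually_gt_atTop 0] with n hn ω
  have hn' : (0 : ℝ) < n := by exact_mod_cast hn
  rw [← hη]
  set Δ : Fin k → Fin q → ℝ := fun c =>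
    lsCoef (covMat x n ω) (fHatVec x β v T e p K h N n (s c) ω)
      - lsCoef (covMat x n ω) (fVec x β v n (s c) ω) with hΔ
  have h1 : ((fun (n : ℕ) ω => (WithLp.toLp 2 (fun cr : Fin k × Fin q =>
      (√(n : ℝ) • (lsCoef (covMat x n ω) (fHatVec x β v T e p K h N n (s cr.1) ω)
        - β (s cr.1))) cr.2) : EuclideanSpace ℝ (Fin k × Fin q))) -
      fun (n : ℕ) ω => (WithLp.toLp 2 (fun cr : Fin k × Fin q =>
      (√(n : ℝ) • (lsCoef (covMat x n ω) (fVec x β v n (s cr.1) ω)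
        - β (s cr.1))) cr.2) : EuclideanSpace ℝ (Fin k × Fin q))) n ω
      = WithLp.toLp 2 fun cr : Fin k × Fin q => (√(n : ℝ) • Δ cr.1) cr.2 := by
    simp only [Pi.sub_apply]
    rw [← WithLp.toLp_sub]
    congr 1
    funext cr
    simp only [Pi.sub_apply, Pi.smul_apply, smul_eq_mul, hΔ]
    ring
  rw [h1]
  refine (norm_toLp_le_sum fun c => √(n : ℝ) • Δ c).trans (le_of_eq ?_)
  have h2 : √(n : ℝ) = (n : ℝ) ^ (-(η - 1 / 2)) * (n : ℝ) ^ η := by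
    rw [← Real.rpow_add hn', Real.sqrt_eq_rpow]
    congr 1
    ring
  have h3 : 0 ≤ (n : ℝ) ^ η := by positivity
  rw [Real.norm_of_nonneg (Finset.sum_nonneg fun _ _ => norm_nonneg _)]
  simp only [norm_smul, Real.norm_of_nonneg (Real.sqrt_nonneg _), Real.norm_of_nonneg h3,
    Fintype.card_fin, ← Finset.mul_sum]
  rw [h2]
  ring

end Model

end FLM

/-! ### The three assertions together -/

theorem theorem6 {Ω Ω₀ : Type*} [MeasurableSpace Ω] [MeasurableSpace Ω₀]
    (P : Measure Ω) [IsProbabilityMeasure P] (P₀ : Measure Ω₀) [IsProbabilityMeasure P₀]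
    (a b : ℝ) (hab : a < b)
    (U : Set ℝ) (hU : U = Ioo a b ∨ U = Icc a b)
    (q : ℕ) (x : ℕ → Ω → (Fin q → ℝ)) (β : ℝ → (Fin q → ℝ)) (v : ℕ → ℝ → Ω → ℝ)
    (T e : ℕ → ℕ → Ω → ℝ) (ε : ℝ → Ω₀ → ℝ)
    (γ : ℝ → ℝ → ℝ) (σsq dens : ℝ → ℝ)
    (p : ℕ) (hp : Odd p) (K : ℝ → ℝ) (N : ℕ → ℕ → ℕ) (C δ : ℝ) (h : ℕ → ℝ)
    (hmodel : FLM.IsModel P P₀ a b x v T e ε γ σsq)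
    (hA : FLM.ConditionA P a b U x β v T γ σsq dens p K N C δ h)
    (hB : FLM.ConditionB P U x v)
    (hh : h =Θ[atTop] (fun n : ℕ => (n : ℝ) ^ (-(δ / (2 * (p : ℝ) + 3))))) :
    (∀ S ⊆ U, IsCompact S →
      FLM.IsOUP P (fun _ => S) (fun (n : ℕ) (t : ℝ) (ω : Ω) =>
        (n : ℝ) ^ (((p : ℝ) + 1) * δ / (2 * (p : ℝ) + 3)) •
          (FLM.lsCoef (FLM.covMat x n ω) (FLM.fHatVec x β v T e p K h N n t ω)
            - FLM.lsCoef (FLM.covMat x n ω) (FLM.fVec x β v n t ω)))) ∧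
    (∀ S ⊆ U, IsCompact S →
      FLM.IsOUP P (fun _ => S ×ˢ S) (fun (n : ℕ) (st : ℝ × ℝ) (ω : Ω) =>
        (n : ℝ) ^ (((p : ℝ) + 1) * δ / (2 * (p : ℝ) + 3)) *
          (FLM.residCov (FLM.covMat x n ω) (FLM.fHatVec x β v T e p K h N n st.1 ω)
              (FLM.fHatVec x β v T e p K h N n st.2 ω)
            - FLM.residCov (FLM.covMat x n ω) (FLM.fVec x β v n st.1 ω)
              (FLM.fVec x β v n st.2 ω)))) ∧
    (1 + 1 / (2 * ((p : ℝ) + 1)) < δ →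
      FLM.IsAGP P U (fun (n : ℕ) (t : ℝ) (ω : Ω) =>
          Real.sqrt (n : ℝ) •
            (FLM.lsCoef (FLM.covMat x n ω) (FLM.fHatVec x β v T e p K h N n t ω) - β t))
        (fun s t => γ s t • (FLM.secondMoment P x)⁻¹)) :=
  ⟨fun _ hSU hS => FLM.lsCoef_fHat_oup hab hU hmodel hA hB hh hSU hS,
    fun _ hSU hS => FLM.residCov_fHat_oup hab hU hmodel hA hB hh hSU hS,
    fun hδ => FLM.isAGP_lsCoef_fHat hab hU hmodel hA hB hh hδ⟩
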